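/- **Setting.** Let $(X,g)$ be a smooth compact Riemannian manifold, possibly with smooth boundary, with volume measure $\mathrm dx$, Riemannian distance $d_g$ and outward unit normal $\mathbf n$ on $\partial X$. $C(X)$ and $C(X,TX)$ (continuous functions and continuous vector fields) carry the supremum norm; $\mathcal M(X)$ and $\mathcal M(TX)$ are their topological duals with the dual norm $\|\cdot\|$, and $\mathcal M_+(X)$ is the set of positive elements of $\mathcal M(X)$. The spaces $\mathcal M([0,1]\times X)$ and $\mathcal M([0,1]\times TX)$ are likewise the duals of $C([0,1]\times X)$ and of the space $C([0,1]\times X,TX)$ of continuous time-dependent vector fields. Weak convergence is convergence against each continuous test function or field. Put $$A(\rho,\mathbf m)=\sup\Big\{\langle\rho,a\rangle+\langle\mathbf m,\mathbf b\rangle:\ a\in C(X),\ \mathbf b\in C(X,TX),\ a+\tfrac12|\mathbf b|^2\le 0\Big\},\qquad A^\star(\rho,\mathbf b)=\tfrac12\langle\rho,|\mathbf b|^2\rangle ,$$ and define $\mathcal A(\rho,\mathbf m)$ on $\mathcal M([0,1]\times X)\times\mathcal M([0,1]\times TX)$ in the same way with space-time test functions. The set $\mathcal{CE}(\rho_0,\rho_1)$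 consists of the pairs $(\rho,\mathbf m)\in\mathcal M([0,1]\times X)\times\mathcal M([0,1]\times TX)$ such that $\langle\rho,\partial_t\phi\rangle+\langle\mathbf m,\nabla\phi\rangle=\langle\rho_1,\phi(1,\cdot)\rangle-\langle\rho_0,\phi(0,\cdot)\rangle$ for all $\phi\in C^1([0,1]\times X)$; $\mathcal J_{\rho_0,\rho_1}(\rho,\mathbf m)$ is $\mathcal A(\rho,\mathbf m)$ if $(\rho,\mathbf m)\in\mathcal{CE}(\rho_0,\rho_1)$ and $+\infty$ otherwise. A bounded set of $C^q$ is a set of $C^q$ functions (or vector fields) whose derivatives up to order $q$ in charts are uniformly bounded, in a finite atlas with charts shrunk to have bounded transition maps. **Discrete models.** Let $\Sigma\subset(0,\infty)$ have $0$ as an accumulation point; limits $\sigma\to0$ are taken in $\Sigma$, and $(\varepsilon_\sigma)_{\sigma\in\Sigma}$ denotes real numbers tending to $0$ as $\sigma\to 0$. For each $\sigma\in\Sigma$ let $\mathcal X_\sigma,\mathcal Y_\sigma$ be finite dimensional real vector spaces, $\mathcal X_{\sigma,+}\subset\mathcal X_\sigma$ a cone, $\mathrm{Div}_\sigma:\mathcal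 Y_\sigma\to\mathcal X_\sigma$ linear, and $A_\sigma:\mathcal X_\sigma\times\mathcal Y_\sigma\to[0,+\infty]$ proper, convex, positively $(-1)$-homogeneous in the first variable ($A_\sigma(cP,\mathbf M)=c^{-1}A_\sigma(P,\mathbf M)$ for $c>0$), $2$-homogeneous in the second ($A_\sigma(P,c\mathbf M)=c^2A_\sigma(P,\mathbf M)$ for $c\neq0$), with $A_\sigma(P_1+P_2,\mathbf M)\le A_\sigma(P_1,\mathbf M)$ for $P_1,P_2\in\mathcal X_{\sigma,+}$. Put $A^\star_\sigma(P,\mathbf B)=\sup_{\mathbf M}\big(\langle\mathbf M,\mathbf B\rangle-A_\sigma(P,\mathbf M)\big)$ for $\mathbf B$ in the dual $\mathcal Y_\sigma'$. For $N\ge1$, $\tau=1/N$ and $\bar P_0,\bar P_1\in\mathcal X_{\sigma,+}$, set $$\mathcal J^{N,\sigma}_{\bar P_0,\bar P_1}\big((P_k)_{0\le k\le N},(\mathbf M_k)_{1\le k\le N}\big)=\tau\sum_{k=1}^NA_\sigma\Big(\tfrac{P_{k-1}+P_k}2,\mathbf M_k\Big)$$ if all $P_k\in\mathcal X_{\sigma,+}$,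 $P_0=\bar P_0$, $P_N=\bar P_1$ and $\tau^{-1}(P_k-P_{k-1})+\mathrm{Div}_\sigma(\mathbf M_k)=0$ for $1\le k\le N$, and $+\infty$ otherwise. **Adapted families.** Suppose the family is adapted to $X$ with the following linear operators, for each $\sigma\in\Sigma$: $R^{CE}_\sigma,R^A_\sigma:\mathcal X_\sigma\to\mathcal M(X)$, mapping $\mathcal X_{\sigma,+}$ into $\mathcal M_+(X)$; $R_\sigma:\mathcal Y_\sigma\to\mathcal M(TX)$, with adjoint $R_\sigma^\top:C(X,TX)\to\mathcal Y_\sigma'$; $S_\sigma:\mathcal M(X)\to\mathcal X_\sigma$, mapping $\mathcal M_+(X)$ into $\mathcal X_{\sigma,+}$; and $S'_\sigma$, with values in $\mathcal Y_\sigma$, defined on a subspace of $\mathcal M(TX)$ containing all elements with a continuous density. This means that: * (A1) $R^{CE}_\sigma S_\sigma\rho\to\rho$ weakly as $\sigma\to0$, for every $\rho\in\mathcal M_+(X)$. * (A2) For every bounded set $\mathcal B$ of $C^1(X)$ there is $(\varepsilon_\sigma)$ with $\langle(R^{CE}_\sigma-R^A_\sigma)P,\phi\rangle\le\varepsilon_\sigma\|R^{CE}_\sigma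 P\|$ for all $\sigma$, $\phi\in\mathcal B$, $P\in\mathcal X_\sigma$. * (A3) For every bounded set $\mathcal B$ of $C^2(X)$ there is $(\varepsilon_\sigma)$ with $|\langle R^{CE}_\sigma\mathrm{Div}_\sigma\mathbf M,\phi\rangle+\langle R_\sigma\mathbf M,\nabla\phi\rangle|\le\varepsilon_\sigma\|R_\sigma\mathbf M\|$ for all $\sigma$, $\mathbf M\in\mathcal Y_\sigma$, $\phi\in\mathcal B$. * (A4) $S_\sigma(\nabla\cdot\mathbf m)=\mathrm{Div}_\sigma(S'_\sigma\mathbf m)$ for all $\sigma$ and all $\mathbf m$ with a density in $C^1(X,TX)$ satisfying $\mathbf m\cdot\mathbf n=0$ on $\partial X$. * (A5) For every bounded set $\mathcal B$ of $C^1(X,TX)$ there is $(\varepsilon_\sigma)$ with $A^\star_\sigma(P,R_\sigma^\top\mathbf b)\le A^\star(R^A_\sigma P,\mathbf b)+\varepsilon_\sigma\|R^A_\sigma P\|$ for all $\mathbf b\in\mathcal B$, $\sigma$, $P\in\mathcal X_\sigma$; and there is $C\ge1$ with $A^\star_\sigma(P,R_\sigma^\top\mathbf b)\le\frac C2\|R^A_\sigma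 P\|\sup_x|\mathbf b(x)|^2$ for all $\mathbf b\in C(X,TX)$, $\sigma$, $P\in\mathcal X_\sigma$. * (A6) For every bounded set $\mathcal B$ of $C^1(X)$ whose elements are bounded below by a common positive constant, and every bounded set $\mathcal B'$ of $C^1(X,TX)$, there is $(\varepsilon_\sigma)$ with $A_\sigma(S_\sigma\rho,S'_\sigma\mathbf m)\le A(\rho,\mathbf m)+\varepsilon_\sigma$ for all $\sigma$, whenever $\rho$ has a density in $\mathcal B$ and $\mathbf m$ a density in $\mathcal B'$. * (A7) There are $(\varepsilon_\sigma)$ and a continuous $\omega:[0,\infty)\to\mathbb R$ with $\omega(0)=0$ such that for all $x,y\in X$ with $d_g(x,y)<\infty$ and all $\sigma$ there are $\hat P\in\mathcal X_{\sigma,+}$ and $\hat{\mathbf M}_1,\hat{\mathbf M}_2\in\mathcal Y_\sigma$ with $\mathrm{Div}_\sigma\hat{\mathbf M}_1=\hat P-S_\sigma\delta_x$, $\mathrm{Div}_\sigma\hat{\mathbf M}_2=\hat P-S_\sigma\delta_y$ and $A_\sigma(\hat P,\hat{\mathbf M}_i)\le\omega(d_g(x,y))+\varepsilon_\sigma$ for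 $i=1,2$. **Space-time reconstructions.** For $P\in(\mathcal X_\sigma)^{N+1}$, $\mathbf M\in(\mathcal Y_\sigma)^N$ and continuous test objects $\phi$, $\mathbf b$, set $$\langle\mathcal R^{CE}_{N,\sigma}P,\phi\rangle=\sum_{k=1}^N\int_{(k-1)\tau}^{k\tau}\Big\langle\tfrac{k\tau-t}\tau R^{CE}_\sigma P_{k-1}+\tfrac{t-(k-1)\tau}\tau R^{CE}_\sigma P_k,\ \phi(t,\cdot)\Big\rangle\mathrm dt,$$ $$\langle\mathcal R^{A}_{N,\sigma}P,\phi\rangle=\sum_{k=1}^N\int_{(k-1)\tau}^{k\tau}\Big\langle R^A_\sigma\tfrac{P_{k-1}+P_k}2,\phi(t,\cdot)\Big\rangle\mathrm dt,\qquad \langle\mathcal R_{N,\sigma}\mathbf M,\mathbf b\rangle=\sum_{k=1}^N\int_{(k-1)\tau}^{k\tau}\langle R_\sigma\mathbf M_k,\mathbf b(t,\cdot)\rangle\mathrm dt.$$ **Theorem.** Let $\rho_0,\rho_1\in\mathcal M_+(X)$ have the same total mass, and for all $N\ge1$ and $\sigma\in\Sigma$ let $(P^{N,\sigma},\mathbf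 M^{N,\sigma})\in(\mathcal X_\sigma)^{N+1}\times(\mathcal Y_\sigma)^N$ be such that $$\sup_{N\ge1,\ \sigma\in\Sigma}\mathcal J^{N,\sigma}_{S_\sigma\rho_0,S_\sigma\rho_1}(P^{N,\sigma},\mathbf M^{N,\sigma})<+\infty.$$ Let $N_n\to+\infty$ and $\sigma_n\to0$ be arbitrary sequences (with $\sigma_n\in\Sigma$). Then there are a subsequence (of the indices $n$), $\rho\in\mathcal M([0,1]\times X)$ and $\mathbf m\in\mathcal M([0,1]\times TX)$ such that, along the subsequence, $\mathcal R^{CE}_{N_n,\sigma_n}(P^{N_n,\sigma_n})$ and $\mathcal R^{A}_{N_n,\sigma_n}(P^{N_n,\sigma_n})$ both converge weakly to $\rho$ and $\mathcal R_{N_n,\sigma_n}(\mathbf M^{N_n,\sigma_n})$ converges weakly to $\mathbf m$. Moreover $(\rho,\mathbf m)\in\mathcal{CE}(\rho_0,\rho_1)$ and $$\mathcal J_{\rho_0,\rho_1}(\rho,\mathbf m)\le\liminf_{n\to\infty}\mathcal J^{N_n,\sigma_n}_{S_{\sigma_n}\rho_0,S_{\sigma_n}\rho_1}(P^{N_n,\sigma_n},\mathbf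 M^{N_n,\sigma_n}),$$ where the lower limit is taken over the whole sequence. -/

import Mathlib

open Bundle Set Filter MeasureTheory
open scoped Manifold ContDiff Topology ENNReal RealInnerProductSpace

set_option linter.unusedSectionVars false

noncomputable section

namespace DynamicOT

/-! ### The tangent bundle: continuous vector fields and vector measures -/

section Fields

variable {E : Type*} [NormedAddCommGroup E] [NormedSpace ℝ E]
  {H : Type*} [TopologicalSpace H] (I : ModelWithCorners ℝ E H)
  {X : Type*} [TopologicalSpace X] [ChartedSpace H X] [IsManifold I 1 X]
  {T : Type*} [TopologicalSpace T]

/-- The continuous vector fields along a continuous map `f : T → X`, as a subspace of all families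
`v t ∈ T_{f(t)} X`. For `f = id` on `X` this is `C(X, TX)`; for the projection
`[0,1] × X → X` it is `C([0,1] × X, TX)`. -/
def continuousFields (f : C(T, X)) : Submodule ℝ (∀ t, TangentSpace I (f t)) where
  carrier := {v | Continuous fun t => (⟨f t, v t⟩ : TangentBundle I X)}
  zero_mem' := (contMDiff_zeroSection ℝ (TangentSpace I : X → Type _)
    (IB := I) (F := E) (n := 0)).continuous.comp f.continuous
  add_mem' := by
    intro v w hv hw
    rw [mem_ofPred_eq, continuous_iff_continuousAt] at *
    intro t₀
    have hv' := (FiberBundle.continuousAt_totalSpace E _).1 (hv t₀)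
    have hw' := (FiberBundle.continuousAt_totalSpace E _).1 (hw t₀)
    refine (FiberBundle.continuousAt_totalSpace E _).2 ⟨f.continuous.continuousAt, ?_⟩
    refine (hv'.2.add hw'.2).congr ?_
    have hb : ∀ᶠ t in 𝓝 t₀,
        f t ∈ (trivializationAt E (TangentSpace I : X → Type _) (f t₀)).baseSet :=
      f.continuous.continuousAt.eventually
        ((trivializationAt E (TangentSpace I : X → Type _) (f t₀)).open_baseSet.mem_nhds
          (FiberBundle.mem_baseSet_trivializationAt' (f t₀)))
    filter_upwards [hb] with t ht
    exact (((trivializationAt E (TangentSpace I : X → Type _) (f t₀)).linear ℝ ht).map_add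
      (v t) (w t)).symm
  smul_mem' := by
    intro c v hv
    rw [mem_ofPred_eq, continuous_iff_continuousAt] at *
    intro t₀
    have hv' := (FiberBundle.continuousAt_totalSpace E _).1 (hv t₀)
    refine (FiberBundle.continuousAt_totalSpace E _).2 ⟨f.continuous.continuousAt, ?_⟩
    refine (hv'.2.const_smul c).congr ?_
    have hb : ∀ᶠ t in 𝓝 t₀,
        f t ∈ (trivializationAt E (TangentSpace I : X → Type _) (f t₀)).baseSet :=
      f.continuous.continuousAt.eventually
        ((trivializationAt E (TangentSpace I : X → Type _) (f t₀)).open_baseSet.mem_nhds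
          (FiberBundle.mem_baseSet_trivializationAt' (f t₀)))
    filter_upwards [hb] with t ht
    exact (((trivializationAt E (TangentSpace I : X → Type _) (f t₀)).linear ℝ ht).map_smul
      c (v t)).symm

/-- The space of continuous vector fields along `f`, endowed below with the supremum norm. -/
def VectorField (f : C(T, X)) : Type _ := ↥(continuousFields I f)

variable {I}

instance (f : C(T, X)) : AddCommGroup (VectorField I f) :=
  inferInstanceAs (AddCommGroup ↥(continuousFields I f))

instance (f : C(T, X)) : Module ℝ (VectorField I f) :=
  inferInstanceAs (Module ℝ ↥(continuousFields I f))

instance (f : C(T, X)) : CoeFun (VectorField I f) (fun _ => ∀ t, TangentSpace I (f t)) :=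
  ⟨fun v => v.1⟩

theorem VectorField.ext {f : C(T, X)} {v w : VectorField I f} (h : ∀ t, v t = w t) : v = w :=
  Subtype.ext (funext h)

@[simp] theorem VectorField.add_apply {f : C(T, X)} (v w : VectorField I f) (t : T) :
    (v + w) t = v t + w t := rfl

@[simp] theorem VectorField.smul_apply {f : C(T, X)} (c : ℝ) (v : VectorField I f) (t : T) :
    (c • v) t = c • v t := rfl

@[simp] theorem VectorField.zero_apply {f : C(T, X)} (t : T) :
    (0 : VectorField I f) t = 0 := rfl

theorem VectorField.continuous {f : C(T, X)} (v : VectorField I f) :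
    Continuous fun t => (⟨f t, v t⟩ : TangentBundle I X) := v.2

variable [RiemannianBundle (fun x : X => TangentSpace I x)]
  [IsContinuousRiemannianBundle E (fun x : X => TangentSpace I x)]

theorem VectorField.continuous_inner {f : C(T, X)} (v w : VectorField I f) :
    Continuous fun t => ⟪v t, w t⟫ :=
  Continuous.inner_bundle (F := E) (E := fun x : X => TangentSpace I x) v.continuous w.continuous

/-- The continuous function `t ↦ |b(t)|²`. -/
def normSq {f : C(T, X)} (b : VectorField I f) : C(T, ℝ) where
  toFun t := ‖b t‖ ^ 2
  continuous_toFun := by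
    simpa only [real_inner_self_eq_norm_sq] using b.continuous_inner b

theorem VectorField.continuous_norm {f : C(T, X)} (v : VectorField I f) :
    Continuous fun t => ‖v t‖ := by
  have h : (fun t => ‖v t‖) = fun t => Real.sqrt (normSq v t) := by
    funext t
    exact (Real.sqrt_sq (norm_nonneg _)).symm
  rw [h]
  exact (normSq v).continuous.sqrt

instance (f : C(T, X)) : Norm (VectorField I f) := ⟨fun v => ⨆ t, ‖v t‖⟩

theorem VectorField.norm_def {f : C(T, X)} (v : VectorField I f) : ‖v‖ = ⨆ t, ‖v t‖ := rfl

variable [CompactSpace T]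

theorem VectorField.bddAbove {f : C(T, X)} (v : VectorField I f) :
    BddAbove (range fun t => ‖v t‖) :=
  (isCompact_range v.continuous_norm).bddAbove

theorem VectorField.norm_apply_le {f : C(T, X)} (v : VectorField I f) (t : T) :
    ‖v t‖ ≤ ‖v‖ := le_ciSup v.bddAbove t

theorem VectorField.norm_le {f : C(T, X)} {v : VectorField I f} {C : ℝ} (hC : 0 ≤ C)
    (h : ∀ t, ‖v t‖ ≤ C) : ‖v‖ ≤ C := Real.iSup_le h hC

theorem VectorField.normedSpaceCore (f : C(T, X)) : NormedSpace.Core ℝ (VectorField I f) where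
  norm_nonneg v := Real.iSup_nonneg fun t => norm_nonneg _
  norm_smul c v := by
    simp only [VectorField.norm_def, VectorField.smul_apply, norm_smul]
    exact (Real.mul_iSup_of_nonneg (norm_nonneg c) _).symm
  norm_triangle v w := by
    refine VectorField.norm_le
      (add_nonneg (Real.iSup_nonneg fun t => norm_nonneg _) (Real.iSup_nonneg fun t => norm_nonneg _))
      fun t => ?_
    exact (norm_add_le _ _).trans (add_le_add (v.norm_apply_le t) (w.norm_apply_le t))
  norm_eq_zero_iff v := by
    refine ⟨fun h => VectorField.ext fun t => ?_, ?_⟩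
    · exact norm_le_zero_iff.1 (h ▸ v.norm_apply_le t)
    · rintro rfl
      simp [VectorField.norm_def]

instance (f : C(T, X)) : NormedAddCommGroup (VectorField I f) :=
  NormedAddCommGroup.ofCore (VectorField.normedSpaceCore f)

instance (f : C(T, X)) : NormedSpace ℝ (VectorField I f) :=
  NormedSpace.ofCore (VectorField.normedSpaceCore f)

end Fields

/-! ### Integration in time -/

section TimeIntegral

variable {V W : Type*} [NormedAddCommGroup V] [NormedSpace ℝ V]
  [NormedAddCommGroup W] [NormedSpace ℝ W]

/-- Given time slices `s t : W → V` (continuous in `t`, of norm at most one) and a continuous curve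
`μ` of elements of the dual of `V`, this is the element `w ↦ ∫_a^b ⟨μ t, s t w⟩ dt` of the dual
of `W`. -/
def timeIntegral (s : ℝ → W →L[ℝ] V) (hs : ∀ w, Continuous fun t => s t w)
    (hb : ∀ t w, ‖s t w‖ ≤ ‖w‖) (μ : ℝ → StrongDual ℝ V) (hμ : Continuous μ) (a b : ℝ) :
    StrongDual ℝ W :=
  LinearMap.mkContinuousOfExistsBound
    { toFun := fun w => ∫ t in a..b, μ t (s t w)
      map_add' := fun v w => by
        simp only [map_add]
        exact intervalIntegral.integral_add ((hμ.clm_apply (hs v)).intervalIntegrable _ _)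
          ((hμ.clm_apply (hs w)).intervalIntegrable _ _)
      map_smul' := fun c w => by
        simp only [map_smul]
        exact intervalIntegral.integral_smul c _ }
    (by
      obtain ⟨C, hC⟩ := (isCompact_uIcc (a := a) (b := b)).exists_bound_of_continuousOn
        hμ.continuousOn
      refine ⟨C * |b - a|, fun w => ?_⟩
      have h := intervalIntegral.norm_integral_le_of_norm_le_const
        (f := fun t => μ t (s t w)) (a := a) (b := b) (C := C * ‖w‖) (fun t ht => by
          have h1 := hC t (uIoc_subset_uIcc ht)
          calc ‖μ t (s t w)‖ ≤ ‖μ t‖ * ‖s t w‖ := (μ t).le_opNorm _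
            _ ≤ C * ‖w‖ := mul_le_mul h1 (hb t w) (norm_nonneg _) ((norm_nonneg _).trans h1))
      calc _ ≤ C * ‖w‖ * |b - a| := h
        _ = C * |b - a| * ‖w‖ := by ring)

end TimeIntegral

section Slices

variable {E : Type*} [NormedAddCommGroup E] [NormedSpace ℝ E]
  {H : Type*} [TopologicalSpace H] {I : ModelWithCorners ℝ E H}
  {X : Type*} [TopologicalSpace X] [CompactSpace X] [ChartedSpace H X] [IsManifold I 1 X]
  [RiemannianBundle (fun x : X => TangentSpace I x)]
  [IsContinuousRiemannianBundle E (fun x : X => TangentSpace I x)]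

/-- A real time, clamped to `[0,1]`. -/
abbrev clamp (t : ℝ) : unitInterval := projIcc 0 1 zero_le_one t

/-- The time slice `φ ↦ φ(t, ·)` from `C([0,1] × X)` to `C(X)`. -/
def sliceFun (t : ℝ) : C(unitInterval × X, ℝ) →L[ℝ] C(X, ℝ) :=
  LinearMap.mkContinuous
    { toFun := fun φ => φ.comp ⟨fun x => (clamp t, x), by fun_prop⟩
      map_add' := fun _ _ => rfl
      map_smul' := fun _ _ => rfl } 1 (fun φ => by
        rw [one_mul]
        exact (ContinuousMap.norm_le _ (norm_nonneg _)).2 fun x => φ.norm_coe_le_norm _)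

@[simp] theorem sliceFun_apply (t : ℝ) (φ : C(unitInterval × X, ℝ)) (x : X) :
    sliceFun t φ x = φ (clamp t, x) := rfl

theorem continuous_sliceFun (φ : C(unitInterval × X, ℝ)) :
    Continuous fun t : ℝ => sliceFun t φ :=
  (ContinuousMap.curry φ).continuous.comp continuous_projIcc

theorem norm_sliceFun_le (t : ℝ) (φ : C(unitInterval × X, ℝ)) : ‖sliceFun t φ‖ ≤ ‖φ‖ :=
  (ContinuousMap.norm_le _ (norm_nonneg _)).2 fun _ => φ.norm_coe_le_norm _

/-- The space `C(X, TX)` of continuous vector fields on `X`. -/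
abbrev SpaceField (I : ModelWithCorners ℝ E H) (X : Type*) [TopologicalSpace X]
    [ChartedSpace H X] [IsManifold I 1 X] : Type _ :=
  VectorField I (ContinuousMap.id X)

/-- The value `b(x) ∈ T_x X` of a vector field on `X`. -/
def SpaceField.val (b : SpaceField I X) (x : X) : TangentSpace I x := b x

/-- The space `C([0,1] × X, TX)` of continuous time-dependent vector fields on `X`. -/
abbrev SpaceTimeField (I : ModelWithCorners ℝ E H) (X : Type*) [TopologicalSpace X]
    [ChartedSpace H X] [IsManifold I 1 X] : Type _ :=
  VectorField I (ContinuousMap.snd : C(unitInterval × X, X))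

/-- The time slice `b ↦ b(t, ·)` from `C([0,1] × X, TX)` to `C(X, TX)`. -/
def sliceField (t : ℝ) : SpaceTimeField I X →L[ℝ] SpaceField I X :=
  LinearMap.mkContinuous
    { toFun := fun b => ⟨fun x => b (clamp t, x),
        b.continuous.comp (Continuous.prodMk_right (clamp t))⟩
      map_add' := fun _ _ => rfl
      map_smul' := fun _ _ => rfl } 1 (fun b => by
        rw [one_mul]
        exact VectorField.norm_le (norm_nonneg b) fun x => b.norm_apply_le (clamp t, x))

theorem sliceField_apply (t : ℝ) (b : SpaceTimeField I X) (x : X) :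
    sliceField t b x = b (clamp t, x) := rfl

theorem norm_sliceField_le (t : ℝ) (b : SpaceTimeField I X) : ‖sliceField t b‖ ≤ ‖b‖ :=
  VectorField.norm_le (norm_nonneg b) fun x => b.norm_apply_le (clamp t, x)

theorem continuous_sliceField (b : SpaceTimeField I X) :
    Continuous fun t : ℝ => sliceField t b := by
  rw [continuous_iff_continuousAt]
  intro s
  -- the field `(t, x) ↦ b (t, x) - b (s, x)` is continuous, and so is its norm
  let c : SpaceTimeField I X := ⟨fun p => b (clamp s, p.2),
    b.continuous.comp (Continuous.prodMk_right (clamp s) |>.comp continuous_snd)⟩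
  let g : C(unitInterval × X, ℝ) := ⟨fun p => ‖(b - c) p‖, (b - c).continuous_norm⟩
  have hg : Tendsto (fun t : ℝ => ‖sliceFun t g‖) (𝓝 s) (𝓝 0) := by
    have h0 : ‖sliceFun s g‖ = 0 := by
      rw [norm_eq_zero]
      ext x
      change ‖b (clamp s, x) - b (clamp s, x)‖ = 0
      rw [sub_self, norm_zero]
    have := (continuous_sliceFun g).norm.tendsto s
    rwa [h0] at this
  rw [ContinuousAt, tendsto_iff_norm_sub_tendsto_zero]
  refine squeeze_zero (fun _ => norm_nonneg _) (fun t => ?_) hg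
  refine VectorField.norm_le (norm_nonneg _) fun x => ?_
  have := (sliceFun t g).norm_coe_le_norm x
  exact (le_abs_self _).trans this

end Slices

/-! ### Measures, the action and the continuity equation -/

section Continuous

/-- `M(X)`: the topological dual of `C(X)`. -/
abbrev Meas (X : Type*) [TopologicalSpace X] [CompactSpace X] : Type _ := StrongDual ℝ C(X, ℝ)

/-- `M₊(X)`: the positive elements of `M(X)`. -/
def IsPositive {X : Type*} [TopologicalSpace X] [CompactSpace X] (ρ : Meas X) : Prop :=
  ∀ φ : C(X, ℝ), (∀ x, 0 ≤ φ x) → 0 ≤ ρ φ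

/-- The Dirac mass at `x`. -/
def dirac {X : Type*} [TopologicalSpace X] [CompactSpace X] (x : X) : Meas X :=
  ContinuousMap.evalCLM ℝ x

variable {E : Type*} [NormedAddCommGroup E] [NormedSpace ℝ E]
  {H : Type*} [TopologicalSpace H] (I : ModelWithCorners ℝ E H)
  {X : Type*} [TopologicalSpace X] [CompactSpace X] [ChartedSpace H X] [IsManifold I 1 X]
  [RiemannianBundle (fun x : X => TangentSpace I x)]
  [IsContinuousRiemannianBundle E (fun x : X => TangentSpace I x)]

variable (X) in
/-- `M(TX)`: the topological dual of `C(X, TX)`. -/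
abbrev VecMeas : Type _ := StrongDual ℝ (SpaceField I X)

variable (X) in
/-- `M([0,1] × TX)`: the topological dual of `C([0,1] × X, TX)`. -/
abbrev SpaceTimeVecMeas : Type _ := StrongDual ℝ (SpaceTimeField I X)

variable {I}

/-- The Benamou-Brenier action: the supremum of `⟨ρ, a⟩ + ⟨m, b⟩` over all continuous `a`, `b` with
`a + |b|² / 2 ≤ 0` everywhere. It is `A` for `f = id` on `X`, and the space-time action for the
projection `f : [0,1] × X → X`. -/
def action {T : Type*} [TopologicalSpace T] [CompactSpace T] {f : C(T, X)}
    (ρ : Meas T) (m : StrongDual ℝ (VectorField I f)) : EReal :=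
  ⨆ (a : C(T, ℝ)) (b : VectorField I f) (_ : ∀ t, a t + ‖b t‖ ^ 2 / 2 ≤ 0),
    ((ρ a + m b : ℝ) : EReal)

/-- `A⋆(ρ, b) = ½ ⟨ρ, |b|²⟩`. -/
def actionStar (ρ : Meas X) (b : SpaceField I X) : ℝ := 1 / 2 * ρ (normSq b)

/-- `φ` is differentiable and the continuous vector field `G` is its Riemannian gradient:
`g_x(G x, v) = dφ_x(v)`. A function has such a `G` exactly when it is of class `C¹`. -/
structure HasGradient (φ : X → ℝ) (G : SpaceField I X) : Prop where
  differentiable : MDifferentiable I 𝓘(ℝ, ℝ) φ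
  gradient : ∀ (x : X) (v : TangentSpace I x),
    ⟪SpaceField.val G x, v⟫ = (mfderiv I 𝓘(ℝ, ℝ) φ x v : ℝ)

/-- `φ ∈ C¹([0,1] × X)`, with time derivative `φt` and spatial gradient `G`: the partial
derivatives exist everywhere (one-sided in time at `0` and `1`) and are the continuous
objects `φt` and `G`, which is the meaning of `φ ∈ C¹([0,1] × X)`. -/
structure IsC1TestFunction (φ φt : C(unitInterval × X, ℝ)) (G : SpaceTimeField I X) : Prop where
  time : ∀ t ∈ Icc (0 : ℝ) 1, ∀ x : X,
    HasDerivWithinAt (fun s : ℝ => φ (clamp s, x)) (φt (clamp t, x)) (Icc 0 1) t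
  space : ∀ t : ℝ, HasGradient (fun x : X => φ (clamp t, x)) (sliceField t G)

/-- The set `CE(ρ₀, ρ₁)`: weak solutions of `∂ₜ ρ + ∇ · m = 0` on `[0,1] × X` with no-flux
conditions on the boundary of `X` and temporal boundary values `ρ₀`, `ρ₁`. -/
def ContinuityEquation (ρ₀ ρ₁ : Meas X) (ρ : Meas (unitInterval × X))
    (m : SpaceTimeVecMeas I X) : Prop :=
  ∀ (φ φt : C(unitInterval × X, ℝ)) (G : SpaceTimeField I X), IsC1TestFunction φ φt G →
    ρ φt + m G = ρ₁ (sliceFun 1 φ) - ρ₀ (sliceFun 0 φ)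

open Classical in
/-- The functional `J_{ρ₀, ρ₁}`. -/
def energy (ρ₀ ρ₁ : Meas X) (ρ : Meas (unitInterval × X)) (m : SpaceTimeVecMeas I X) : EReal :=
  if ContinuityEquation ρ₀ ρ₁ ρ m then action ρ m else ⊤

end Continuous

/-! ### Regularity of test functions -/

section Regularity

variable {E : Type*} [NormedAddCommGroup E] [NormedSpace ℝ E]
  {H : Type*} [TopologicalSpace H] (I : ModelWithCorners ℝ E H)
  {X : Type*} [TopologicalSpace X] [ChartedSpace H X] [IsManifold I 1 X]

/-- A bounded set of `C^q(X)`: all its elements are of class `C^q`, and around every point, the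
partial derivatives of order at most `q` of their expressions in a chart are bounded uniformly on
the set. As `X` is compact, this amounts to a uniform bound in a finite atlas (with charts shrunk
so that their transition maps have bounded derivatives). -/
def IsBoundedCq (q : ℕ) (B : Set C(X, ℝ)) : Prop :=
  (∀ φ ∈ B, ContMDiff I 𝓘(ℝ, ℝ) q φ) ∧
  ∀ x₀ : X, ∃ U ∈ 𝓝 x₀, ∃ C : ℝ, ∀ φ ∈ B, ∀ x ∈ U, ∀ j ≤ q,
    ‖iteratedFDerivWithin ℝ j (fun y => φ ((extChartAt I x₀).symm y)) (range I)
      (extChartAt I x₀ x)‖ ≤ C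

variable {I}

/-- The expression `y ↦ Dφ (b (φ⁻¹ y))` of a vector field `b` in the chart `φ` at `x₀`. -/
def chartExpr (x₀ : X) (b : SpaceField I X) (y : E) : E :=
  mfderiv I 𝓘(ℝ, E) (extChartAt I x₀) ((extChartAt I x₀).symm y)
    (SpaceField.val b ((extChartAt I x₀).symm y))

/-- The vector field `b` is of class `C^q`. -/
def IsCqField (q : ℕ) (b : SpaceField I X) : Prop :=
  ContMDiff I I.tangent q (fun x : X => (⟨x, SpaceField.val b x⟩ : TangentBundle I X))

/-- A bounded set of `C^q(X, TX)`. -/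
def IsBoundedCqField (q : ℕ) (B : Set (SpaceField I X)) : Prop :=
  (∀ b ∈ B, IsCqField q b) ∧
  ∀ x₀ : X, ∃ U ∈ 𝓝 x₀, ∃ C : ℝ, ∀ b ∈ B, ∀ x ∈ U, ∀ j ≤ q,
    ‖iteratedFDerivWithin ℝ j (chartExpr x₀ b) (range I) (extChartAt I x₀ x)‖ ≤ C

end Regularity

/-! ### Riemannian volume, densities, divergence, no-flux boundary conditions -/

section Volume

variable {E : Type*} [NormedAddCommGroup E] [NormedSpace ℝ E]
  {H : Type*} [TopologicalSpace H] {I : ModelWithCorners ℝ E H}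
  {X : Type*} [EMetricSpace X] [CompactSpace X] [MeasurableSpace X] [BorelSpace X]
  [ChartedSpace H X] [IsManifold I 1 X]
  [RiemannianBundle (fun x : X => TangentSpace I x)]
  [IsContinuousRiemannianBundle E (fun x : X => TangentSpace I x)]

variable (E X) in
/-- The Riemannian volume: the Hausdorff measure for the Riemannian distance, in the dimension of
the manifold, normalized so as to be Lebesgue measure on a Euclidean space. -/
def riemannianVolume : Measure X := μHE[Module.finrank ℝ E]

variable (E) in
/-- `ρ ∈ M(X)` has the density `h` with respect to the volume measure. -/
def HasDensity (ρ : Meas X) (h : C(X, ℝ)) : Prop :=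
  ∀ φ : C(X, ℝ), ρ φ = ∫ x, φ x * h x ∂(riemannianVolume E X)

/-- `m ∈ M(TX)` has the density `b` with respect to the volume measure. -/
def HasVecDensity (m : VecMeas I X) (b : SpaceField I X) : Prop :=
  ∀ c : SpaceField I X,
    m c = ∫ x, ⟪SpaceField.val c x, SpaceField.val b x⟫ ∂(riemannianVolume E X)

/-- The continuous function `h` is the divergence of the vector field `b`: minus the adjoint of the
gradient, tested against `C¹` functions vanishing near the boundary. -/
def IsDivergence (b : SpaceField I X) (h : C(X, ℝ)) : Prop :=
  ∀ (φ : C(X, ℝ)) (G : SpaceField I X), HasGradient φ G →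
    (∀ᶠ x in 𝓝ˢ (I.boundary X), φ x = 0) →
    ∫ x, ⟪SpaceField.val G x, SpaceField.val b x⟫ ∂(riemannianVolume E X) =
      - ∫ x, φ x * h x ∂(riemannianVolume E X)

/-- The expression `Dφ_x v` of the tangent vector `v ∈ T_x X` in the preferred chart `φ` at `x`. -/
def chartVector (x : X) (v : TangentSpace I x) : E := mfderiv I 𝓘(ℝ, E) (extChartAt I x) x v

/-- The vector `v ∈ T_x X` is tangent to the boundary at the boundary point `x`: in the chart at
`x`, a small segment around `x` in the directions `v` and `-v` stays in the model half space. -/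
def IsTangentToBoundary (x : X) (v : TangentSpace I x) : Prop :=
  ∀ᶠ t : ℝ in 𝓝 0, extChartAt I x x + t • chartVector x v ∈ range I

/-- `n ∈ T_x X` is the outward unit normal at the boundary point `x`. -/
structure IsOutwardNormal (x : X) (n : TangentSpace I x) : Prop where
  norm_eq : ‖n‖ = 1
  orthogonal : ∀ v : TangentSpace I x, IsTangentToBoundary x v → ⟪n, v⟫ = 0
  outward : ∀ᶠ t : ℝ in 𝓝[>] 0, extChartAt I x x + t • chartVector x n ∉ range I

/-- The no-flux boundary conditions `b · n = 0` on the boundary of `X`. -/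
def NoFlux (b : SpaceField I X) : Prop :=
  ∀ x ∈ I.boundary X, ∀ n : TangentSpace I x, IsOutwardNormal x n →
    ⟪SpaceField.val b x, n⟫ = 0

end Volume

/-! ### Finite dimensional models of dynamical optimal transport -/

section Discrete

/-- One member `(𝒳, 𝒴, A, Div)` of a family of finite dimensional models of dynamical optimal
transport, with its cone `𝒳₊`. -/
structure DiscreteModel (𝒳 𝒴 : Type*) [AddCommGroup 𝒳] [Module ℝ 𝒳]
    [AddCommGroup 𝒴] [Module ℝ 𝒴] where
  /-- the action `A : 𝒳 × 𝒴 → [0, ∞]` -/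
  action : 𝒳 → 𝒴 → ℝ≥0∞
  /-- the cone `𝒳₊` -/
  cone : Set 𝒳
  /-- the divergence -/
  Div : 𝒴 →ₗ[ℝ] 𝒳
  smul_mem_cone : ∀ P ∈ cone, ∀ c : ℝ, 0 < c → c • P ∈ cone
  proper : ∃ P M, action P M ≠ ⊤
  convex : ∀ P₁ P₂ M₁ M₂, ∀ a b : ℝ, 0 ≤ a → 0 ≤ b → a + b = 1 →
    action (a • P₁ + b • P₂) (a • M₁ + b • M₂) ≤
      ENNReal.ofReal a * action P₁ M₁ + ENNReal.ofReal b * action P₂ M₂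
  homogeneous_left : ∀ P M, ∀ c : ℝ, 0 < c → action (c • P) M = ENNReal.ofReal c⁻¹ * action P M
  homogeneous_right : ∀ P M, ∀ c : ℝ, c ≠ 0 →
    action P (c • M) = ENNReal.ofReal (c ^ 2) * action P M
  antitone : ∀ P₁ ∈ cone, ∀ P₂ ∈ cone, ∀ M, action (P₁ + P₂) M ≤ action P₁ M

variable {𝒳 𝒴 : Type*} [AddCommGroup 𝒳] [Module ℝ 𝒳] [AddCommGroup 𝒴] [Module ℝ 𝒴]

/-- The Legendre transform `A⋆(P, B) = sup_M ⟨M, B⟩ - A(P, M)` in the second variable. -/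
def DiscreteModel.actionStar (D : DiscreteModel 𝒳 𝒴) (P : 𝒳) (B : Module.Dual ℝ 𝒴) : EReal :=
  ⨆ M : 𝒴, (((B M : ℝ) : EReal) - (D.action P M : EReal))

/-- Admissibility: densities in the cone, the discrete continuity equation with time
step `τ = 1 / N`, and the prescribed temporal boundary values. -/
structure DiscreteModel.Admissible (D : DiscreteModel 𝒳 𝒴) {N : ℕ} (P₀ P₁ : 𝒳)
    (P : Fin (N + 1) → 𝒳) (M : Fin N → 𝒴) : Prop where
  mem_cone : ∀ k, P k ∈ D.cone
  continuity : ∀ k : Fin N, (N : ℝ) • (P k.succ - P k.castSucc) + D.Div (M k) = 0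
  initial : P 0 = P₀
  final : P (Fin.last N) = P₁

open Classical in
/-- The discrete functional `J^N_{P₀, P₁}`; `M k` is the momentum on the time interval
`[k / N, (k + 1) / N]`, for `k = 0, …, N - 1`. -/
def DiscreteModel.energy (D : DiscreteModel 𝒳 𝒴) {N : ℕ} (P₀ P₁ : 𝒳)
    (P : Fin (N + 1) → 𝒳) (M : Fin N → 𝒴) : ℝ≥0∞ :=
  if D.Admissible P₀ P₁ P M then
    (N : ℝ≥0∞)⁻¹ * ∑ k : Fin N, D.action ((1 / 2 : ℝ) • (P k.castSucc + P k.succ)) (M k)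
  else ⊤

variable {E : Type*} [NormedAddCommGroup E] [NormedSpace ℝ E]
  {H : Type*} [TopologicalSpace H] {I : ModelWithCorners ℝ E H}
  {X : Type*} [EMetricSpace X] [CompactSpace X] [MeasurableSpace X] [BorelSpace X]
  [ChartedSpace H X] [IsManifold I 1 X]
  [RiemannianBundle (fun x : X => TangentSpace I x)]
  [IsContinuousRiemannianBundle E (fun x : X => TangentSpace I x)]

variable (I X) in
/-- Reconstruction and sampling operators for one discrete model. -/
structure Operators (D : DiscreteModel 𝒳 𝒴) where
  /-- the reconstruction of densities adapted to the continuity equation -/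
  RCE : 𝒳 →ₗ[ℝ] Meas X
  /-- the reconstruction of densities adapted to the action -/
  RA : 𝒳 →ₗ[ℝ] Meas X
  /-- the reconstruction of momenta -/
  RY : 𝒴 →ₗ[ℝ] VecMeas I X
  /-- the sampling of densities -/
  SX : Meas X →ₗ[ℝ] 𝒳
  /-- the sampling of momenta, only defined on a subspace -/
  SY : VecMeas I X →ₗ.[ℝ] 𝒴
  RCE_pos : ∀ P ∈ D.cone, IsPositive (RCE P)
  RA_pos : ∀ P ∈ D.cone, IsPositive (RA P)
  SX_mem : ∀ ρ, IsPositive ρ → SX ρ ∈ D.cone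
  mem_SY_domain : ∀ (m : VecMeas I X) (b : SpaceField I X), HasVecDensity m b → m ∈ SY.domain

/-- The adjoint `L^⊤ : C(X, TX) → 𝒴'` of a linear map `L : 𝒴 → M(TX)`. -/
def adjoint (L : 𝒴 →ₗ[ℝ] VecMeas I X) (b : SpaceField I X) : Module.Dual ℝ 𝒴 where
  toFun M := L M b
  map_add' M M' := by simp
  map_smul' c M := by simp

/-! #### Reconstruction in space and time -/

namespace Operators

variable {D : DiscreteModel 𝒳 𝒴} (R : Operators I X D) {N : ℕ}

/-- Piecewise linear in time reconstruction of the density. With `τ = 1 / N`, on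
`[k τ, (k + 1) τ]` the weights are `((k + 1) τ - t) / τ = k + 1 - N t` and
`(t - k τ) / τ = N t - k`. -/
def recCE (P : Fin (N + 1) → 𝒳) : Meas (unitInterval × X) :=
  ∑ k : Fin N, timeIntegral sliceFun continuous_sliceFun norm_sliceFun_le
    (fun t => ((k : ℝ) + 1 - N * t) • R.RCE (P k.castSucc) + (N * t - k) • R.RCE (P k.succ))
    (by fun_prop) (k / N) ((k + 1) / N)

/-- Piecewise constant in time reconstruction of the density. -/
def recA (P : Fin (N + 1) → 𝒳) : Meas (unitInterval × X) :=
  ∑ k : Fin N, timeIntegral sliceFun continuous_sliceFun norm_sliceFun_le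
    (fun _ => R.RA ((1 / 2 : ℝ) • (P k.castSucc + P k.succ)))
    continuous_const (k / N) ((k + 1) / N)

/-- Piecewise constant in time reconstruction of the momentum. -/
def recY (M : Fin N → 𝒴) : SpaceTimeVecMeas I X :=
  ∑ k : Fin N, timeIntegral sliceField continuous_sliceField norm_sliceField_le
    (fun _ => R.RY (M k)) continuous_const (k / N) ((k + 1) / N)

end Operators

end Discrete

/-! ### Adapted families -/

section Adapted

variable {E : Type*} [NormedAddCommGroup E] [NormedSpace ℝ E]
  {H : Type*} [TopologicalSpace H] {I : ModelWithCorners ℝ E H}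
  {X : Type*} [EMetricSpace X] [CompactSpace X] [MeasurableSpace X] [BorelSpace X]
  [ChartedSpace H X] [IsManifold I 1 X]
  [RiemannianBundle (fun x : X => TangentSpace I x)]
  [IsContinuousRiemannianBundle E (fun x : X => TangentSpace I x)]

/-- `σ → 0` within the set `S` of admissible spatial step sizes. -/
def toZero (S : Set ℝ) : Filter S := comap Subtype.val (𝓝 (0 : ℝ))

variable {S : Set ℝ} {𝒳 𝒴 : S → Type*}
  [∀ σ, AddCommGroup (𝒳 σ)] [∀ σ, Module ℝ (𝒳 σ)]
  [∀ σ, AddCommGroup (𝒴 σ)] [∀ σ, Module ℝ (𝒴 σ)]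

/-- The family of discrete models `D`, with the reconstruction and sampling operators `R`, is
adapted to the manifold `X`. -/
structure IsAdapted (D : ∀ σ, DiscreteModel (𝒳 σ) (𝒴 σ))
    (R : ∀ σ, Operators I X (D σ)) : Prop where
  /-- reconstruction is asymptotically the inverse of sampling -/
  rec_sampling : ∀ ρ : Meas X, IsPositive ρ → ∀ φ : C(X, ℝ),
    Tendsto (fun σ => (R σ).RCE ((R σ).SX ρ) φ) (toZero S) (𝓝 (ρ φ))
  /-- the two reconstructions of the density are asymptotically equivalent -/
  rec_equiv : ∀ B : Set C(X, ℝ), IsBoundedCq I 1 B →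
    ∃ ε : S → ℝ, Tendsto ε (toZero S) (𝓝 0) ∧ ∀ σ, ∀ φ ∈ B, ∀ P : 𝒳 σ,
      ((R σ).RCE P - (R σ).RA P) φ ≤ ε σ * ‖(R σ).RCE P‖
  /-- asymptotic commutation of reconstruction and derivation -/
  rec_div : ∀ B : Set C(X, ℝ), IsBoundedCq I 2 B →
    ∃ ε : S → ℝ, Tendsto ε (toZero S) (𝓝 0) ∧ ∀ σ, ∀ M : 𝒴 σ, ∀ φ ∈ B,
      ∀ G : SpaceField I X, HasGradient φ G →
        |(R σ).RCE ((D σ).Div M) φ + (R σ).RY M G| ≤ ε σ * ‖(R σ).RY M‖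
  /-- exact commutation of sampling and derivation -/
  sampling_div : ∀ (m : VecMeas I X) (b : SpaceField I X) (hm : HasVecDensity m b),
    IsCqField 1 b → NoFlux b → ∀ (h : C(X, ℝ)) (μ : Meas X), IsDivergence b h →
      HasDensity E μ h → ∀ σ,
        (R σ).SX μ = (D σ).Div ((R σ).SY ⟨m, (R σ).mem_SY_domain m b hm⟩)
  /-- one-sided estimate for the Legendre transform of the action -/
  actionStar_le : ∀ B : Set (SpaceField I X), IsBoundedCqField 1 B →
    ∃ ε : S → ℝ, Tendsto ε (toZero S) (𝓝 0) ∧ ∀ b ∈ B, ∀ σ, ∀ P : 𝒳 σ,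
      (D σ).actionStar P (adjoint (R σ).RY b) ≤
        ((actionStar ((R σ).RA P) b + ε σ * ‖(R σ).RA P‖ : ℝ) : EReal)
  /-- uniform estimate for the Legendre transform of the action -/
  actionStar_le_sup : ∃ C : ℝ, 1 ≤ C ∧ ∀ b : SpaceField I X, ∀ σ, ∀ P : 𝒳 σ,
    (D σ).actionStar P (adjoint (R σ).RY b) ≤
      ((C / 2 * ‖(R σ).RA P‖ * ‖b‖ ^ 2 : ℝ) : EReal)
  /-- asymptotic one-sided estimate for the action on smooth densities -/
  action_sampling : ∀ (B : Set C(X, ℝ)) (B' : Set (SpaceField I X)), IsBoundedCq I 1 B →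
    (∃ c > 0, ∀ h ∈ B, ∀ x, c ≤ h x) → IsBoundedCqField 1 B' →
    ∃ ε : S → ℝ, Tendsto ε (toZero S) (𝓝 0) ∧
      ∀ (ρ : Meas X), ∀ h ∈ B, HasDensity E ρ h →
      ∀ (m : VecMeas I X), ∀ b ∈ B', ∀ hm : HasVecDensity m b, ∀ σ,
        ((D σ).action ((R σ).SX ρ) ((R σ).SY ⟨m, (R σ).mem_SY_domain m b hm⟩) : EReal) ≤
          action ρ m + ((ε σ : ℝ) : EReal)
  /-- controllability -/
  controllability : ∃ (ε : S → ℝ) (w : ℝ → ℝ), Tendsto ε (toZero S) (𝓝 0) ∧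
    ContinuousOn w (Ici 0) ∧ w 0 = 0 ∧
    ∀ x y : X, edist x y ≠ ⊤ → ∀ σ, ∃ P ∈ (D σ).cone, ∃ M₁ M₂ : 𝒴 σ,
      (D σ).Div M₁ = P - (R σ).SX (dirac x) ∧ (D σ).Div M₂ = P - (R σ).SX (dirac y) ∧
      ((D σ).action P M₁ : EReal) ≤ ((w (edist x y).toReal + ε σ : ℝ) : EReal) ∧
      ((D σ).action P M₂ : EReal) ≤ ((w (edist x y).toReal + ε σ : ℝ) : EReal)

end Adapted

/-- The charts of the manifold take values in a normed space or in a closed half space. -/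
def IsHalfSpaceModel {E : Type*} [NormedAddCommGroup E] [NormedSpace ℝ E]
    {H : Type*} [TopologicalSpace H] (I : ModelWithCorners ℝ E H) : Prop :=
  range I = univ ∨ ∃ l : StrongDual ℝ E, l ≠ 0 ∧ range I = {v | 0 ≤ l v}

end DynamicOT

end

set_option linter.unusedSectionVars false

noncomputable section

namespace DynamicOT

section TangentFrames

variable {E : Type*} [NormedAddCommGroup E] [NormedSpace ℝ E]
  {H : Type*} [TopologicalSpace H] {I : ModelWithCorners ℝ E H}
  {X : Type*} [TopologicalSpace X] [ChartedSpace H X] [IsManifold I ∞ X]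
  {T : Type*} [TopologicalSpace T]

variable (I) in
/-- The coordinates of a tangent vector in the trivialization at `x₀`. -/
def coordAt (x₀ x : X) : TangentSpace I x →L[ℝ] E :=
  (trivializationAt E (TangentSpace I : X → Type _) x₀).continuousLinearMapAt ℝ x

variable (I) in
/-- The tangent vector with given coordinates in the trivialization at `x₀`. -/
def frameAt (x₀ x : X) : E →L[ℝ] TangentSpace I x :=
  (trivializationAt E (TangentSpace I : X → Type _) x₀).symmL ℝ x

theorem coordAt_apply {x₀ x : X} (hx : x ∈ (chartAt H x₀).source) (v : TangentSpace I x) :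
    coordAt I x₀ x v = (trivializationAt E (TangentSpace I : X → Type _) x₀ ⟨x, v⟩).2 := by
  rw [coordAt, Bundle.Trivialization.continuousLinearMapAt_apply,
    Bundle.Trivialization.coe_linearMapAt_of_mem _ (by simpa using hx)]

theorem frameAt_coordAt {x₀ x : X} (hx : x ∈ (chartAt H x₀).source) (v : TangentSpace I x) :
    frameAt I x₀ x (coordAt I x₀ x v) = v :=
  (trivializationAt E (TangentSpace I : X → Type _) x₀).symmL_continuousLinearMapAt
    (by simpa using hx) v

theorem coordAt_frameAt {x₀ x : X} (hx : x ∈ (chartAt H x₀).source) (e : E) :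
    coordAt I x₀ x (frameAt I x₀ x e) = e :=
  (trivializationAt E (TangentSpace I : X → Type _) x₀).continuousLinearMapAt_symmL
    (by simpa using hx) e

theorem coordAt_eq_mfderiv {x₀ x : X} (hx : x ∈ (chartAt H x₀).source) :
    coordAt I x₀ x = mfderiv I 𝓘(ℝ, E) (extChartAt I x₀) x :=
  TangentBundle.continuousLinearMapAt_trivializationAt hx

theorem frameAt_eq_mfderivWithin {x₀ x : X} (hx : x ∈ (chartAt H x₀).source) :
    frameAt I x₀ x =
      mfderivWithin 𝓘(ℝ, E) I (extChartAt I x₀).symm (range I) (extChartAt I x₀ x) :=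
  TangentBundle.symmL_trivializationAt hx

theorem contMDiffOn_frameAt (x₀ : X) (e : E) :
    ContMDiffOn I I.tangent ∞ (fun x : X => (⟨x, frameAt I x₀ x e⟩ : TangentBundle I X))
      (chartAt H x₀).source := by
  have h := (trivializationAt E (TangentSpace I : X → Type _) x₀).contMDiffOn_section_baseSet_iff
    (IB := I) (n := ∞) (s := fun x => frameAt I x₀ x e)
  rw [TangentBundle.trivializationAt_baseSet] at h
  refine h.2 (contMDiffOn_const (c := e) |>.congr fun x hx => ?_)
  exact (coordAt_apply hx _).symm.trans (coordAt_frameAt (I := I) hx e)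

theorem continuousOn_frameAt (x₀ : X) (e : E) :
    ContinuousOn (fun x : X => (⟨x, frameAt I x₀ x e⟩ : TangentBundle I X))
      (chartAt H x₀).source :=
  (contMDiffOn_frameAt x₀ e).continuousOn

theorem continuousOn_coordAt {f : C(T, X)} (v : VectorField I f) (x₀ : X) :
    ContinuousOn (fun t => coordAt I x₀ (f t) (v t)) (f ⁻¹' (chartAt H x₀).source) := by
  have h := (trivializationAt E (TangentSpace I : X → Type _) x₀).continuousOn.comp
    v.continuous.continuousOn (s := f ⁻¹' (chartAt H x₀).source) (fun t ht => by
      simpa [Bundle.Trivialization.mem_source] using ht)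
  exact h.snd.congr fun t ht => coordAt_apply ht _

variable [RiemannianBundle (fun x : X => TangentSpace I x)]
  [IsContinuousRiemannianBundle E (fun x : X => TangentSpace I x)]

theorem eventually_norm_coordAt_le (x₀ : X) :
    ∃ C > 0, ∀ᶠ x in 𝓝 x₀, ∀ v : TangentSpace I x, ‖coordAt I x₀ x v‖ ≤ C * ‖v‖ := by
  obtain ⟨C, hC, h⟩ := eventually_norm_trivializationAt_lt E (fun x : X => TangentSpace I x) x₀
  refine ⟨C, hC, h.mono fun x hx v => ?_⟩
  exact ContinuousLinearMap.le_of_opNorm_le _ hx.le v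

theorem eventually_norm_frameAt_le (x₀ : X) :
    ∃ C > 0, ∀ᶠ x in 𝓝 x₀, ∀ e : E, ‖frameAt I x₀ x e‖ ≤ C * ‖e‖ := by
  obtain ⟨C, hC, h⟩ := eventually_norm_symmL_trivializationAt_lt E
    (fun x : X => TangentSpace I x) x₀
  refine ⟨C, hC, h.mono fun x hx v => ?_⟩
  exact ContinuousLinearMap.le_of_opNorm_le _ hx.le v

end TangentFrames

section Separable

variable {E : Type*} [NormedAddCommGroup E] [NormedSpace ℝ E] [FiniteDimensional ℝ E]
  {H : Type*} [TopologicalSpace H] {I : ModelWithCorners ℝ E H}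
  {X : Type*} [TopologicalSpace X] [CompactSpace X] [T2Space X]
  [ChartedSpace H X] [IsManifold I ∞ X]
  [RiemannianBundle (fun x : X => TangentSpace I x)]
  [IsContinuousRiemannianBundle E (fun x : X => TangentSpace I x)]
  {T : Type*} [TopologicalSpace T] [CompactSpace T] [SecondCountableTopology T]

variable [T2Space T]

/-- A space admitting a map into a second countable metric space that does not decrease distances
by more than a constant factor is separable. -/
theorem separableSpace_of_antilipschitzWith {V W : Type*} [PseudoMetricSpace V]
    [PseudoMetricSpace W] [SecondCountableTopology W] {K : NNReal} {Φ : V → W}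
    (hΦ : AntilipschitzWith K Φ) : TopologicalSpace.SeparableSpace V := by
  obtain ⟨s, hs, hd⟩ := TopologicalSpace.exists_countable_dense (range Φ)
  choose g hg using fun y : range Φ => y.2
  refine ⟨⟨g '' s, hs.image g, fun v => Metric.mem_closure_iff.2 fun ε hε => ?_⟩⟩
  obtain ⟨y, hy, hyv⟩ := Metric.dense_iff.1 hd ⟨Φ v, mem_range_self v⟩ (ε / (K + 1)) (by positivity)
  refine ⟨g y, mem_image_of_mem g hyv, ?_⟩
  have h1 := hΦ.le_mul_dist v (g y)
  rw [hg y] at h1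
  have h2 : dist (y : W) (Φ v) < ε / (K + 1) := hy
  rw [dist_comm, lt_div_iff₀ (by positivity)] at h2
  nlinarith [dist_nonneg (x := Φ v) (y := (y : W)), K.coe_nonneg]

theorem separableSpace_vectorField (f : C(T, X)) :
    TopologicalSpace.SeparableSpace (VectorField I f) := by
  have h (x₀ : X) : ∃ K ∈ 𝓝 x₀, IsClosed K ∧ K ⊆ (chartAt H x₀).source ∧ ∃ C > 0,
      ∀ x ∈ K, ∀ v : TangentSpace I x, ‖v‖ ≤ C * ‖coordAt I x₀ x v‖ := by
    obtain ⟨C, hC, hx⟩ := eventually_norm_frameAt_le (I := I) x₀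
    obtain ⟨K, hK, hKc, hKs⟩ := exists_mem_nhds_isClosed_subset
      (inter_mem hx ((chartAt H x₀).open_source.mem_nhds (mem_chart_source H x₀)))
    refine ⟨K, hK, hKc, fun x hx => (hKs hx).2, C, hC, fun x hx v => ?_⟩
    have := (hKs hx).1 (coordAt I x₀ x v)
    rwa [frameAt_coordAt (hKs hx).2] at this
  choose K hK hKc hKs C hC hKC using h
  obtain ⟨s, -, hs⟩ := isCompact_univ.elim_nhds_subcover K fun x _ => hK x
  have hcomp (i : s) : CompactSpace (f ⁻¹' K i) :=
    isCompact_iff_compactSpace.1 ((hKc i).preimage f.continuous).isCompact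
  let Φ (b : VectorField I f) (i : s) : C(f ⁻¹' K i, E) :=
    ⟨fun t => coordAt I (i : X) (f t) (b t),
      continuousOn_iff_continuous_domRestrict.1
        ((continuousOn_coordAt b (i : X)).mono (preimage_mono (hKs i)))⟩
  refine separableSpace_of_antilipschitzWith (K := ∑ i : s, (C i).toNNReal) (Φ := Φ)
    (AntilipschitzWith.of_le_mul_dist fun b c => ?_)
  rw [dist_eq_norm]
  refine VectorField.norm_le (by positivity) fun t => ?_
  obtain ⟨i, his, hi⟩ := mem_iUnion₂.1 (hs (mem_univ (f t)))
  have h1 := hKC i (f t) hi ((b - c) t)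
  have h2 : ‖coordAt I i (f t) ((b - c) t)‖ ≤ dist (Φ b) (Φ c) := by
    have h3 := (dist_le_pi_dist (Φ b) (Φ c) ⟨i, his⟩)
    have h4 := (ContinuousMap.dist_apply_le_dist (f := Φ b ⟨i, his⟩) (g := Φ c ⟨i, his⟩) ⟨t, hi⟩)
    rw [dist_eq_norm] at h4
    refine le_trans (le_of_eq ?_) (h4.trans h3)
    change ‖coordAt I i (f t) (b t - c t)‖ = _
    rw [map_sub]
    rfl
  have h5 : C i ≤ ((∑ i : s, (C i).toNNReal : NNReal) : ℝ) := by
    rw [← Real.coe_toNNReal _ (hC i).le]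
    exact_mod_cast Finset.single_le_sum (f := fun j : s => (C j).toNNReal)
      (fun _ _ => zero_le) (Finset.mem_univ (⟨i, his⟩ : s))
  calc _ ≤ _ := h1
    _ ≤ _ := mul_le_mul h5 h2 (norm_nonneg _) (by positivity)

end Separable

section Smooth

variable {E : Type*} [NormedAddCommGroup E] [NormedSpace ℝ E] [FiniteDimensional ℝ E]
  {H : Type*} [TopologicalSpace H] {I : ModelWithCorners ℝ E H}
  {X : Type*} [TopologicalSpace X] [CompactSpace X] [T2Space X]
  [ChartedSpace H X] [IsManifold I ∞ X]

theorem exists_contMDiff_norm_sub_lt (φ : C(X, ℝ)) {ε : ℝ} (hε : 0 < ε) :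
    ∃ ψ : C(X, ℝ), ContMDiff I 𝓘(ℝ, ℝ) ∞ ψ ∧ ‖ψ - φ‖ ≤ ε := by
  obtain ⟨g, hg, -⟩ := φ.continuous.exists_contMDiff_approx I ⊤ (ε := fun _ => ε)
    continuous_const (fun _ => hε)
  refine ⟨⟨g, g.contMDiff.continuous⟩, g.contMDiff, ?_⟩
  exact (ContinuousMap.norm_le _ hε.le).2 fun x => (dist_eq_norm (g x) (φ x) ▸ hg x).le

variable [RiemannianBundle (fun x : X => TangentSpace I x)]
  [IsContinuousRiemannianBundle E (fun x : X => TangentSpace I x)]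

theorem exists_isCqField_norm_sub_le (b : SpaceField I X) {ε : ℝ} (hε : 0 < ε) :
    ∃ c : SpaceField I X, IsCqField 1 c ∧ ‖c - b‖ ≤ ε := by
  have hconv (x : X) : Convex ℝ {v : TangentSpace I x | ‖v - SpaceField.val b x‖ ≤ ε} := by
    have := convex_closedBall (SpaceField.val b x) ε
    simpa only [Metric.closedBall, dist_eq_norm] using this
  have hloc (x₀ : X) : ∃ U ∈ 𝓝 x₀, ∃ s : (x : X) → TangentSpace I x,
      ContMDiffOn I I.tangent ∞ (fun x : X => (⟨x, s x⟩ : TangentBundle I X)) U ∧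
        ∀ y ∈ U, s y ∈ {v : TangentSpace I y | ‖v - SpaceField.val b y‖ ≤ ε} := by
    obtain ⟨C, hC, hb⟩ := eventually_norm_frameAt_le (I := I) x₀
    have hx₀ := mem_chart_source H x₀
    have hsrc := (chartAt H x₀).open_source.mem_nhds hx₀
    have hc := ((continuousOn_coordAt b x₀).continuousAt hsrc)
    have hnear := Metric.continuousAt_iff'.1 hc (ε / C) (by positivity)
    refine ⟨_, inter_mem (inter_mem hb hnear) hsrc,
      fun x => frameAt I x₀ x (coordAt I x₀ x₀ (SpaceField.val b x₀)), ?_, ?_⟩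
    · exact (contMDiffOn_frameAt x₀ _).mono inter_subset_right
    · rintro x ⟨⟨h1, h2⟩, h3⟩
      have h4 : frameAt I x₀ x (coordAt I x₀ x₀ (SpaceField.val b x₀)) - SpaceField.val b x =
          frameAt I x₀ x (coordAt I x₀ x₀ (SpaceField.val b x₀) - coordAt I x₀ x (SpaceField.val b x)) := by
        rw [map_sub]
        exact congrArg _ (frameAt_coordAt h3 (SpaceField.val b x)).symm
      change ‖frameAt I x₀ x (coordAt I x₀ x₀ (SpaceField.val b x₀)) - SpaceField.val b x‖ ≤ ε
      rw [h4]
      refine (h1 _).trans ?_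
      have h5 : dist (coordAt I x₀ x (SpaceField.val b x)) (coordAt I x₀ x₀ (SpaceField.val b x₀)) < ε / C := h2
      rw [dist_comm, dist_eq_norm, lt_div_iff₀ hC] at h5
      rw [mul_comm]
      exact h5.le
  obtain ⟨s, hs⟩ := exists_contMDiffSection_forall_mem_convex_of_local (n := ⊤) I
    (F_fiber := E) (fun x : X => TangentSpace I x) _ hconv hloc
  have h1 : IsCqField (I := I) 1 ⟨fun x => s x, s.contMDiff.continuous⟩ :=
    s.contMDiff.of_le (by simp)
  exact ⟨_, h1, VectorField.norm_le hε.le hs⟩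

theorem contDiffWithinAt_of_contDiffOn_target {F : Type*} [NormedAddCommGroup F] [NormedSpace ℝ F]
    {q : ℕ} {x₀ x : X} {u : E → F} (hu : ContDiffOn ℝ q u (extChartAt I x₀).target)
    (hx : x ∈ (chartAt H x₀).source) :
    ContDiffWithinAt ℝ q u (range I) (extChartAt I x₀ x) := by
  have hx' : x ∈ (extChartAt I x₀).source := by simpa using hx
  exact (hu _ ((extChartAt I x₀).map_source hx')).mono_of_mem_nhdsWithin
    (extChartAt_target_mem_nhdsWithin_of_mem ((extChartAt I x₀).map_source hx'))

theorem eventually_iteratedFDerivWithin_le {F : Type*} [NormedAddCommGroup F] [NormedSpace ℝ F]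
    {q : ℕ} {x₀ : X} {u : E → F} (hu : ContDiffOn ℝ q u (extChartAt I x₀).target) :
    ∃ C : ℝ, ∀ᶠ x in 𝓝 x₀, ∀ j ≤ q,
      ‖iteratedFDerivWithin ℝ j u (range I) (extChartAt I x₀ x)‖ ≤ C := by
  have key (j : ℕ) (hj : j ≤ q) : ∃ C : ℝ, 0 ≤ C ∧ ∀ᶠ x in 𝓝 x₀,
      ‖iteratedFDerivWithin ℝ j u (range I) (extChartAt I x₀ x)‖ ≤ C := by
    have h1 : ContinuousWithinAt (iteratedFDerivWithin ℝ j u (range I)) (range I)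
        (extChartAt I x₀ x₀) :=
      (contDiffWithinAt_of_contDiffOn_target hu
        (mem_chart_source H x₀)).continuousWithinAt_iteratedFDerivWithin
        I.uniqueDiffOn (by exact_mod_cast hj) (mem_range_self _)
    have h2 : Tendsto (extChartAt I x₀) (𝓝 x₀) (𝓝[range I] (extChartAt I x₀ x₀)) :=
      tendsto_nhdsWithin_iff.2 ⟨continuousAt_extChartAt x₀,
        Eventually.of_forall fun x => mem_range_self _⟩
    have h3 := (h1.tendsto.comp h2).norm
    refine ⟨_, by positivity, (h3.eventually (gt_mem_nhds (lt_add_one _))).mono fun x hx => hx.le⟩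
  choose! C hC0 hC using key
  refine ⟨∑ j ∈ Finset.range (q + 1), C j, ?_⟩
  have h : ∀ᶠ x in 𝓝 x₀, ∀ j ∈ Finset.range (q + 1),
      ‖iteratedFDerivWithin ℝ j u (range I) (extChartAt I x₀ x)‖ ≤ C j :=
    (Filter.eventually_all_finset _).2 fun j hj => hC j (by simpa [Nat.lt_succ_iff] using hj)
  filter_upwards [h] with x hx j hj
  have hj' : j ∈ Finset.range (q + 1) := by simpa [Nat.lt_succ_iff] using hj
  exact (hx j hj').trans (Finset.single_le_sum (f := C)
    (fun i hi => hC0 i (by simpa [Nat.lt_succ_iff] using hi)) hj')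

theorem isBoundedCq_pair {q : ℕ} {φ : C(X, ℝ)} (h : ContMDiff I 𝓘(ℝ, ℝ) q φ) :
    IsBoundedCq I q {φ, -φ} := by
  have hneg : ContMDiff I 𝓘(ℝ, ℝ) q (-φ : C(X, ℝ)) := h.neg
  refine ⟨fun ψ hψ => ?_, fun x₀ => ?_⟩
  · rcases hψ with rfl | rfl
    exacts [h, hneg]
  · have key (φ : C(X, ℝ)) (hφ : ContMDiff I 𝓘(ℝ, ℝ) q φ) :
        ContDiffOn ℝ q (fun y => φ ((extChartAt I x₀).symm y)) (extChartAt I x₀).target :=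
      (hφ.comp_contMDiffOn ((contMDiffOn_extChartAt_symm (n := ∞) (I := I) x₀).of_le
        (by exact_mod_cast le_top))).contDiffOn
    obtain ⟨C, hC⟩ := eventually_iteratedFDerivWithin_le (key _ h)
    obtain ⟨C', hC'⟩ := eventually_iteratedFDerivWithin_le (key _ hneg)
    refine ⟨_, hC.and hC', max C C', fun ψ hψ x hx j hj => ?_⟩
    rcases hψ with rfl | rfl
    exacts [(hx.1 j hj).trans (le_max_left _ _), (hx.2 j hj).trans (le_max_right _ _)]

theorem contDiffOn_chartExpr {b : SpaceField I X} (hb : IsCqField 1 b) (x₀ : X) :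
    ContDiffOn ℝ 1 (chartExpr x₀ b) (extChartAt I x₀).target := by
  have h1 := ((trivializationAt E (TangentSpace I : X → Type _) x₀).contMDiffOn_section_baseSet_iff
    (IB := I) (n := 1) (s := fun x => SpaceField.val b x)).1 (hb.contMDiffOn.of_le (by simp))
  rw [TangentBundle.trivializationAt_baseSet] at h1
  have h2 := h1.comp (ContMDiffOn.of_le (m := 1)
      (contMDiffOn_extChartAt_symm (n := ∞) (I := I) x₀) (by simp))
    (fun y hy => by simpa using (extChartAt I x₀).map_target hy)
  refine h2.contDiffOn.congr fun y hy => ?_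
  have hy' : (extChartAt I x₀).symm y ∈ (chartAt H x₀).source := by
    simpa using (extChartAt I x₀).map_target hy
  exact (DFunLike.congr_fun (coordAt_eq_mfderiv hy') _).symm.trans (coordAt_apply hy' _)

theorem IsCqField.sum_smul {ι : Type*} (s : Finset ι) {b : ι → SpaceField I X}
    (hb : ∀ i, IsCqField 1 (b i)) (c : ι → ℝ) : IsCqField 1 (∑ i ∈ s, c i • b i) := by
  classical
  induction s using Finset.induction_on with
  | empty =>
    rw [Finset.sum_empty]
    exact contMDiff_zeroSection ℝ (TangentSpace I : X → Type _)
  | insert a s ha ih =>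
    rw [Finset.sum_insert ha]
    exact ContMDiff.add_section (ContMDiff.const_smul_section (hb a)) ih

theorem chartExpr_sum_smul {ι : Type*} (s : Finset ι) (b : ι → SpaceField I X) (c : ι → ℝ)
    (x₀ : X) : chartExpr x₀ (∑ i ∈ s, c i • b i) = fun y => ∑ i ∈ s, c i • chartExpr x₀ (b i) y := by
  classical
  induction s using Finset.induction_on with
  | empty =>
    funext y
    rw [Finset.sum_empty, Finset.sum_empty]
    exact map_zero (mfderiv I 𝓘(ℝ, E) (extChartAt I x₀) ((extChartAt I x₀).symm y))
  | insert a s ha ih =>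
    funext y
    rw [Finset.sum_insert ha, Finset.sum_insert ha, ← congrFun ih y]
    have h1 := map_add (mfderiv I 𝓘(ℝ, E) (extChartAt I x₀) ((extChartAt I x₀).symm y))
      (c a • SpaceField.val (b a) ((extChartAt I x₀).symm y))
      (SpaceField.val (∑ i ∈ s, c i • b i) ((extChartAt I x₀).symm y))
    rw [map_smul] at h1
    exact h1

theorem isBoundedCqField_combinations {ι : Type*} [Fintype ι] {b : ι → SpaceField I X}
    (hb : ∀ i, IsCqField 1 (b i)) :
    IsBoundedCqField 1 {v | ∃ c : ι → ℝ, (∀ i, |c i| ≤ 1) ∧ v = ∑ i, c i • b i} := by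
  refine ⟨?_, fun x₀ => ?_⟩
  · rintro v ⟨c, -, rfl⟩
    exact IsCqField.sum_smul _ hb c
  · have h (i : ι) := eventually_iteratedFDerivWithin_le (q := 1)
      (by exact_mod_cast contDiffOn_chartExpr (hb i) x₀)
    choose C hC using h
    refine ⟨_, (eventually_all.2 hC).and ((chartAt H x₀).open_source.mem_nhds
      (mem_chart_source H x₀)), ∑ i, C i, ?_⟩
    rintro v ⟨c, hc, rfl⟩ x ⟨hx, hxs⟩ j hj
    have hd (i : ι) : ContDiffWithinAt ℝ j (chartExpr x₀ (b i)) (range I) (extChartAt I x₀ x) :=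
      (contDiffWithinAt_of_contDiffOn_target (q := 1)
        (by exact_mod_cast contDiffOn_chartExpr (hb i) x₀) hxs).of_le (by exact_mod_cast hj)
    rw [chartExpr_sum_smul, iteratedFDerivWithin_fun_sum_apply I.uniqueDiffOn
      (x := extChartAt I x₀ x) (mem_range_self _)
      (fun i _ => (hd i).const_smul (c i))]
    refine (norm_sum_le _ _).trans (Finset.sum_le_sum fun i _ => ?_)
    have := iteratedFDerivWithin_const_smul_apply (a := c i) (hd i) I.uniqueDiffOn
      (x := extChartAt I x₀ x) (mem_range_self _)
    rw [Pi.smul_def] at this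
    rw [this, norm_smul]
    have h1 : ‖c i‖ ≤ 1 := hc i
    have h2 := hx i j hj
    nlinarith [norm_nonneg (iteratedFDerivWithin ℝ j (chartExpr x₀ (b i)) (range I)
      (extChartAt I x₀ x))]

end Smooth

section Gradients

variable {E : Type*} [NormedAddCommGroup E] [NormedSpace ℝ E] [FiniteDimensional ℝ E]
  {H : Type*} [TopologicalSpace H] {I : ModelWithCorners ℝ E H}
  {X : Type*} [TopologicalSpace X] [ChartedSpace H X] [IsManifold I ∞ X]

variable (I) in
/-- The derivative, at the image of `x` in the chart at `x₀`, of the expression of `ψ` in this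
chart. -/
def chartDeriv (ψ : X → ℝ) (x₀ x : X) : E →L[ℝ] ℝ :=
  fderivWithin ℝ (ψ ∘ (extChartAt I x₀).symm) (range I) (extChartAt I x₀ x)

variable (I) in
/-- The derivative of `ψ` at `x` in the direction `v`. -/
def derivAlong (ψ : X → ℝ) (x : X) (v : TangentSpace I x) : ℝ := mfderiv I 𝓘(ℝ, ℝ) ψ x v

theorem differentiableWithinAt_comp_extChartAt_symm {ψ : X → ℝ} {x₀ x : X}
    (hψ : MDifferentiableAt I 𝓘(ℝ, ℝ) ψ x) (hx : x ∈ (chartAt H x₀).source) :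
    DifferentiableWithinAt ℝ (ψ ∘ (extChartAt I x₀).symm) (range I) (extChartAt I x₀ x) := by
  have hx' : x ∈ (extChartAt I x₀).source := by simpa using hx
  have hinv := (extChartAt I x₀).left_inv hx'
  have h1 := mdifferentiableWithinAt_extChartAt_symm (I := I) ((extChartAt I x₀).map_source hx')
  have h2 : MDifferentiableWithinAt 𝓘(ℝ, E) 𝓘(ℝ, ℝ) (ψ ∘ (extChartAt I x₀).symm) (range I)
      (extChartAt I x₀ x) := by
    refine MDifferentiableAt.comp_mdifferentiableWithinAt (I' := I) _ ?_ h1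
    rwa [hinv]
  exact h2.differentiableWithinAt

theorem mfderiv_frameAt {ψ : X → ℝ} {x₀ x : X} (hψ : MDifferentiableAt I 𝓘(ℝ, ℝ) ψ x)
    (hx : x ∈ (chartAt H x₀).source) (e : E) :
    (mfderiv I 𝓘(ℝ, ℝ) ψ x (frameAt I x₀ x e) : ℝ) = chartDeriv I ψ x₀ x e := by
  have hx' : x ∈ (extChartAt I x₀).source := by simpa using hx
  have hinv := (extChartAt I x₀).left_inv hx'
  have h1 := mdifferentiableWithinAt_extChartAt_symm (I := I) ((extChartAt I x₀).map_source hx')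
  have h2 := mfderiv_comp_mfderivWithin (I' := I) (I'' := 𝓘(ℝ, ℝ)) (g := ψ) (extChartAt I x₀ x)
    (by rwa [hinv]) h1
    (I.uniqueMDiffOn _ (mem_range_self ((chartAt H x₀) x)))
  rw [mfderivWithin_eq_fderivWithin] at h2
  have h3 := (DFunLike.congr_fun h2 e).symm
  rw [frameAt_eq_mfderivWithin hx]
  let f : X → E → ℝ := fun z w => (mfderiv I 𝓘(ℝ, ℝ) ψ z : TangentSpace I z → ℝ) w
  let w : E := mfderivWithin 𝓘(ℝ, E) I (extChartAt I x₀).symm (range I) (extChartAt I x₀ x) e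
  exact (congrArg (fun z => f z w) hinv.symm).trans h3

theorem mfderiv_eq_chartDeriv {ψ : X → ℝ} {x₀ x : X} (hψ : MDifferentiableAt I 𝓘(ℝ, ℝ) ψ x)
    (hx : x ∈ (chartAt H x₀).source) (v : TangentSpace I x) :
    (mfderiv I 𝓘(ℝ, ℝ) ψ x v : ℝ) = chartDeriv I ψ x₀ x (coordAt I x₀ x v) := by
  rw [← mfderiv_frameAt hψ hx, frameAt_coordAt hx]

theorem continuousOn_chartDeriv {ψ : X → ℝ} (hψ : ContMDiff I 𝓘(ℝ, ℝ) 1 ψ) (x₀ : X) :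
    ContinuousOn (chartDeriv I ψ x₀) (chartAt H x₀).source := by
  have h1 : ContDiffOn ℝ 1 (ψ ∘ (extChartAt I x₀).symm) (extChartAt I x₀).target :=
    (hψ.comp_contMDiffOn (ContMDiffOn.of_le (m := 1)
      (contMDiffOn_extChartAt_symm (n := ∞) (I := I) x₀) (by simp))).contDiffOn
  have h2 : ContinuousOn (fderivWithin ℝ (ψ ∘ (extChartAt I x₀).symm) (range I))
      (extChartAt I x₀).target := by
    refine (h1.continuousOn_fderivWithin (uniqueDiffOn_extChartAt_target x₀) le_rfl).congr
      fun y hy => ?_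
    exact (((h1.differentiableOn one_ne_zero y hy).mono_of_mem_nhdsWithin
      (extChartAt_target_mem_nhdsWithin_of_mem hy)).hasFDerivWithinAt.mono
        (extChartAt_target_subset_range x₀)).fderivWithin
          (uniqueDiffOn_extChartAt_target x₀ y hy) |>.symm
  refine h2.comp ?_ ?_
  · rw [← extChartAt_source I]
    exact continuousOn_extChartAt x₀
  · rw [← extChartAt_source I]
    exact (extChartAt I x₀).mapsTo

variable [RiemannianBundle (fun x : X => TangentSpace I x)]
  [IsContinuousRiemannianBundle E (fun x : X => TangentSpace I x)]

theorem HasGradient.contMDiff {ψ : X → ℝ} {G : SpaceField I X} (h : HasGradient ψ G) :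
    ContMDiff I 𝓘(ℝ, ℝ) 1 ψ := by
  intro x₀
  have hcont : ContinuousOn (chartDeriv I ψ x₀) (chartAt H x₀).source := by
    refine continuousOn_clm_apply.2 fun e => ?_
    have h1 : ContinuousOn (fun x => ⟪SpaceField.val G x, frameAt I x₀ x e⟫)
        (chartAt H x₀).source :=
      ContinuousOn.inner_bundle (F := E) (E := fun x : X => TangentSpace I x) (b := fun x => x)
        G.continuous.continuousOn (continuousOn_frameAt x₀ e)
    refine h1.congr fun x hx => ?_
    exact ((h.gradient x _).trans (mfderiv_frameAt (h.differentiable x) hx e)).symm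
  rw [contMDiffAt_iff]
  refine ⟨(h.differentiable x₀).continuousAt, ?_⟩
  suffices ContDiffOn ℝ 1 (ψ ∘ (extChartAt I x₀).symm) (extChartAt I x₀).target from
    (this _ (mem_extChartAt_target x₀)).mono_of_mem_nhdsWithin
      (extChartAt_target_mem_nhdsWithin x₀)
  rw [← zero_add (1 : ℕ∞ω),
    contDiffOn_succ_iff_hasFDerivWithinAt_of_uniqueDiffOn (uniqueDiffOn_extChartAt_target x₀)]
  have hsymm : MapsTo (extChartAt I x₀).symm (extChartAt I x₀).target (chartAt H x₀).source :=
    fun y hy => by simpa using (extChartAt I x₀).map_target hy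
  refine ⟨by simp, fun y => chartDeriv I ψ x₀ ((extChartAt I x₀).symm y), ?_, fun y hy => ?_⟩
  · rw [contDiffOn_zero]
    exact hcont.comp (continuousOn_extChartAt_symm x₀) hsymm
  · have := (differentiableWithinAt_comp_extChartAt_symm (h.differentiable _)
      (hsymm hy)).hasFDerivWithinAt
    change HasFDerivWithinAt _ (chartDeriv I ψ x₀ ((extChartAt I x₀).symm y)) _ _ at this
    rw [(extChartAt I x₀).right_inv hy] at this
    exact this.mono (extChartAt_target_subset_range x₀)

theorem exists_hasGradient {ψ : X → ℝ} (hψ : ContMDiff I 𝓘(ℝ, ℝ) 1 ψ) :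
    ∃ G : SpaceField I X, HasGradient ψ G := by
  have hd : MDifferentiable I 𝓘(ℝ, ℝ) ψ := hψ.mdifferentiable one_ne_zero
  have hex (x : X) : ∃ v : TangentSpace I x, ∀ w : TangentSpace I x,
      ⟪v, w⟫ = (mfderiv I 𝓘(ℝ, ℝ) ψ x w : ℝ) := by
    have : FiniteDimensional ℝ (TangentSpace I x) := inferInstanceAs (FiniteDimensional ℝ E)
    have : CompleteSpace (TangentSpace I x) := FiniteDimensional.complete ℝ _
    let L : TangentSpace I x →L[ℝ] ℝ := mfderiv I 𝓘(ℝ, ℝ) ψ x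
    exact ⟨(InnerProductSpace.toDual ℝ (TangentSpace I x)).symm L,
      fun w => InnerProductSpace.toDual_symm_apply⟩
  choose G hG using hex
  suffices hcont : Continuous fun x : X => (⟨x, G x⟩ : TangentBundle I X) from
    ⟨⟨G, hcont⟩, hd, hG⟩
  refine continuous_iff_continuousAt.2 fun x₀ => ?_
  refine (FiberBundle.continuousAt_totalSpace E _).2 ⟨continuousAt_id, ?_⟩
  have hx₀ := mem_chart_source H x₀
  have hsrc := (chartAt H x₀).open_source.mem_nhds hx₀
  suffices ContinuousAt (fun x => coordAt I x₀ x (G x)) x₀ by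
    refine this.congr ?_
    filter_upwards [hsrc] with x hx using coordAt_apply hx _
  set e₀ := coordAt I x₀ x₀ (G x₀) with he₀
  have hlin (x : X) : ∃ L : E →L[ℝ] ℝ, ∀ e,
      L e = chartDeriv I ψ x₀ x e - ⟪frameAt I x₀ x e₀, frameAt I x₀ x e⟫ :=
    ⟨LinearMap.toContinuousLinearMap
      { toFun := fun e => chartDeriv I ψ x₀ x e - ⟪frameAt I x₀ x e₀, frameAt I x₀ x e⟫
        map_add' := fun e e' => by rw [map_add, map_add, inner_add_right]; ring
        map_smul' := fun c e => by
          rw [map_smul, map_smul, inner_smul_right, RingHom.id_apply, smul_eq_mul, smul_eq_mul]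
          ring }, fun e => rfl⟩
  choose L hL using hlin
  have hLcont : ContinuousOn L (chartAt H x₀).source := by
    refine continuousOn_clm_apply.2 fun e => ?_
    have h1 : ContinuousOn (fun x => ⟪frameAt I x₀ x e₀, frameAt I x₀ x e⟫)
        (chartAt H x₀).source :=
      ContinuousOn.inner_bundle (F := E) (E := fun x : X => TangentSpace I x) (b := fun x => x)
        (continuousOn_frameAt x₀ e₀) (continuousOn_frameAt x₀ e)
    simp only [hL]
    exact (continuousOn_clm_apply.1 (continuousOn_chartDeriv hψ x₀) e).sub h1
  have hLG (x : X) (hx : x ∈ (chartAt H x₀).source) (e : E) :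
      L x e = ⟪G x - frameAt I x₀ x e₀, frameAt I x₀ x e⟫ := by
    rw [hL, ← mfderiv_frameAt (hd x) hx, ← hG, inner_sub_left]
  have hL0 : L x₀ = 0 := by
    ext e
    rw [hLG x₀ hx₀, he₀, frameAt_coordAt hx₀, sub_self, inner_zero_left]
    rfl
  obtain ⟨C, hC, hbound⟩ := eventually_norm_coordAt_le (I := I) x₀
  rw [ContinuousAt, tendsto_iff_norm_sub_tendsto_zero]
  have hlim : Tendsto (fun x => C * (C * ‖L x‖)) (𝓝 x₀) (𝓝 0) := by
    have := (((hLcont.continuousAt hsrc).norm.tendsto).const_mul C).const_mul C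
    rwa [hL0, norm_zero, mul_zero, mul_zero] at this
  refine squeeze_zero' (Eventually.of_forall fun _ => norm_nonneg _) ?_ hlim
  filter_upwards [hbound, hsrc] with x hx hxs
  set w := G x - frameAt I x₀ x e₀ with hw
  have h1 : coordAt I x₀ x (G x) - e₀ = coordAt I x₀ x w := by
    rw [hw, map_sub, coordAt_frameAt hxs]
  have h2 : ‖w‖ * ‖w‖ ≤ C * ‖L x‖ * ‖w‖ := by
    have h3 := hLG x hxs (coordAt I x₀ x w)
    rw [frameAt_coordAt hxs, ← hw, real_inner_self_eq_norm_mul_norm] at h3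
    rw [← h3]
    calc L x (coordAt I x₀ x w) ≤ ‖L x (coordAt I x₀ x w)‖ := le_abs_self _
      _ ≤ ‖L x‖ * ‖coordAt I x₀ x w‖ := (L x).le_opNorm _
      _ ≤ ‖L x‖ * (C * ‖w‖) := by gcongr; exact hx w
      _ = C * ‖L x‖ * ‖w‖ := by ring
  have h4 : ‖w‖ ≤ C * ‖L x‖ := by
    rcases (norm_nonneg w).eq_or_lt with h0 | h0
    · rw [← h0]; positivity
    · exact le_of_mul_le_mul_right h2 h0
  rw [h1]
  exact (hx w).trans (by gcongr)

theorem HasGradient.norm_val_sub_le {ψ ψ' : X → ℝ} {G G' : SpaceField I X} (h : HasGradient ψ G)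
    (h' : HasGradient ψ' G') {x : X} {ε : ℝ} (hε : 0 ≤ ε)
    (hle : ∀ v : TangentSpace I x, |derivAlong I ψ x v - derivAlong I ψ' x v|
      ≤ ε * ‖v‖) : ‖SpaceField.val G x - SpaceField.val G' x‖ ≤ ε := by
  set w := SpaceField.val G x - SpaceField.val G' x with hw
  have h1 := hle w
  rw [derivAlong, derivAlong, ← h.gradient, ← h'.gradient, ← inner_sub_left, ← hw, real_inner_self_eq_norm_mul_norm,
    abs_of_nonneg (by positivity)] at h1
  rcases (norm_nonneg w).eq_or_lt with h0 | h0
  · rw [← h0]; exact hε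
  · exact le_of_mul_le_mul_right h1 h0

end Gradients

section Mollification

open scoped Convolution

variable {E : Type*} [NormedAddCommGroup E] [NormedSpace ℝ E] [FiniteDimensional ℝ E]

/-- All points of the set can be pushed inside it, uniformly, along a fixed direction. -/
def HasInwardDirection (S : Set E) : Prop :=
  ∃ e : E, ∃ r > 0, ∀ y ∈ S, ∀ s > 0, Metric.ball (y + s • e) (s * r) ⊆ S

theorem IsHalfSpaceModel.hasInwardDirection {H : Type*} [TopologicalSpace H]
    {I : ModelWithCorners ℝ E H} (hI : IsHalfSpaceModel I) : HasInwardDirection (range I) := by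
  rcases hI with h | ⟨l, hl, h⟩
  · exact ⟨0, 1, one_pos, fun y _ s _ => h ▸ subset_univ _⟩
  · obtain ⟨v, hv⟩ : ∃ v, l v ≠ 0 := by
      by_contra! h0
      exact hl (ContinuousLinearMap.ext h0)
    refine ⟨(l v)⁻¹ • v, (‖l‖ + 1)⁻¹, by positivity, fun y hy s hs z hz => ?_⟩
    rw [h, mem_ofPred_eq] at hy ⊢
    rw [Metric.mem_ball, dist_eq_norm] at hz
    have h1 : l z = l y + s + l (z - (y + s • (l v)⁻¹ • v)) := by
      simp [map_sub, map_add, map_smul, inv_mul_cancel₀ hv]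
    have h2 : |l (z - (y + s • (l v)⁻¹ • v))| ≤ s := by
      calc _ ≤ ‖l‖ * ‖z - (y + s • (l v)⁻¹ • v)‖ := l.le_opNorm _
        _ ≤ (‖l‖ + 1) * (s * (‖l‖ + 1)⁻¹) := by
          apply mul_le_mul (by linarith) hz.le (norm_nonneg _) (by positivity)
        _ = s := by field_simp
    linarith [(abs_le.1 h2).1]

theorem locallyIntegrable_indicator_of_continuousOn [MeasurableSpace E] [BorelSpace E]
    {F : Type*} [NormedAddCommGroup F] {μ : Measure E} [IsLocallyFiniteMeasure μ]
    {S : Set E} (hS : IsClosed S) {u : E → F} (hu : ContinuousOn u S) :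
    LocallyIntegrable (S.indicator u) μ := by
  refine locallyIntegrable_iff.2 fun k hk => ?_
  rw [IntegrableOn, integrable_indicator_iff hS.measurableSet, IntegrableOn,
    Measure.restrict_restrict hS.measurableSet]
  exact (hu.mono inter_subset_left).integrableOn_compact (hk.inter_left hS)

theorem dist_normed_convolution_indicator_le [MeasurableSpace E] [BorelSpace E]
    {F : Type*} [NormedAddCommGroup F] [NormedSpace ℝ F] [CompleteSpace F]
    {μ : Measure E} [μ.IsAddHaarMeasure] {S : Set E} {g : E → F} (φ : ContDiffBump (0 : E))
    {x₀ : E} {z₀ : F} {ε : ℝ} (hε : 0 ≤ ε) (hg : LocallyIntegrable (S.indicator g) μ)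
    (h : ∀ z ∈ Metric.ball x₀ φ.rOut, z ∈ S ∧ dist (g z) z₀ ≤ ε) :
    dist ((φ.normed μ ⋆[ContinuousLinearMap.lsmul ℝ ℝ, μ] S.indicator g) x₀) z₀ ≤ ε :=
  dist_convolution_le hε φ.support_normed_eq.subset φ.nonneg_normed φ.integral_normed
    hg.aestronglyMeasurable fun z hz => by
      rw [indicator_of_mem (h z hz).1]
      exact (h z hz).2

theorem hasFDerivAt_convolution_indicator [MeasurableSpace E] [BorelSpace E]
    {μ : Measure E} [μ.IsAddHaarMeasure] {S : Set E} (hS : IsClosed S) {u : E → ℝ}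
    (hS' : UniqueDiffOn ℝ S) (hu : ContDiffOn ℝ 1 u S) (φ : ContDiffBump (0 : E)) {x₀ : E}
    (hx₀ : Metric.closedBall x₀ (2 * φ.rOut) ⊆ S) :
    HasFDerivAt (φ.normed μ ⋆[ContinuousLinearMap.lsmul ℝ ℝ, μ] S.indicator u)
      ((φ.normed μ ⋆[ContinuousLinearMap.lsmul ℝ ℝ, μ]
        S.indicator (fderivWithin ℝ u S)) x₀) x₀ := by
  have hr := φ.rOut_pos
  have hD : ContinuousOn (fderivWithin ℝ u S) S := hu.continuousOn_fderivWithin hS' le_rfl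
  have h1 (x : E) := (φ.hasCompactSupport_normed (μ := μ)).convolutionExists_left (μ := μ)
    (ContinuousLinearMap.lsmul ℝ ℝ) φ.continuous_normed
    (locallyIntegrable_indicator_of_continuousOn (μ := μ) hS hu.continuousOn) x
  have h2 := (φ.hasCompactSupport_normed (μ := μ)).convolutionExists_left (μ := μ)
    (ContinuousLinearMap.lsmul ℝ ℝ) φ.continuous_normed
    (locallyIntegrable_indicator_of_continuousOn (μ := μ) hS hD) x₀
  obtain ⟨M, hM⟩ := (isCompact_closedBall x₀ (2 * φ.rOut)).exists_bound_of_continuousOn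
    (hD.mono hx₀)
  have hmem {x t : E} (hx : x ∈ Metric.ball x₀ φ.rOut) (ht : φ.normed μ t ≠ 0) :
      x - t ∈ Metric.ball x₀ (2 * φ.rOut) := by
    have : t ∈ Metric.ball (0 : E) φ.rOut := by
      rw [← φ.support_normed_eq (μ := μ)]
      exact ht
    rw [mem_ball_zero_iff] at this
    rw [Metric.mem_ball, dist_eq_norm] at hx ⊢
    calc ‖x - t - x₀‖ = ‖(x - x₀) - t‖ := by congr 1; abel
      _ ≤ ‖x - x₀‖ + ‖t‖ := norm_sub_le _ _
      _ < 2 * φ.rOut := by linarith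
  refine hasFDerivAt_integral_of_dominated_of_fderiv_le
    (F' := fun x t => φ.normed μ t • S.indicator (fderivWithin ℝ u S) (x - t))
    (bound := fun t => φ.normed μ t * M) (Metric.ball_mem_nhds x₀ hr)
    (Eventually.of_forall fun x => (h1 x).aestronglyMeasurable) (h1 x₀) h2.aestronglyMeasurable
    (Eventually.of_forall fun t x hx => ?_) (φ.integrable_normed.mul_const M)
    (Eventually.of_forall fun t x hx => ?_)
  · rw [norm_smul, Real.norm_of_nonneg (φ.nonneg_normed t)]
    by_cases ht : φ.normed μ t = 0
    · rw [ht, zero_mul, zero_mul]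
    · have h3 := Metric.ball_subset_closedBall (hmem hx ht)
      refine mul_le_mul_of_nonneg_left ?_ (φ.nonneg_normed t)
      rw [indicator_of_mem (hx₀ h3)]
      exact hM _ h3
  · by_cases ht : φ.normed μ t = 0
    · simp only [ht, map_zero, zero_apply, zero_smul]
      exact hasFDerivAt_const _ _
    · have h3 := hmem hx ht
      have hnhds : S ∈ 𝓝 (x - t) := mem_of_superset (Metric.isOpen_ball.mem_nhds h3)
        (Metric.ball_subset_closedBall.trans hx₀)
      have h4 : HasFDerivAt u (fderivWithin ℝ u S (x - t)) (x - t) :=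
        (hu.differentiableOn one_ne_zero _ (mem_of_mem_nhds hnhds)).hasFDerivWithinAt.hasFDerivAt
          hnhds
      have h5 : HasFDerivAt (S.indicator u) (fderivWithin ℝ u S (x - t)) (x - t) :=
        h4.congr_of_eventuallyEq (mem_of_superset hnhds fun y hy => indicator_of_mem hy u)
      rw [indicator_of_mem (mem_of_mem_nhds hnhds)]
      have h6 : HasFDerivAt (fun x => S.indicator u (x - t)) (fderivWithin ℝ u S (x - t)) x := by
        have h7 := HasFDerivAt.comp (g := S.indicator u) x h5 ((hasFDerivAt_id x).sub_const t)
        rwa [ContinuousLinearMap.comp_id] at h7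
      exact h6.const_smul (φ.normed μ t)

/-- A `C¹` function on a closed set that can be pushed inside itself is approximated in `C¹`, on
compact sets, by smooth functions on the whole space. -/
theorem exists_contDiff_approx_of_hasInwardDirection {S : Set E} (hS : IsClosed S)
    (hS' : UniqueDiffOn ℝ S) (hin : HasInwardDirection S) {u : E → ℝ} (hu : ContDiffOn ℝ 1 u S)
    {K : Set E} (hK : IsCompact K) (hKS : K ⊆ S) {ε : ℝ} (hε : 0 < ε) :
    ∃ w : E → ℝ, ContDiff ℝ ∞ w ∧ ∀ y ∈ K, |w y - u y| ≤ ε ∧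
      ‖fderiv ℝ w y - fderivWithin ℝ u S y‖ ≤ ε := by
  borelize E
  let μ : Measure E := Measure.addHaar
  have hD : ContinuousOn (fderivWithin ℝ u S) S := hu.continuousOn_fderivWithin hS' le_rfl
  have hK' : IsCompact (Metric.cthickening 1 K ∩ S) := hK.cthickening.inter_right hS
  obtain ⟨δ₁, hδ₁, h1⟩ := Metric.uniformContinuousOn_iff.1
    (hK'.uniformContinuousOn_of_continuous (hu.continuousOn.mono inter_subset_right)) (ε / 2)
    (by positivity)
  obtain ⟨δ₂, hδ₂, h2⟩ := Metric.uniformContinuousOn_iff.1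
    (hK'.uniformContinuousOn_of_continuous (hD.mono inter_subset_right)) (ε / 2)
    (by positivity)
  obtain ⟨e, r, hr, hball⟩ := hin
  set δ := min 1 (min δ₁ δ₂) with hδ
  have hδ0 : 0 < δ := lt_min one_pos (lt_min hδ₁ hδ₂)
  set s := δ / (2 * (‖e‖ + r)) with hs
  have her : 0 < ‖e‖ + r := by positivity
  have hs0 : 0 < s := by positivity
  have hsδ : s * ‖e‖ + s * r < δ := by
    have : s * (‖e‖ + r) = δ / 2 := by rw [hs]; field_simp
    linarith [mul_add s ‖e‖ r]
  let φ : ContDiffBump (0 : E) := ⟨s * r / 6, s * r / 3, by positivity, by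
    have : 0 < s * r := by positivity
    linarith⟩
  have hφ : φ.rOut = s * r / 3 := rfl
  have hsr : 0 < s * r := by positivity
  have hloc := locallyIntegrable_indicator_of_continuousOn (μ := μ) hS hu.continuousOn
  have hlocD := locallyIntegrable_indicator_of_continuousOn (μ := μ) hS hD
  let W : E → ℝ := φ.normed μ ⋆[ContinuousLinearMap.lsmul ℝ ℝ, μ] S.indicator u
  have hW : ContDiff ℝ ∞ W :=
    φ.hasCompactSupport_normed.contDiff_convolution_left _ φ.contDiff_normed hloc
  refine ⟨fun y => W (y + s • e), hW.comp (contDiff_id.add contDiff_const), fun y hy => ?_⟩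
  have hsub : Metric.ball (y + s • e) (s * r) ⊆ S := hball y (hKS hy) s hs0
  have hcl : Metric.closedBall (y + s • e) (2 * φ.rOut) ⊆ S :=
    (Metric.closedBall_subset_ball (by rw [hφ]; linarith)).trans hsub
  -- points near the shifted point are close to `y`
  have hclose {z : E} (hz : z ∈ Metric.ball (y + s • e) (s * r)) :
      z ∈ Metric.cthickening 1 K ∩ S ∧ dist z y < δ := by
    have hzy : dist z y < δ := by
      calc dist z y ≤ dist z (y + s • e) + dist (y + s • e) y := dist_triangle _ _ _
        _ < s * r + s * ‖e‖ := by
          have : dist (y + s • e) y = s * ‖e‖ := by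
            rw [dist_eq_norm, add_sub_cancel_left, norm_smul, Real.norm_of_nonneg hs0.le]
          rw [this]
          exact add_lt_add_left (Metric.mem_ball.1 hz) _
        _ < δ := by linarith
    exact ⟨⟨Metric.mem_cthickening_of_dist_le z y 1 K hy (hzy.le.trans (min_le_left _ _)),
      hsub hz⟩, hzy⟩
  have hy' : y ∈ Metric.cthickening 1 K ∩ S := ⟨Metric.self_subset_cthickening K hy, hKS hy⟩
  have hsmall : Metric.ball (y + s • e) φ.rOut ⊆ Metric.ball (y + s • e) (s * r) :=
    Metric.ball_subset_ball (by rw [hφ]; linarith)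
  constructor
  · rw [← Real.dist_eq]
    refine dist_normed_convolution_indicator_le φ hε.le hloc fun z hz => ?_
    obtain ⟨hz, hzy⟩ := hclose (hsmall hz)
    exact ⟨hz.2, (h1 z hz y hy' (hzy.trans_le ((min_le_right _ _).trans (min_le_left _ _)))).le.trans (half_le_self hε.le)⟩
  · have h5 := hasFDerivAt_convolution_indicator (μ := μ) hS hS' hu φ hcl
    have h6 : HasFDerivAt (fun y => W (y + s • e)) _ y :=
      HasFDerivAt.comp (g := W) y h5 ((hasFDerivAt_id y).add_const (s • e))
    rw [h6.fderiv, ContinuousLinearMap.comp_id, ← dist_eq_norm]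
    refine dist_normed_convolution_indicator_le φ hε.le hlocD fun z hz => ?_
    obtain ⟨hz, hzy⟩ := hclose (hsmall hz)
    exact ⟨hz.2, (h2 z hz y hy' (hzy.trans_le ((min_le_right _ _).trans (min_le_right _ _)))).le.trans (half_le_self hε.le)⟩

end Mollification

section GradientAlgebra

variable {E : Type*} [NormedAddCommGroup E] [NormedSpace ℝ E] [FiniteDimensional ℝ E]
  {H : Type*} [TopologicalSpace H] {I : ModelWithCorners ℝ E H}
  {X : Type*} [TopologicalSpace X] [ChartedSpace H X] [IsManifold I ∞ X]

theorem chartDeriv_mul {χ ψ : X → ℝ} {x₀ x : X} (hχ : MDifferentiableAt I 𝓘(ℝ, ℝ) χ x)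
    (hψ : MDifferentiableAt I 𝓘(ℝ, ℝ) ψ x) (hx : x ∈ (chartAt H x₀).source) :
    chartDeriv I (χ * ψ) x₀ x = χ x • chartDeriv I ψ x₀ x + ψ x • chartDeriv I χ x₀ x := by
  have hx' : x ∈ (extChartAt I x₀).source := by simpa using hx
  have h := fderivWithin_mul (I.uniqueDiffOn (extChartAt I x₀ x) (mem_range_self _))
    (differentiableWithinAt_comp_extChartAt_symm hχ hx)
    (differentiableWithinAt_comp_extChartAt_symm hψ hx)
  rw [Function.comp_apply, Function.comp_apply, (extChartAt I x₀).left_inv hx'] at h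
  exact h

theorem chartDeriv_comp_extChartAt {w : E → ℝ} {x₀ x : X} (hw : Differentiable ℝ w)
    (hx : x ∈ (chartAt H x₀).source) :
    chartDeriv I (w ∘ extChartAt I x₀) x₀ x = fderiv ℝ w (extChartAt I x₀ x) := by
  have hx' : x ∈ (extChartAt I x₀).source := by simpa using hx
  have h := (extChartAt_target_mem_nhdsWithin_of_mem ((extChartAt I x₀).map_source hx'))
  have h1 : (w ∘ extChartAt I x₀) ∘ (extChartAt I x₀).symm
      =ᶠ[𝓝[range I] (extChartAt I x₀ x)] w := by
    filter_upwards [h] with y hy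
    rw [Function.comp_apply, Function.comp_apply, (extChartAt I x₀).right_inv hy]
  rw [chartDeriv, h1.fderivWithin_eq (h1.eq_of_nhdsWithin (mem_range_self _))]
  exact (hw _).fderivWithin (I.uniqueDiffOn _ (mem_range_self _))

theorem derivAlong_congr {ψ ψ' : X → ℝ} {x : X} (h : ψ =ᶠ[𝓝 x] ψ') (v : TangentSpace I x) :
    derivAlong I ψ x v = derivAlong I ψ' x v :=
  DFunLike.congr_fun (h.mfderiv_eq (I := I) (I' := 𝓘(ℝ, ℝ))) v

variable [RiemannianBundle (fun x : X => TangentSpace I x)]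
  [IsContinuousRiemannianBundle E (fun x : X => TangentSpace I x)]

theorem HasGradient.add {ψ ψ' : X → ℝ} {G G' : SpaceField I X} (h : HasGradient ψ G)
    (h' : HasGradient ψ' G') : HasGradient (ψ + ψ') (G + G') where
  differentiable := h.differentiable.add h'.differentiable
  gradient x v := by
    have h1 := DFunLike.congr_fun (mfderiv_add (h.differentiable x) (h'.differentiable x)) v
    refine Eq.trans ?_ h1.symm
    refine (inner_add_left (SpaceField.val G x) (SpaceField.val G' x) v).trans ?_
    exact congrArg₂ _ (h.gradient x v) (h'.gradient x v)

theorem HasGradient.const_smul {ψ : X → ℝ} {G : SpaceField I X} (h : HasGradient ψ G) (c : ℝ) :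
    HasGradient (c • ψ) (c • G) where
  differentiable := h.differentiable.const_smul c
  gradient x v := by
    have h1 := DFunLike.congr_fun (const_smul_mfderiv (h.differentiable x) c) v
    refine Eq.trans ?_ h1.symm
    refine (real_inner_smul_left (SpaceField.val G x) v c).trans ?_
    exact congrArg (c * ·) (h.gradient x v)

theorem hasGradient_const (c : ℝ) : HasGradient (fun _ : X => c) (0 : SpaceField I X) where
  differentiable := mdifferentiable_const
  gradient x v := by
    rw [mfderiv_const]
    exact inner_zero_left v

theorem HasGradient.unique {ψ : X → ℝ} {G G' : SpaceField I X} (h : HasGradient ψ G)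
    (h' : HasGradient ψ G') : G = G' :=
  VectorField.ext fun x => ext_inner_right ℝ fun v =>
    (h.gradient x v).trans (h'.gradient x v).symm

end GradientAlgebra

section C1Approximation

variable {E : Type*} [NormedAddCommGroup E] [NormedSpace ℝ E] [FiniteDimensional ℝ E]
  {H : Type*} [TopologicalSpace H] {I : ModelWithCorners ℝ E H}
  {X : Type*} [TopologicalSpace X] [CompactSpace X] [T2Space X]
  [ChartedSpace H X] [IsManifold I ∞ X]
  [RiemannianBundle (fun x : X => TangentSpace I x)]
  [IsContinuousRiemannianBundle E (fun x : X => TangentSpace I x)]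

variable (I) in
/-- The function is differentiable with a continuous gradient, and is a limit in `C¹` of functions
of class `C²`. -/
def IsC1Limit (ψ : X → ℝ) : Prop :=
  ∃ G : SpaceField I X, HasGradient ψ G ∧ ∀ ε > 0, ∃ (ψ' : X → ℝ) (G' : SpaceField I X),
    ContMDiff I 𝓘(ℝ, ℝ) 2 ψ' ∧ HasGradient ψ' G' ∧ (∀ x, |ψ' x - ψ x| ≤ ε) ∧ ‖G' - G‖ ≤ ε

theorem IsC1Limit.add {ψ₁ ψ₂ : X → ℝ} (h₁ : IsC1Limit I ψ₁) (h₂ : IsC1Limit I ψ₂) :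
    IsC1Limit I (ψ₁ + ψ₂) := by
  obtain ⟨G₁, hG₁, h₁⟩ := h₁
  obtain ⟨G₂, hG₂, h₂⟩ := h₂
  refine ⟨G₁ + G₂, hG₁.add hG₂, fun ε hε => ?_⟩
  obtain ⟨ψ₁', G₁', hc₁, hg₁, hd₁, hn₁⟩ := h₁ (ε / 2) (by positivity)
  obtain ⟨ψ₂', G₂', hc₂, hg₂, hd₂, hn₂⟩ := h₂ (ε / 2) (by positivity)
  refine ⟨ψ₁' + ψ₂', G₁' + G₂', hc₁.add hc₂, hg₁.add hg₂, fun x => ?_, ?_⟩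
  · calc |(ψ₁' + ψ₂') x - (ψ₁ + ψ₂) x| = |(ψ₁' x - ψ₁ x) + (ψ₂' x - ψ₂ x)| := by
          rw [Pi.add_apply, Pi.add_apply]; congr 1; ring
      _ ≤ ε / 2 + ε / 2 := (abs_add_le _ _).trans (add_le_add (hd₁ x) (hd₂ x))
      _ = ε := add_halves ε
  · calc ‖G₁' + G₂' - (G₁ + G₂)‖ = ‖(G₁' - G₁) + (G₂' - G₂)‖ := by congr 1; abel
      _ ≤ ε / 2 + ε / 2 := (norm_add_le _ _).trans (add_le_add hn₁ hn₂)
      _ = ε := add_halves ε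

theorem isC1Limit_zero : IsC1Limit I (0 : X → ℝ) :=
  ⟨0, hasGradient_const 0, fun ε hε => ⟨0, 0, contMDiff_const, hasGradient_const 0,
    fun x => by simpa using hε.le, by simpa using hε.le⟩⟩

theorem isC1Limit_sum {ι : Type*} (s : Finset ι) {ψ : ι → X → ℝ}
    (h : ∀ i ∈ s, IsC1Limit I (ψ i)) : IsC1Limit I (∑ i ∈ s, ψ i) :=
  Finset.sum_induction ψ (IsC1Limit I) (fun _ _ h h' => h.add h') isC1Limit_zero h

theorem contDiffOn_indicator_target {ψ : X → ℝ} (hψ : ContMDiff I 𝓘(ℝ, ℝ) 1 ψ) {x₀ : X}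
    (hs : tsupport ψ ⊆ (chartAt H x₀).source) :
    ContDiffOn ℝ 1 ((extChartAt I x₀).target.indicator (ψ ∘ (extChartAt I x₀).symm))
      (range I) := by
  have h1 : ContDiffOn ℝ 1 (ψ ∘ (extChartAt I x₀).symm) (extChartAt I x₀).target :=
    (hψ.comp_contMDiffOn (ContMDiffOn.of_le (m := 1)
      (contMDiffOn_extChartAt_symm (n := ∞) (I := I) x₀) (by simp))).contDiffOn
  have hK : IsClosed (extChartAt I x₀ '' tsupport ψ) := by
    refine ((isClosed_tsupport ψ).isCompact.image_of_continuousOn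
      ((continuousOn_extChartAt x₀).mono ?_)).isClosed
    rwa [extChartAt_source]
  intro y hy
  by_cases hyt : y ∈ (extChartAt I x₀).target
  · have hn := extChartAt_target_mem_nhdsWithin_of_mem hyt
    refine ((h1 y hyt).mono_of_mem_nhdsWithin hn).congr_of_eventuallyEq ?_
      (indicator_of_mem hyt _)
    filter_upwards [hn] with z hz using indicator_of_mem hz _
  · have hyK : y ∉ extChartAt I x₀ '' tsupport ψ := by
      rintro ⟨x, hx, rfl⟩
      exact hyt ((extChartAt I x₀).map_source (by simpa using hs hx))
    refine (contDiffWithinAt_const (c := (0 : ℝ))).congr_of_eventuallyEq ?_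
      (indicator_of_notMem hyt _)
    filter_upwards [mem_nhdsWithin_of_mem_nhds (hK.isOpen_compl.mem_nhds hyK)] with z hz
    by_cases hzt : z ∈ (extChartAt I x₀).target
    · rw [indicator_of_mem hzt, Function.comp_apply]
      refine image_eq_zero_of_notMem_tsupport fun hmem => hz ⟨_, hmem, ?_⟩
      exact (extChartAt I x₀).right_inv hzt
    · exact indicator_of_notMem hzt _

theorem exists_isOpen_isC1Limit (hin : HasInwardDirection (range I)) (x₀ : X) :
    ∃ U : Set X, IsOpen U ∧ x₀ ∈ U ∧ ∀ ψ : X → ℝ, ContMDiff I 𝓘(ℝ, ℝ) 1 ψ → tsupport ψ ⊆ U →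
      IsC1Limit I ψ := by
  obtain ⟨C, hC, hbound⟩ := eventually_norm_coordAt_le (I := I) x₀
  obtain ⟨V, hV, hVo, hx₀V⟩ := eventually_nhds_iff.1 hbound
  refine ⟨V ∩ (chartAt H x₀).source, hVo.inter (chartAt H x₀).open_source,
    ⟨hx₀V, mem_chart_source H x₀⟩, fun ψ hψ hsupp => ?_⟩
  set U := V ∩ (chartAt H x₀).source with hU
  have hUo : IsOpen U := hVo.inter (chartAt H x₀).open_source
  obtain ⟨G, hG⟩ := exists_hasGradient hψ
  obtain ⟨χ, hχ0, hχ1, hχ⟩ := exists_contMDiffMap_zero_one_nhds_of_isClosed I (n := ⊤)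
    hUo.isClosed_compl (isClosed_tsupport ψ)
    (disjoint_compl_left_iff_subset.2 hsupp)
  have hχd : ContMDiff I 𝓘(ℝ, ℝ) ∞ χ := χ.contMDiff
  have hL : tsupport χ ⊆ U := by
    intro x hx
    by_contra hxU
    exact (notMem_tsupport_iff_eventuallyEq.2 (eventually_nhdsSet_iff_forall.1 hχ0 x hxU)) hx
  have hLs : tsupport χ ⊆ (chartAt H x₀).source := hL.trans inter_subset_right
  have hψχ : ψ = χ * ψ := by
    funext x
    rw [Pi.mul_apply]
    by_cases hx : x ∈ tsupport ψ
    · rw [(eventually_nhdsSet_iff_forall.1 hχ1 x hx).self_of_nhds, one_mul]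
    · rw [image_eq_zero_of_notMem_tsupport hx, mul_zero]
  have hLc : IsCompact (tsupport χ) := (isClosed_tsupport χ).isCompact
  obtain ⟨B, hB⟩ := hLc.exists_bound_of_continuousOn
    ((continuousOn_chartDeriv (hχd.of_le (by simp)) x₀).mono hLs)
  have hLimg : IsCompact (extChartAt I x₀ '' tsupport χ) :=
    hLc.image_of_continuousOn ((continuousOn_extChartAt x₀).mono (by rwa [extChartAt_source]))
  have hu := contDiffOn_indicator_target hψ (hsupp.trans inter_subset_right)
  set u := (extChartAt I x₀).target.indicator (ψ ∘ (extChartAt I x₀).symm) with hu_def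
  refine ⟨G, hG, fun ε hε => ?_⟩
  have hB' : 0 ≤ |B| := abs_nonneg B
  obtain ⟨w, hw, hwu⟩ := exists_contDiff_approx_of_hasInwardDirection I.isClosed_range
    I.uniqueDiffOn hin hu hLimg (by rintro _ ⟨x, -, rfl⟩; exact mem_range_self _)
    (ε := ε / (1 + (1 + |B|) * C)) (by positivity)
  set η := ε / (1 + (1 + |B|) * C) with hη
  have hη0 : 0 < η := by positivity
  have hηε : η * (1 + (1 + |B|) * C) = ε := by rw [hη]; field_simp
  have hηε1 : η ≤ ε := by
    rw [hη]; exact div_le_self hε.le (by nlinarith [mul_nonneg (add_nonneg zero_le_one hB') hC.le])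
  have hηε2 : η * (1 + |B|) * C ≤ ε := by linarith [hηε]
  -- the approximation, in the chart, is close to the given function
  have hux (x : X) (hx : x ∈ (chartAt H x₀).source) : u (extChartAt I x₀ x) = ψ x := by
    have hx' : x ∈ (extChartAt I x₀).source := by simpa using hx
    rw [hu_def, indicator_of_mem ((extChartAt I x₀).map_source hx'), Function.comp_apply,
      (extChartAt I x₀).left_inv hx']
  have hux' (x : X) (hx : x ∈ (chartAt H x₀).source) :
      fderivWithin ℝ u (range I) (extChartAt I x₀ x) = chartDeriv I ψ x₀ x := by
    have hx' : x ∈ (extChartAt I x₀).source := by simpa using hx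
    have hmem := (extChartAt I x₀).map_source hx'
    refine Filter.EventuallyEq.fderivWithin_eq ?_ (indicator_of_mem hmem _)
    filter_upwards [extChartAt_target_mem_nhdsWithin_of_mem hmem] with z hz
      using indicator_of_mem hz _
  set ψ' : X → ℝ := χ * (w ∘ extChartAt I x₀) with hψ'
  have hsup' : tsupport ψ' ⊆ tsupport χ := tsupport_mul_subset_left
  have hwx (x : X) (hx : x ∈ (chartAt H x₀).source) :
      ContMDiffAt I 𝓘(ℝ, ℝ) ∞ (w ∘ extChartAt I x₀) x :=
    hw.contMDiff.contMDiffAt.comp x (contMDiffAt_extChartAt' hx)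
  have hψ'd : ContMDiff I 𝓘(ℝ, ℝ) ∞ ψ' :=
    contMDiff_of_tsupport fun x hx => hχd.contMDiffAt.mul (hwx x (hLs (hsup' hx)))
  have hψ'2 : ContMDiff I 𝓘(ℝ, ℝ) 2 ψ' := hψ'd.of_le (WithTop.coe_le_coe.2 le_top)
  obtain ⟨G', hG'⟩ := exists_hasGradient (hψ'd.of_le (by simp))
  refine ⟨ψ', G', hψ'2, hG', fun x => ?_, ?_⟩
  · by_cases hx : x ∈ tsupport χ
    · have h1 := (hwu _ (mem_image_of_mem _ hx)).1
      rw [hux x (hLs hx)] at h1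
      have h2 : ψ' x - ψ x = χ x * (w (extChartAt I x₀ x) - ψ x) := by
        conv_lhs => rw [hψχ]
        simp only [hψ', Pi.mul_apply, Function.comp_apply]
        ring
      rw [h2, abs_mul, abs_of_nonneg (hχ x).1]
      calc χ x * |w (extChartAt I x₀ x) - ψ x| ≤ 1 * η :=
            mul_le_mul (hχ x).2 h1 (abs_nonneg _) zero_le_one
        _ ≤ ε := by rwa [one_mul]
    · rw [image_eq_zero_of_notMem_tsupport (fun h => hx (hsup' h)), hψχ, Pi.mul_apply,
        image_eq_zero_of_notMem_tsupport hx, zero_mul, sub_zero, abs_zero]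
      exact hε.le
  · refine VectorField.norm_le hε.le fun x => hG'.norm_val_sub_le (x := x) hG hε.le
      fun (v : TangentSpace I x) => ?_
    by_cases hx : x ∈ tsupport χ
    · have h1 := (hwu _ (mem_image_of_mem _ hx))
      have hxs := hLs hx
      rw [hux x hxs, hux' x hxs] at h1
      have hχx : MDifferentiableAt I 𝓘(ℝ, ℝ) χ x :=
        hχd.contMDiffAt.mdifferentiableAt (by simp)
      have hd1 := chartDeriv_mul hχx ((hwx x hxs).mdifferentiableAt (by simp)) hxs
      rw [chartDeriv_comp_extChartAt (hw.differentiable (by simp)) hxs] at hd1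
      have hd2 := chartDeriv_mul hχx (hψ.contMDiffAt.mdifferentiableAt (x := x) one_ne_zero) hxs
      rw [← hψχ] at hd2
      have hdd : chartDeriv I ψ' x₀ x - chartDeriv I ψ x₀ x =
          χ x • (fderiv ℝ w (extChartAt I x₀ x) - chartDeriv I ψ x₀ x) +
            (w (extChartAt I x₀ x) - ψ x) • chartDeriv I χ x₀ x := by
        rw [hψ', hd1, Function.comp_apply]
        calc _ = (χ x • fderiv ℝ w (extChartAt I x₀ x) +
              w (extChartAt I x₀ x) • chartDeriv I χ x₀ x) -
              (χ x • chartDeriv I ψ x₀ x + ψ x • chartDeriv I χ x₀ x) := by rw [← hd2]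
          _ = _ := by module
      have hnorm : ‖chartDeriv I ψ' x₀ x - chartDeriv I ψ x₀ x‖ ≤ η * (1 + |B|) := by
        rw [hdd]
        refine (norm_add_le _ _).trans ?_
        rw [norm_smul, norm_smul, Real.norm_of_nonneg (hχ x).1, Real.norm_eq_abs, mul_add, mul_one]
        refine add_le_add ?_ ?_
        · calc _ ≤ 1 * η := mul_le_mul (hχ x).2 h1.2 (norm_nonneg _) zero_le_one
            _ = η := one_mul η
        · exact mul_le_mul h1.1 ((hB x hx).trans (le_abs_self B)) (norm_nonneg _) hη0.le
      have e1 : derivAlong I ψ' x v = chartDeriv I ψ' x₀ x (coordAt I x₀ x v) :=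
        mfderiv_eq_chartDeriv (hG'.differentiable x) hxs v
      have e2 : derivAlong I ψ x v = chartDeriv I ψ x₀ x (coordAt I x₀ x v) :=
        mfderiv_eq_chartDeriv (hG.differentiable x) hxs v
      rw [e1, e2, ← sub_apply]
      calc _ ≤ ‖chartDeriv I ψ' x₀ x - chartDeriv I ψ x₀ x‖ * ‖coordAt I x₀ x v‖ :=
            ContinuousLinearMap.le_opNorm _ _
        _ ≤ (η * (1 + |B|)) * (C * ‖v‖) :=
            mul_le_mul hnorm (hV x (hL hx).1 v) (norm_nonneg _) (by positivity)
        _ = η * (1 + |B|) * C * ‖v‖ := by ring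
        _ ≤ ε * ‖v‖ := by gcongr
    · have h1 : ψ' =ᶠ[𝓝 x] ψ := by
        filter_upwards [notMem_tsupport_iff_eventuallyEq.1 hx] with z hz
        rw [hψχ]
        simp only [hψ', Pi.mul_apply, hz, Pi.zero_apply, zero_mul]
      rw [derivAlong_congr h1, sub_self, abs_zero]
      positivity

theorem isC1Limit_of_contMDiff (hin : HasInwardDirection (range I)) {ψ : X → ℝ}
    (hψ : ContMDiff I 𝓘(ℝ, ℝ) 1 ψ) : IsC1Limit I ψ := by
  choose U hUo hxU hU using exists_isOpen_isC1Limit (I := I) (X := X) hin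
  obtain ⟨s, -, hs⟩ := isCompact_univ.elim_nhds_subcover U fun x _ => (hUo x).mem_nhds (hxU x)
  obtain ⟨f, hf⟩ := SmoothPartitionOfUnity.exists_isSubordinate I (isClosed_univ (X := X))
    (fun i : s => U i) (fun i => hUo i) (fun x hx => by
      obtain ⟨i, his, hi⟩ := mem_iUnion₂.1 (hs hx)
      exact mem_iUnion.2 ⟨⟨i, his⟩, hi⟩)
  have hsum : ψ = ∑ i : s, (f i * ψ : X → ℝ) := by
    funext x
    have h1 := f.sum_eq_one (mem_univ x)
    rw [finsum_eq_sum_of_fintype] at h1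
    rw [Finset.sum_apply]
    simp only [Pi.mul_apply]
    rw [← Finset.sum_mul, h1, one_mul]
  rw [hsum]
  refine isC1Limit_sum _ fun i _ => hU i _ ?_ ?_
  · exact ((f i).contMDiff.of_le (by simp)).mul hψ
  · exact tsupport_mul_subset_left.trans (hf i)

/-- Functions of class `C²` are dense in `C¹`. -/
theorem HasGradient.exists_approx (hin : HasInwardDirection (range I)) {ψ : X → ℝ}
    {G : SpaceField I X} (h : HasGradient ψ G) {ε : ℝ} (hε : 0 < ε) :
    ∃ (ψ' : C(X, ℝ)) (G' : SpaceField I X), ContMDiff I 𝓘(ℝ, ℝ) 2 ψ' ∧ HasGradient ψ' G' ∧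
      (∀ x, |ψ' x - ψ x| ≤ ε) ∧ ‖G' - G‖ ≤ ε := by
  obtain ⟨G₁, hG₁, happ⟩ := isC1Limit_of_contMDiff hin h.contMDiff
  obtain rfl := h.unique hG₁
  obtain ⟨ψ', G', hc, hg, h1, h2⟩ := happ ε hε
  exact ⟨⟨ψ', hc.continuous⟩, G', hc, hg, h1, h2⟩

end C1Approximation

section BernsteinDerivative

/-- The derivative of a Bernstein polynomial, as a continuous function on the unit interval. -/
def bernsteinDeriv (n ν : ℕ) : C(unitInterval, ℝ) :=
  (Polynomial.derivative (bernsteinPolynomial ℝ n ν)).toContinuousMapOn unitInterval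

theorem sum_derivative_bernsteinPolynomial (m : ℕ) (f : ℕ → ℝ) (t : ℝ) :
    ∑ k ∈ Finset.range (m + 2),
      (Polynomial.derivative (bernsteinPolynomial ℝ (m + 1) k)).eval t * f k =
    ∑ j ∈ Finset.range (m + 1),
      (bernsteinPolynomial ℝ m j).eval t * ((m + 1) * (f (j + 1) - f j)) := by
  set β : ℕ → ℝ := fun j => (bernsteinPolynomial ℝ m j).eval t with hβ
  have h0 : (Polynomial.derivative (bernsteinPolynomial ℝ (m + 1) 0)).eval t =
      -((m + 1) * β 0) := by
    rw [bernsteinPolynomial.derivative_zero]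
    simp [hβ]
    ring
  have h1 (k : ℕ) : (Polynomial.derivative (bernsteinPolynomial ℝ (m + 1) (k + 1))).eval t =
      (m + 1) * (β k - β (k + 1)) := by
    rw [bernsteinPolynomial.derivative_succ]
    simp [hβ]
  have hlast : β (m + 1) = 0 := by
    simp [hβ, bernsteinPolynomial.eq_zero_of_lt ℝ (Nat.lt_succ_self m)]
  rw [Finset.sum_range_succ', h0]
  simp only [h1]
  have h2 : ∑ k ∈ Finset.range (m + 1), β (k + 1) * f (k + 1) + β 0 * f 0 =
      ∑ k ∈ Finset.range (m + 1), β k * f k := by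
    rw [← Finset.sum_range_succ' (fun k => β k * f k), Finset.sum_range_succ, hlast, zero_mul,
      add_zero]
  have h3 (k : ℕ) : (m + 1 : ℝ) * (β k - β (k + 1)) * f (k + 1) =
      β k * ((m + 1) * (f (k + 1) - f k)) + (m + 1) * (β k * f k) -
        (m + 1) * (β (k + 1) * f (k + 1)) := by ring
  simp only [h3]
  rw [Finset.sum_sub_distrib, Finset.sum_add_distrib, ← Finset.mul_sum, ← Finset.mul_sum, ← h2]
  ring

theorem sum_bernsteinDeriv (m : ℕ) (f : unitInterval → ℝ) (t : unitInterval) :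
    ∑ k : Fin (m + 2), bernsteinDeriv (m + 1) k t * f (bernstein.z k) =
    ∑ j : Fin (m + 1), bernstein m j t * ((m + 1) *
      (f (bernstein.z j.succ) - f (bernstein.z j.castSucc))) := by
  have h := sum_derivative_bernsteinPolynomial m (fun k => f (clamp (k / (m + 1)))) t
  have hz (k : Fin (m + 2)) : bernstein.z k = clamp ((k : ℝ) / (m + 1)) := by
    have hk : (k : ℝ) / (m + 1) ∈ Icc (0 : ℝ) 1 := by
      refine ⟨by positivity, (div_le_one (by positivity)).2 ?_⟩
      exact_mod_cast Nat.lt_succ_iff.1 k.2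
    rw [clamp, projIcc_of_mem _ hk]
    ext
    simp [bernstein.z]
  rw [Finset.sum_range, Finset.sum_range] at h
  simp only [hz, Fin.val_succ, Fin.val_castSucc]
  exact h

/-- The derivatives of the Bernstein approximations of a `C¹` curve converge uniformly to the
derivative of the curve. -/
theorem norm_sum_bernsteinDeriv_sub_le {f f' : ℝ → ℝ} {F' : unitInterval → ℝ}
    (hF : ∀ t : unitInterval, F' t = f' t)
    (hf : ∀ t ∈ Icc (0 : ℝ) 1, HasDerivWithinAt f (f' t) (Icc 0 1) t) (m : ℕ) {η : ℝ}
    (hη : ∀ s t : unitInterval, |(s : ℝ) - t| ≤ 1 / (m + 1) → |F' s - F' t| ≤ η)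
    (t : unitInterval) :
    |∑ k : Fin (m + 2), bernsteinDeriv (m + 1) k t * f ((bernstein.z k : unitInterval) : ℝ) -
      ∑ j : Fin (m + 1), bernstein m j t * F' (bernstein.z j)| ≤ η := by
  rw [sum_bernsteinDeriv m (fun s => f s), ← Finset.sum_sub_distrib]
  have hm : (0 : ℝ) < m + 1 := by positivity
  have key (j : Fin (m + 1)) : |(m + 1) * (f ((bernstein.z j.succ : unitInterval) : ℝ) -
      f ((bernstein.z j.castSucc : unitInterval) : ℝ)) -
        F' (bernstein.z j)| ≤ η := by
    set a : ℝ := ((bernstein.z j.castSucc : unitInterval) : ℝ) with ha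
    set b : ℝ := ((bernstein.z j.succ : unitInterval) : ℝ) with hb
    have ha' : a = j / (m + 1) := by simp [ha, bernstein.z]
    have hb' : b = (j + 1) / (m + 1) := by simp [hb, bernstein.z]
    have hab : b - a = 1 / (m + 1) := by rw [ha', hb']; ring
    have hlt : a < b := by
      have : 0 < 1 / ((m : ℝ) + 1) := by positivity
      linarith
    have ha0 : 0 ≤ a := (bernstein.z j.castSucc).2.1
    have hb1 : b ≤ 1 := (bernstein.z j.succ).2.2
    have hcont : ContinuousOn f (Icc a b) := fun s hs =>
      (hf s ⟨ha0.trans hs.1, hs.2.trans hb1⟩).continuousWithinAt.mono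
        (Icc_subset_Icc ha0 hb1)
    obtain ⟨c, hc, hcd⟩ := exists_hasDerivAt_eq_slope f f' hlt hcont fun s hs =>
      (hf s ⟨ha0.trans hs.1.le, hs.2.le.trans hb1⟩).hasDerivAt
        (Icc_mem_nhds (ha0.trans_lt hs.1) (hs.2.trans_le hb1))
    have hcI : c ∈ Icc (0 : ℝ) 1 := ⟨ha0.trans hc.1.le, hc.2.le.trans hb1⟩
    have h1 : (m + 1) * (f b - f a) = F' ⟨c, hcI⟩ := by
      rw [hF, hcd, hab]
      field_simp
    rw [h1]
    refine hη _ _ ?_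
    have hz : ((bernstein.z j : unitInterval) : ℝ) = j / m := by
      simp [bernstein.z]
    have hj : (j : ℝ) ≤ m := by exact_mod_cast Nat.lt_succ_iff.1 j.2
    have hza : a ≤ ((bernstein.z j : unitInterval) : ℝ) := by
      rw [hz, ha']
      rcases (Nat.eq_zero_or_pos m) with rfl | hm0
      · simp
      · have : (0 : ℝ) < m := by exact_mod_cast hm0
        gcongr
        linarith
    have hzb : ((bernstein.z j : unitInterval) : ℝ) ≤ b := by
      rw [hz, hb']
      rcases (Nat.eq_zero_or_pos m) with rfl | hm0
      · simp
      · have : (0 : ℝ) < m := by exact_mod_cast hm0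
        rw [div_le_div_iff₀ this hm]
        nlinarith
    rw [← hab, abs_le]
    exact ⟨by linarith [hc.1, hc.2], by linarith [hc.1, hc.2]⟩
  calc |∑ j : Fin (m + 1), _| ≤ ∑ j : Fin (m + 1), bernstein m j t * η := by
        refine (Finset.abs_sum_le_sum_abs _ _).trans (Finset.sum_le_sum fun j _ => ?_)
        rw [← mul_sub, abs_mul, abs_of_nonneg bernstein_nonneg]
        exact mul_le_mul_of_nonneg_left (key j) bernstein_nonneg
    _ = η := by rw [← Finset.sum_mul, bernstein.probability, one_mul]

end BernsteinDerivative

section Tensor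

variable {E : Type*} [NormedAddCommGroup E] [NormedSpace ℝ E]
  {H : Type*} [TopologicalSpace H] {I : ModelWithCorners ℝ E H}
  {X : Type*} [TopologicalSpace X] [CompactSpace X] [ChartedSpace H X] [IsManifold I 1 X]
  {T : Type*} [TopologicalSpace T]

/-- The product of a vector field with a continuous function. -/
def VectorField.funSMul {f : C(T, X)} (a : C(T, ℝ)) (b : VectorField I f) : VectorField I f :=
  ⟨fun t => a t • b t, by
    have hb : Continuous fun t => (⟨f t, b t⟩ : TangentBundle I X) := b.continuous
    change Continuous fun t => (⟨f t, a t • b t⟩ : TangentBundle I X)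
    rw [continuous_iff_continuousAt] at *
    intro t₀
    have hv' := (FiberBundle.continuousAt_totalSpace E _).1 (hb t₀)
    refine (FiberBundle.continuousAt_totalSpace E _).2 ⟨f.continuous.continuousAt, ?_⟩
    refine (a.continuous.continuousAt.smul hv'.2).congr ?_
    have hb : ∀ᶠ t in 𝓝 t₀,
        f t ∈ (trivializationAt E (TangentSpace I : X → Type _) (f t₀)).baseSet :=
      f.continuous.continuousAt.eventually
        ((trivializationAt E (TangentSpace I : X → Type _) (f t₀)).open_baseSet.mem_nhds
          (FiberBundle.mem_baseSet_trivializationAt' (f t₀)))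
    filter_upwards [hb] with t ht
    exact (((trivializationAt E (TangentSpace I : X → Type _) (f t₀)).linear ℝ ht).map_smul
      (a t) (b t)).symm⟩

variable [RiemannianBundle (fun x : X => TangentSpace I x)]
  [IsContinuousRiemannianBundle E (fun x : X => TangentSpace I x)]

theorem VectorField.sum_apply {f : C(T, X)} {ι : Type*} (s : Finset ι) (v : ι → VectorField I f)
    (t : T) : (∑ i ∈ s, v i) t = ∑ i ∈ s, v i t :=
  map_sum (⟨⟨fun w : VectorField I f => w t, rfl⟩, fun _ _ => rfl⟩ :
    VectorField I f →+ TangentSpace I (f t)) v s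

/-- The function `(t, x) ↦ a(t) ψ(x)`, as a continuous linear function of `ψ`. -/
def tensor (a : C(unitInterval, ℝ)) : C(X, ℝ) →L[ℝ] C(unitInterval × X, ℝ) :=
  LinearMap.mkContinuous
    { toFun := fun ψ => ⟨fun p => a p.1 * ψ p.2, by fun_prop⟩
      map_add' := fun ψ ψ' => by ext p; simp [mul_add]
      map_smul' := fun c ψ => by ext p; simp [mul_left_comm] } ‖a‖ fun ψ => by
        refine (ContinuousMap.norm_le _ (by positivity)).2 fun p => ?_
        change ‖a p.1 * ψ p.2‖ ≤ _
        rw [norm_mul]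
        exact mul_le_mul (a.norm_coe_le_norm _) (ψ.norm_coe_le_norm _) (norm_nonneg _)
          (norm_nonneg _)

@[simp] theorem tensor_apply (a : C(unitInterval, ℝ)) (ψ : C(X, ℝ)) (p : unitInterval × X) :
    tensor a ψ p = a p.1 * ψ p.2 := rfl

/-- The vector field `(t, x) ↦ a(t) b(x)`, as a continuous linear function of `b`. -/
def tensorField (a : C(unitInterval, ℝ)) : SpaceField I X →L[ℝ] SpaceTimeField I X :=
  LinearMap.mkContinuous
    { toFun := fun b => VectorField.funSMul (a.comp ContinuousMap.fst)
        ⟨fun p => b p.2, b.continuous.comp continuous_snd⟩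
      map_add' := fun b b' => VectorField.ext fun p => smul_add (a p.1) (b p.2) (b' p.2)
      map_smul' := fun c b => VectorField.ext fun p => smul_comm (a p.1) c (b p.2) } ‖a‖
    fun b => by
      refine VectorField.norm_le (by positivity) fun p => ?_
      change ‖a p.1 • b p.2‖ ≤ _
      rw [norm_smul]
      exact mul_le_mul (a.norm_coe_le_norm _) (b.norm_apply_le _) (norm_nonneg _)
          (norm_nonneg _)

theorem clamp_coe (t : unitInterval) : clamp (t : ℝ) = t := projIcc_val zero_le_one t

theorem sliceFun_tensor (a : C(unitInterval, ℝ)) (ψ : C(X, ℝ)) (t : ℝ) :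
    sliceFun t (tensor a ψ) = a (clamp t) • ψ := rfl

theorem sliceField_tensorField (a : C(unitInterval, ℝ)) (b : SpaceField I X) (t : ℝ) :
    sliceField t (tensorField a b) = a (clamp t) • b := rfl

theorem eventually_norm_sum_bernstein_sub_le {V : Type*} [NormedAddCommGroup V] [NormedSpace ℝ V]
    {f : unitInterval → V} (hf : Continuous f) {ε : ℝ} (hε : 0 < ε) :
    ∀ᶠ n : ℕ in atTop, ∀ t : unitInterval,
      ‖∑ k : Fin (n + 1), bernstein n k t • f (bernstein.z k) - f t‖ ≤ ε := by
  let F : C(unitInterval, V) := ⟨f, hf⟩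
  have h := tendsto_iff_norm_sub_tendsto_zero.1 (bernsteinApproximation_uniform F)
  filter_upwards [h.eventually (ge_mem_nhds hε)] with n hn t
  have h1 := ((bernsteinApproximation n F - F).norm_coe_le_norm t).trans hn
  rwa [ContinuousMap.sub_apply, bernsteinApproximation.apply] at h1

theorem tendsto_sum_tensor_bernstein (φ : C(unitInterval × X, ℝ)) :
    Tendsto (fun n : ℕ => ∑ k : Fin (n + 1),
      tensor (bernstein n k) (sliceFun ((bernstein.z k : unitInterval) : ℝ) φ)) atTop (𝓝 φ) := by
  rw [Metric.tendsto_nhds]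
  intro ε hε
  filter_upwards [eventually_norm_sum_bernstein_sub_le (f := fun t : unitInterval => sliceFun t φ)
    ((continuous_sliceFun φ).comp continuous_subtype_val) (half_pos hε)] with n hn
  rw [dist_eq_norm]
  refine lt_of_le_of_lt ((ContinuousMap.norm_le _ (by positivity)).2 fun p => ?_)
    (half_lt_self hε)
  refine le_trans (le_of_eq ?_) ((ContinuousMap.norm_coe_le_norm _ p.2).trans (hn p.1))
  rw [ContinuousMap.sub_apply, ContinuousMap.sub_apply, ContinuousMap.sum_apply,
    ContinuousMap.sum_apply]
  have : φ p = sliceFun p.1 φ p.2 := by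
    change φ p = φ (clamp p.1, p.2)
    rw [clamp_coe]
  rw [this]
  rfl

theorem tendsto_sum_tensorField_bernstein (b : SpaceTimeField I X) :
    Tendsto (fun n : ℕ => ∑ k : Fin (n + 1),
      tensorField (bernstein n k) (sliceField ((bernstein.z k : unitInterval) : ℝ) b))
      atTop (𝓝 b) := by
  let F : C(unitInterval, SpaceField I X) :=
    ⟨fun t => sliceField t b, (continuous_sliceField b).comp continuous_subtype_val⟩
  have h := tendsto_iff_norm_sub_tendsto_zero.1 (bernsteinApproximation_uniform F)
  refine tendsto_iff_norm_sub_tendsto_zero.2 (squeeze_zero (fun _ => norm_nonneg _)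
    (fun n => ?_) h)
  refine VectorField.norm_le (norm_nonneg _) fun p => ?_
  refine le_trans (le_of_eq ?_) (((bernsteinApproximation n F - F) p.1).norm_apply_le p.2 |>.trans
    ((bernsteinApproximation n F - F).norm_coe_le_norm p.1))
  have h1 : (bernsteinApproximation n F - F) p.1 = ∑ k : Fin (n + 1),
      bernstein n k p.1 • F (bernstein.z k) - F p.1 := by
    rw [ContinuousMap.sub_apply, bernsteinApproximation.apply]
  have hb : b p = F p.1 p.2 := by
    change b p = b (clamp p.1, p.2)
    rw [clamp_coe]
  change ‖(∑ k : Fin (n + 1), tensorField (bernstein n k)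
    (sliceField ((bernstein.z k : unitInterval) : ℝ) b)) p - b p‖ = _
  rw [VectorField.sum_apply, hb, h1]
  change _ = ‖(∑ k : Fin (n + 1), bernstein n k p.1 • F (bernstein.z k)) p.2 - F p.1 p.2‖
  rw [VectorField.sum_apply]
  rfl

theorem tendsto_sum_tensor_bernsteinDeriv {φ φt : C(unitInterval × X, ℝ)}
    {G : SpaceTimeField I X} (h : IsC1TestFunction φ φt G) :
    Tendsto (fun m : ℕ => ∑ k : Fin (m + 2),
      tensor (bernsteinDeriv (m + 1) k) (sliceFun ((bernstein.z k : unitInterval) : ℝ) φ))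
      atTop (𝓝 φt) := by
  let F : C(unitInterval, C(X, ℝ)) :=
    ⟨fun t => sliceFun t φt, (continuous_sliceFun φt).comp continuous_subtype_val⟩
  have hF := CompactSpace.uniformContinuous_of_continuous F.continuous
  suffices Tendsto (fun m : ℕ => ∑ k : Fin (m + 2),
      tensor (bernsteinDeriv (m + 1) k) (sliceFun ((bernstein.z k : unitInterval) : ℝ) φ) -
      ∑ k : Fin (m + 1),
        tensor (bernstein m k) (sliceFun ((bernstein.z k : unitInterval) : ℝ) φt))
      atTop (𝓝 0) by
    have h1 := this.add (tendsto_sum_tensor_bernstein φt)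
    simpa only [sub_add_cancel, zero_add] using h1
  rw [Metric.tendsto_nhds]
  intro ε hε
  obtain ⟨δ, hδ, hFδ⟩ := Metric.uniformContinuous_iff.1 hF (ε / 2) (by positivity)
  have hev : ∀ᶠ m : ℕ in atTop, 1 / ((m : ℝ) + 1) < δ :=
    tendsto_one_div_add_atTop_nhds_zero_nat.eventually (gt_mem_nhds hδ)
  filter_upwards [hev] with m hm
  rw [dist_zero_right]
  refine lt_of_le_of_lt ((ContinuousMap.norm_le _ (by positivity)).2 fun p => ?_)
    (half_lt_self hε)
  have key := norm_sum_bernsteinDeriv_sub_le (f := fun s => φ (clamp s, p.2))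
    (f' := fun s => φt (clamp s, p.2)) (F' := fun s => φt (s, p.2)) (fun t => by rw [clamp_coe])
    (fun t ht => h.time t ht p.2) m (η := ε / 2) (fun s t hst => ?_) p.1
  · rw [ContinuousMap.sub_apply, ContinuousMap.sum_apply, ContinuousMap.sum_apply]
    simp only [tensor_apply, sliceFun_apply, clamp_coe, Real.norm_eq_abs] at key ⊢
    exact key
  · have h1 := hFδ (a := s) (b := t) (lt_of_le_of_lt hst hm)
    have h2 := (ContinuousMap.dist_apply_le_dist (f := F s) (g := F t) p.2).trans h1.le
    rw [Real.dist_eq] at h2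
    change |φt (clamp s, p.2) - φt (clamp t, p.2)| ≤ _ at h2
    rwa [clamp_coe, clamp_coe] at h2

end Tensor

section TensorDensity

variable {E : Type*} [NormedAddCommGroup E] [NormedSpace ℝ E] [FiniteDimensional ℝ E]
  {H : Type*} [TopologicalSpace H] {I : ModelWithCorners ℝ E H}
  {X : Type*} [TopologicalSpace X] [CompactSpace X] [T2Space X]
  [ChartedSpace H X] [IsManifold I ∞ X]

theorem norm_sum_bernstein_le {V : Type*} [SeminormedAddCommGroup V] [NormedSpace ℝ V] (n : ℕ)
    (t : unitInterval) {v : Fin (n + 1) → V} {ε : ℝ} (hv : ∀ k, ‖v k‖ ≤ ε) :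
    ‖∑ k : Fin (n + 1), bernstein n k t • v k‖ ≤ ε := by
  calc _ ≤ ∑ k : Fin (n + 1), bernstein n k t * ε := by
        refine (norm_sum_le _ _).trans (Finset.sum_le_sum fun k _ => ?_)
        rw [norm_smul, Real.norm_of_nonneg bernstein_nonneg]
        exact mul_le_mul_of_nonneg_left (hv k) bernstein_nonneg
    _ = ε := by rw [← Finset.sum_mul, bernstein.probability, one_mul]

variable (I) in
theorem exists_sum_tensor_approx (φ : C(unitInterval × X, ℝ)) {ε : ℝ} (hε : 0 < ε) :
    ∃ (n : ℕ) (ψ : Fin (n + 1) → C(X, ℝ)), (∀ k, ContMDiff I 𝓘(ℝ, ℝ) ∞ (ψ k)) ∧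
      ‖∑ k : Fin (n + 1), tensor (bernstein n k) (ψ k) - φ‖ ≤ ε := by
  obtain ⟨n, hn⟩ := ((tendsto_sum_tensor_bernstein φ).eventually
    (Metric.ball_mem_nhds φ (half_pos hε))).exists
  choose ψ hψ hψn using fun k : Fin (n + 1) => exists_contMDiff_norm_sub_lt (I := I)
    (sliceFun ((bernstein.z k : unitInterval) : ℝ) φ) (half_pos hε)
  refine ⟨n, ψ, hψ, ?_⟩
  rw [dist_eq_norm] at hn
  have h1 : ‖∑ k : Fin (n + 1), tensor (bernstein n k) (ψ k) - ∑ k : Fin (n + 1),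
      tensor (bernstein n k) (sliceFun ((bernstein.z k : unitInterval) : ℝ) φ)‖ ≤ ε / 2 := by
    rw [← Finset.sum_sub_distrib]
    refine (ContinuousMap.norm_le _ (by positivity)).2 fun p => ?_
    rw [ContinuousMap.sum_apply]
    simp only [← map_sub, tensor_apply]
    exact norm_sum_bernstein_le n p.1 fun k => (ContinuousMap.norm_coe_le_norm _ p.2).trans (hψn k)
  calc _ ≤ _ := norm_sub_le_norm_sub_add_norm_sub _ (∑ k : Fin (n + 1),
      tensor (bernstein n k) (sliceFun ((bernstein.z k : unitInterval) : ℝ) φ)) _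
    _ ≤ ε / 2 + ε / 2 := add_le_add h1 hn.le
    _ = ε := add_halves ε

variable [RiemannianBundle (fun x : X => TangentSpace I x)]
  [IsContinuousRiemannianBundle E (fun x : X => TangentSpace I x)]

theorem exists_sum_tensorField_approx (b : SpaceTimeField I X) {ε : ℝ} (hε : 0 < ε) :
    ∃ (n : ℕ) (c : Fin (n + 1) → SpaceField I X), (∀ k, IsCqField 1 (c k)) ∧
      ‖∑ k : Fin (n + 1), tensorField (bernstein n k) (c k) - b‖ ≤ ε := by
  obtain ⟨n, hn⟩ := ((tendsto_sum_tensorField_bernstein b).eventually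
    (Metric.ball_mem_nhds b (half_pos hε))).exists
  choose c hc hcn using fun k : Fin (n + 1) => exists_isCqField_norm_sub_le
    (sliceField ((bernstein.z k : unitInterval) : ℝ) b) (half_pos hε)
  refine ⟨n, c, hc, ?_⟩
  rw [dist_eq_norm] at hn
  have h1 : ‖∑ k : Fin (n + 1), tensorField (bernstein n k) (c k) - ∑ k : Fin (n + 1),
      tensorField (bernstein n k) (sliceField ((bernstein.z k : unitInterval) : ℝ) b)‖
      ≤ ε / 2 := by
    rw [← Finset.sum_sub_distrib]
    simp only [← map_sub]
    refine VectorField.norm_le (by positivity) fun p => ?_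
    rw [VectorField.sum_apply]
    exact norm_sum_bernstein_le n p.1 fun k => (VectorField.norm_apply_le _ p.2).trans (hcn k)
  calc _ ≤ _ := norm_sub_le_norm_sub_add_norm_sub _ (∑ k : Fin (n + 1),
      tensorField (bernstein n k) (sliceField ((bernstein.z k : unitInterval) : ℝ) b)) _
    _ ≤ ε / 2 + ε / 2 := add_le_add h1 hn.le
    _ = ε := add_halves ε

/-- The continuity equation can be tested with products of Bernstein polynomials in time and
functions of class `C²` in space. -/
theorem continuityEquation_of_tensor (hin : HasInwardDirection (range I)) {ρ₀ ρ₁ : Meas X}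
    {ρ : Meas (unitInterval × X)} {m : SpaceTimeVecMeas I X}
    (h : ∀ (n k : ℕ) (ψ : C(X, ℝ)) (G : SpaceField I X), ContMDiff I 𝓘(ℝ, ℝ) 2 ψ →
      HasGradient ψ G → ρ (tensor (bernsteinDeriv n k) ψ) + m (tensorField (bernstein n k) G) =
        bernstein n k 1 * ρ₁ ψ - bernstein n k 0 * ρ₀ ψ) :
    ContinuityEquation ρ₀ ρ₁ ρ m := by
  have h' (n k : ℕ) (ψ : C(X, ℝ)) (G : SpaceField I X) (hG : HasGradient ψ G) :
      ρ (tensor (bernsteinDeriv n k) ψ) + m (tensorField (bernstein n k) G) =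
        bernstein n k 1 * ρ₁ ψ - bernstein n k 0 * ρ₀ ψ := by
    choose ψ' G' hc hg h1 h2 using fun j : ℕ => hG.exists_approx hin
      (Nat.one_div_pos_of_nat (n := j) (α := ℝ))
    have hψ : Tendsto ψ' atTop (𝓝 ψ) :=
      tendsto_iff_norm_sub_tendsto_zero.2 (squeeze_zero (fun _ => norm_nonneg _)
        (fun j => (ContinuousMap.norm_le _ Nat.one_div_pos_of_nat.le).2 fun x => h1 j x)
        tendsto_one_div_add_atTop_nhds_zero_nat)
    have hG' : Tendsto G' atTop (𝓝 G) :=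
      tendsto_iff_norm_sub_tendsto_zero.2 (squeeze_zero (fun _ => norm_nonneg _) h2
        tendsto_one_div_add_atTop_nhds_zero_nat)
    have hL := (((ρ.continuous.comp (tensor (bernsteinDeriv n k)).continuous).tendsto ψ).comp
      hψ).add (((m.continuous.comp (tensorField (bernstein n k)).continuous).tendsto G).comp hG')
    have hR := (((ρ₁.continuous.tendsto ψ).comp hψ).const_mul (bernstein n k 1)).sub
      (((ρ₀.continuous.tendsto ψ).comp hψ).const_mul (bernstein n k 0))
    exact tendsto_nhds_unique hL (hR.congr fun j => (h n k (ψ' j) (G' j) (hc j) (hg j)).symm)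
  intro φ φt G hφ
  have hL := ((ρ.continuous.tendsto _).comp (tendsto_sum_tensor_bernsteinDeriv hφ)).add
    ((m.continuous.tendsto _).comp
      ((tendsto_add_atTop_iff_nat 1).2 (tendsto_sum_tensorField_bernstein G)))
  have hR := ((ρ₁.continuous.tendsto _).comp (((sliceFun (X := X) 1).continuous.tendsto _).comp
      ((tendsto_add_atTop_iff_nat 1).2 (tendsto_sum_tensor_bernstein φ)))).sub
    ((ρ₀.continuous.tendsto _).comp (((sliceFun (X := X) 0).continuous.tendsto _).comp
      ((tendsto_add_atTop_iff_nat 1).2 (tendsto_sum_tensor_bernstein φ))))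
  refine tendsto_nhds_unique hL (hR.congr fun j => ?_)
  simp only [Function.comp_apply, map_sum, sliceFun_tensor, map_smul, smul_eq_mul]
  rw [← Finset.sum_sub_distrib, ← Finset.sum_add_distrib]
  refine Finset.sum_congr rfl fun k _ => ?_
  have h1 : clamp 1 = 1 := clamp_coe 1
  have h0 : clamp 0 = 0 := clamp_coe 0
  rw [h1, h0]
  exact (h' _ _ _ _ (hφ.space _)).symm

end TensorDensity

section DualEstimates

theorem IsPositive.norm_le {X : Type*} [TopologicalSpace X] [CompactSpace X] {ρ : Meas X}
    (hρ : IsPositive ρ) : ‖ρ‖ ≤ ρ 1 := by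
  refine ρ.opNorm_le_bound (hρ 1 fun _ => zero_le_one) fun φ => ?_
  have h1 : 0 ≤ ρ (‖φ‖ • 1 - φ) := hρ _ fun x => by
    simpa using (le_abs_self _).trans (φ.norm_coe_le_norm x)
  have h2 : 0 ≤ ρ (‖φ‖ • 1 + φ) := hρ _ fun x => by
    have := (neg_abs_le _).trans' (neg_le_neg (φ.norm_coe_le_norm x))
    simp only [ContinuousMap.add_apply, ContinuousMap.smul_apply, ContinuousMap.one_apply,
      smul_eq_mul, mul_one]
    linarith
  rw [map_sub, map_smul, smul_eq_mul] at h1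
  rw [map_add, map_smul, smul_eq_mul] at h2
  rw [Real.norm_eq_abs, abs_le]
  constructor <;> linarith

theorem IsPositive.half_add {X : Type*} [TopologicalSpace X] [CompactSpace X] {ρ μ : Meas X}
    (hρ : IsPositive ρ) (hμ : IsPositive μ) : IsPositive ((1 / 2 : ℝ) • (ρ + μ)) := fun φ hφ =>
  mul_nonneg (by norm_num) (add_nonneg (hρ φ hφ) (hμ φ hφ))

theorem norm_le_of_forall_apply_le {V : Type*} [NormedAddCommGroup V] [NormedSpace ℝ V]
    {m : StrongDual ℝ V} {K : ℝ} (h : ∀ v, ‖v‖ ≤ 1 → m v ≤ K) : ‖m‖ ≤ K := by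
  have hK : 0 ≤ K := by simpa using h 0 (by simp)
  have h' (v : V) : m v ≤ K * ‖v‖ := by
    rcases eq_or_ne v 0 with rfl | hv
    · simp
    · have hv' : 0 < ‖v‖ := norm_pos_iff.2 hv
      have h1 := h (‖v‖⁻¹ • v) (by rw [norm_smul, norm_inv, norm_norm, inv_mul_cancel₀ hv'.ne'])
      rw [map_smul, smul_eq_mul, inv_mul_le_iff₀ hv', mul_comm] at h1
      exact h1
  refine m.opNorm_le_bound hK fun v => ?_
  rw [Real.norm_eq_abs, abs_le]
  have h1 := h' (-v)
  rw [map_neg, norm_neg] at h1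
  exact ⟨by linarith, h' v⟩

theorem sum_succ_sub_castSucc {N : ℕ} (f : Fin (N + 1) → ℝ) :
    ∑ k : Fin N, (f k.succ - f k.castSucc) = f (Fin.last N) - f 0 := by
  have h1 := Fin.sum_univ_succ f
  have h2 := Fin.sum_univ_castSucc f
  rw [Finset.sum_sub_distrib]
  linarith

theorem le_add_sum_abs_sub {N : ℕ} (f : Fin (N + 1) → ℝ) (k : Fin (N + 1)) :
    f k ≤ f 0 + ∑ j : Fin N, |f j.succ - f j.castSucc| := by
  induction N with
  | zero => simp [Fin.fin_one_eq_zero k]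
  | succ n ih =>
    refine Fin.cases ?_ (fun i => ?_) k
    · exact le_add_of_nonneg_right (Finset.sum_nonneg fun _ _ => abs_nonneg _)
    · have h1 := ih (fun j => f j.succ) i
      have h2 := le_abs_self (f (Fin.succ 0) - f (Fin.castSucc 0))
      rw [Fin.sum_univ_succ]
      simp only [Fin.castSucc_zero, ← Fin.succ_castSucc] at h1 h2 ⊢
      linarith

theorem mul_sum_add_mul_le {N : ℕ} {a y : Fin N → ℝ} {C m K : ℝ} (hC : 0 ≤ C) (hm : 0 ≤ m)
    (hy : ∀ k, y k ≤ a k + C * m) (ha : (N : ℝ)⁻¹ * ∑ k, a k ≤ K) :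
    (N : ℝ)⁻¹ * ∑ k, y k ≤ K + C * m := by
  have h1 : ∑ k, y k ≤ ∑ k, a k + N * (C * m) := by
    refine (Finset.sum_le_sum fun k _ => hy k).trans (le_of_eq ?_)
    rw [Finset.sum_add_distrib, Finset.sum_const, Finset.card_univ, Fintype.card_fin,
      nsmul_eq_mul]
  have h2 : (N : ℝ)⁻¹ * ∑ k, y k ≤ (N : ℝ)⁻¹ * (∑ k, a k + N * (C * m)) :=
    mul_le_mul_of_nonneg_left h1 (by positivity)
  rcases eq_or_ne N 0 with rfl | hN
  · simp at h2 ha ⊢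
    positivity
  · have hN' : (N : ℝ) ≠ 0 := Nat.cast_ne_zero.2 hN
    rw [mul_add, inv_mul_cancel_left₀ hN'] at h2
    linarith

/-- A discrete Gronwall estimate: if the variation of `r` is controlled by `ε y`, where the mean
of `y` is itself controlled by the size of `r`, then `r` is bounded for small `ε`. -/
theorem le_of_abs_sub_le {N : ℕ} {r : Fin (N + 1) → ℝ} {a y : Fin N → ℝ} {C ε K : ℝ}
    (hC : 0 ≤ C) (hε : 0 ≤ ε) (hεC : ε * C ≤ 1 / 2) (hr : ∀ k, 0 ≤ r k)
    (hdiff : ∀ k : Fin N, |r k.succ - r k.castSucc| ≤ (N : ℝ)⁻¹ * (ε * y k))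
    (hy : ∀ k : Fin N, y k ≤ a k + C * ((r k.castSucc + r k.succ) / 2))
    (ha : (N : ℝ)⁻¹ * ∑ k, a k ≤ K) (k : Fin (N + 1)) :
    r k ≤ 2 * (r 0 + ε * K) := by
  obtain ⟨j, -, hj⟩ := Finset.exists_max_image Finset.univ r ⟨0, Finset.mem_univ _⟩
  have h1 : (N : ℝ)⁻¹ * ∑ k, y k ≤ K + C * r j := by
    refine mul_sum_add_mul_le hC (hr j) (fun k => (hy k).trans ?_) ha
    have h2 := hj k.castSucc (Finset.mem_univ _)
    have h3 := hj k.succ (Finset.mem_univ _)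
    gcongr
    linarith
  have h2 := le_add_sum_abs_sub r j
  have h3 : ∑ k : Fin N, |r k.succ - r k.castSucc| ≤ ε * ((N : ℝ)⁻¹ * ∑ k, y k) := by
    refine (Finset.sum_le_sum fun k _ => hdiff k).trans (le_of_eq ?_)
    rw [← Finset.mul_sum, ← Finset.mul_sum]
    ring
  have h4 := mul_le_mul_of_nonneg_left h1 hε
  have h5 := mul_le_mul_of_nonneg_right hεC (hr j)
  have h6 := hj k (Finset.mem_univ _)
  nlinarith

end DualEstimates

section TimeIntegralEstimates

variable {V W : Type*} [NormedAddCommGroup V] [NormedSpace ℝ V]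
  [NormedAddCommGroup W] [NormedSpace ℝ W]

theorem timeIntegral_apply (s : ℝ → W →L[ℝ] V) (hs : ∀ w, Continuous fun t => s t w)
    (hb : ∀ t w, ‖s t w‖ ≤ ‖w‖) (μ : ℝ → StrongDual ℝ V) (hμ : Continuous μ) (a b : ℝ) (w : W) :
    timeIntegral s hs hb μ hμ a b w = ∫ t in a..b, μ t (s t w) := rfl

theorem norm_timeIntegral_le (s : ℝ → W →L[ℝ] V) (hs : ∀ w, Continuous fun t => s t w)
    (hb : ∀ t w, ‖s t w‖ ≤ ‖w‖) (μ : ℝ → StrongDual ℝ V) (hμ : Continuous μ) {a b c : ℝ}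
    (hab : a ≤ b) (hc : 0 ≤ c) (h : ∀ t ∈ Icc a b, ‖μ t‖ ≤ c) :
    ‖timeIntegral s hs hb μ hμ a b‖ ≤ (b - a) * c := by
  refine ContinuousLinearMap.opNorm_le_bound _ (mul_nonneg (sub_nonneg.2 hab) hc) fun w => ?_
  rw [timeIntegral_apply]
  refine (intervalIntegral.norm_integral_le_of_norm_le_const (C := c * ‖w‖) fun t ht => ?_).trans
    (le_of_eq ?_)
  · rw [uIoc_of_le hab] at ht
    exact ((μ t).le_opNorm _).trans (mul_le_mul (h t (Ioc_subset_Icc_self ht)) (hb t w)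
      (norm_nonneg _) hc)
  · rw [abs_of_nonneg (sub_nonneg.2 hab)]
    ring

end TimeIntegralEstimates

section DiscreteEstimates

variable {𝒳 𝒴 : Type*} [AddCommGroup 𝒳] [Module ℝ 𝒳] [AddCommGroup 𝒴] [Module ℝ 𝒴]
  {E : Type*} [NormedAddCommGroup E] [NormedSpace ℝ E]
  {H : Type*} [TopologicalSpace H] {I : ModelWithCorners ℝ E H}
  {X : Type*} [EMetricSpace X] [CompactSpace X] [MeasurableSpace X] [BorelSpace X]
  [ChartedSpace H X] [IsManifold I 1 X]
  [RiemannianBundle (fun x : X => TangentSpace I x)]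
  [IsContinuousRiemannianBundle E (fun x : X => TangentSpace I x)]
  {D : DiscreteModel 𝒳 𝒴} (R : Operators I X D) {N : ℕ}

theorem grid_sub (N k : ℕ) : ((k : ℝ) + 1) / N - k / N = (N : ℝ)⁻¹ := by
  rw [← sub_div, add_sub_cancel_left, one_div]

theorem grid_le (N k : ℕ) : (k : ℝ) / N ≤ ((k : ℝ) + 1) / N := by gcongr; linarith

theorem grid_mem (k : Fin N) {t : ℝ} (ht : t ∈ Icc ((k : ℝ) / N) (((k : ℝ) + 1) / N)) :
    t ∈ Icc (0 : ℝ) 1 ∧ 0 ≤ (k : ℝ) + 1 - N * t ∧ 0 ≤ N * t - k := by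
  have hN : (0 : ℝ) < N := Nat.cast_pos.2 (Fin.pos k)
  have h1 := (div_le_iff₀ hN).1 ht.1
  have h2 := (le_div_iff₀ hN).1 ht.2
  have hk : (k : ℝ) + 1 ≤ N := by exact_mod_cast k.2
  refine ⟨⟨le_trans (by positivity) ht.1, ht.2.trans ((div_le_one hN).2 hk)⟩, ?_, ?_⟩ <;> linarith

theorem DiscreteModel.apply_le_action_add {P : 𝒳} {M : 𝒴} {b : SpaceField I X} {c : ℝ}
    (h : D.actionStar P (adjoint R.RY b) ≤ (c : EReal)) (hA : D.action P M ≠ ⊤) :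
    R.RY M b ≤ (D.action P M).toReal + c := by
  have h1 := (le_iSup (fun M : 𝒴 => ((adjoint R.RY b M : ℝ) : EReal) - (D.action P M : EReal))
    M).trans h
  lift D.action P M to NNReal using hA with a
  have h2 : ((R.RY M b - a : ℝ) : EReal) ≤ (c : EReal) := h1
  rw [EReal.coe_le_coe_iff] at h2
  rw [ENNReal.coe_toReal]
  linarith

namespace Operators

theorem norm_recY_le (M : Fin N → 𝒴) :
    ‖R.recY M‖ ≤ (N : ℝ)⁻¹ * ∑ k, ‖R.RY (M k)‖ := by
  rw [recY, Finset.mul_sum]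
  refine (norm_sum_le _ _).trans (Finset.sum_le_sum fun k _ => ?_)
  rw [← grid_sub N k]
  exact norm_timeIntegral_le _ _ _ _ _ (grid_le N k) (norm_nonneg _) fun _ _ => le_rfl

theorem sum_inv_mul_le {c : ℝ} (hc : 0 ≤ c) : ∑ _k : Fin N, (N : ℝ)⁻¹ * c ≤ c := by
  rw [Finset.sum_const, Finset.card_univ, Fintype.card_fin, nsmul_eq_mul, ← mul_assoc]
  exact mul_le_of_le_one_left hc mul_inv_le_one

theorem norm_recA_le {P : Fin (N + 1) → 𝒳} {c : ℝ} (hc : 0 ≤ c)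
    (h : ∀ k : Fin N, ‖R.RA ((1 / 2 : ℝ) • (P k.castSucc + P k.succ))‖ ≤ c) :
    ‖R.recA P‖ ≤ c := by
  rw [recA]
  refine (norm_sum_le (E := Meas (unitInterval × X)) _ _).trans ?_
  refine le_trans (Finset.sum_le_sum fun k _ => ?_) (sum_inv_mul_le (N := N) hc)
  rw [← grid_sub N k]
  exact norm_timeIntegral_le _ _ _ _ _ (grid_le N k) hc fun _ _ => h k

theorem norm_recCE_le {P : Fin (N + 1) → 𝒳} {c : ℝ} (hc : 0 ≤ c)
    (h : ∀ k, ‖R.RCE (P k)‖ ≤ c) : ‖R.recCE P‖ ≤ c := by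
  rw [recCE]
  refine (norm_sum_le (E := Meas (unitInterval × X)) _ _).trans ?_
  refine le_trans (Finset.sum_le_sum fun k _ => ?_) (sum_inv_mul_le (N := N) hc)
  rw [← grid_sub N k]
  refine norm_timeIntegral_le _ _ _ _ _ (grid_le N k) hc fun t ht => ?_
  obtain ⟨-, h1, h2⟩ := grid_mem k ht
  refine (norm_add_le _ _).trans ?_
  rw [norm_smul, norm_smul, Real.norm_of_nonneg h1, Real.norm_of_nonneg h2]
  calc _ ≤ ((k : ℝ) + 1 - N * t) * c + (N * t - k) * c := by
        gcongr
        · exact h _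
        · exact h _
    _ = c := by ring

theorem isPositive_RA_mid {P : Fin (N + 1) → 𝒳} (hP : ∀ k, P k ∈ D.cone) (k : Fin N) :
    IsPositive (R.RA ((1 / 2 : ℝ) • (P k.castSucc + P k.succ))) := by
  rw [map_smul, map_add]
  exact (R.RA_pos _ (hP _)).half_add (R.RA_pos _ (hP _))

theorem isPositive_RCE_mid {P : Fin (N + 1) → 𝒳} (hP : ∀ k, P k ∈ D.cone) (k : Fin N) :
    IsPositive (R.RCE ((1 / 2 : ℝ) • (P k.castSucc + P k.succ))) := by
  rw [map_smul, map_add]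
  exact (R.RCE_pos _ (hP _)).half_add (R.RCE_pos _ (hP _))

theorem isPositive_recA {P : Fin (N + 1) → 𝒳} (hP : ∀ k, P k ∈ D.cone) :
    IsPositive (R.recA P) := by
  intro φ hφ
  rw [recA, sum_apply]
  exact Finset.sum_nonneg fun k _ => intervalIntegral.integral_nonneg (grid_le N k) fun t _ =>
    R.isPositive_RA_mid hP k _ fun x => hφ _

/-- The increments of the reconstructed densities, from the discrete continuity equation. -/
theorem RCE_sub_apply {P : Fin (N + 1) → 𝒳} {M : Fin N → 𝒴}
    (h : ∀ k : Fin N, (N : ℝ) • (P k.succ - P k.castSucc) + D.Div (M k) = 0) (k : Fin N)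
    (ψ : C(X, ℝ)) :
    N * (R.RCE (P k.succ) ψ - R.RCE (P k.castSucc) ψ) = - R.RCE (D.Div (M k)) ψ := by
  have h1 := congrArg (fun p => R.RCE p ψ) (h k)
  simp only [map_add, map_smul, map_sub, map_zero, add_apply, smul_apply, sub_apply, smul_eq_mul,
    zero_apply] at h1
  linarith

theorem abs_RCE_sub_le {P : Fin (N + 1) → 𝒳} {M : Fin N → 𝒴}
    (h : ∀ k : Fin N, (N : ℝ) • (P k.succ - P k.castSucc) + D.Div (M k) = 0)
    {ψ : C(X, ℝ)} {G : SpaceField I X} {ε : ℝ}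
    (hε : ∀ M, |R.RCE (D.Div M) ψ + R.RY M G| ≤ ε * ‖R.RY M‖) (k : Fin N) :
    |R.RCE (P k.succ) ψ - R.RCE (P k.castSucc) ψ| ≤ (N : ℝ)⁻¹ * ((‖G‖ + ε) * ‖R.RY (M k)‖) := by
  have hN : (0 : ℝ) < N := Nat.cast_pos.2 (Fin.pos k)
  have h1 := R.RCE_sub_apply h k ψ
  rw [← div_eq_inv_mul, le_div_iff₀ hN, mul_comm, ← abs_of_pos hN, ← abs_mul]
  rw [h1, abs_neg]
  have h2 := hε (M k)
  have h3 : |R.RY (M k) G| ≤ ‖R.RY (M k)‖ * ‖G‖ := (R.RY (M k)).le_opNorm G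
  rw [abs_le] at h2 h3 ⊢
  constructor <;> linarith

/-- The difference of the two reconstructions of the density, on product test functions. -/
theorem abs_recCE_sub_recA_le {P : Fin (N + 1) → 𝒳} (a : C(unitInterval, ℝ)) {ψ : C(X, ℝ)}
    {c d : ℝ}
    (h1 : ∀ k : Fin N, |(R.RCE ((1 / 2 : ℝ) • (P k.castSucc + P k.succ)) -
      R.RA ((1 / 2 : ℝ) • (P k.castSucc + P k.succ))) ψ| ≤ c)
    (hc : 0 ≤ c)
    (h2 : ∑ k : Fin N, (N : ℝ)⁻¹ * |R.RCE (P k.succ) ψ - R.RCE (P k.castSucc) ψ| ≤ d) :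
    |R.recCE P (tensor a ψ) - R.recA P (tensor a ψ)| ≤ ‖a‖ * (c + d) := by
  rw [recCE, recA, sum_apply, sum_apply,
    ← Finset.sum_sub_distrib]
  refine (Finset.abs_sum_le_sum_abs _ _).trans ?_
  calc _ ≤ ∑ k : Fin N, ‖a‖ * ((N : ℝ)⁻¹ * c +
        (N : ℝ)⁻¹ * |R.RCE (P k.succ) ψ - R.RCE (P k.castSucc) ψ|) := by
        refine Finset.sum_le_sum fun k _ => ?_
        have hμ : Continuous fun t : ℝ => ((k : ℝ) + 1 - N * t) • R.RCE (P k.castSucc) +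
            (N * t - k) • R.RCE (P k.succ) := by fun_prop
        rw [timeIntegral_apply, timeIntegral_apply, ← intervalIntegral.integral_sub
          (Continuous.intervalIntegrable (hμ.clm_apply (continuous_sliceFun _)) _ _)
          (Continuous.intervalIntegrable (Continuous.clm_apply continuous_const
            (continuous_sliceFun _)) _ _)]
        refine (intervalIntegral.norm_integral_le_of_norm_le_const (E := ℝ)
          (C := ‖a‖ * (c + |R.RCE (P k.succ) ψ - R.RCE (P k.castSucc) ψ|))
          fun t ht => ?_).trans (le_of_eq ?_)
        · rw [uIoc_of_le (grid_le N k)] at ht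
          obtain ⟨-, h3, h4⟩ := grid_mem k (Ioc_subset_Icc_self ht)
          have h5 := h1 k
          simp only [sliceFun_tensor, map_smul, map_add, add_apply, smul_apply, sub_apply,
            smul_eq_mul] at h5 ⊢
          rw [Real.norm_eq_abs, ← mul_sub, abs_mul]
          refine mul_le_mul (a.norm_coe_le_norm _) ?_ (abs_nonneg _) (norm_nonneg _)
          set r := R.RCE (P k.castSucc) ψ
          set r' := R.RCE (P k.succ) ψ
          rw [show ((k : ℝ) + 1 - N * t) * r + (N * t - k) * r' -
              1 / 2 * (R.RA (P k.castSucc) ψ + R.RA (P k.succ) ψ) =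
              (1 / 2 * (r + r') - 1 / 2 * (R.RA (P k.castSucc) ψ + R.RA (P k.succ) ψ)) +
              (N * t - k - 1 / 2) * (r' - r) by ring]
          refine (abs_add_le _ _).trans (add_le_add h5 ?_)
          rw [abs_mul]
          refine mul_le_of_le_one_left (abs_nonneg _) (abs_le.2 ⟨?_, ?_⟩) <;> linarith
        · rw [grid_sub, abs_of_nonneg (inv_nonneg.2 (Nat.cast_nonneg N) : 0 ≤ (N : ℝ)⁻¹)]
          ring
    _ ≤ ‖a‖ * (c + d) := by
        rw [← Finset.mul_sum, Finset.sum_add_distrib]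
        gcongr
        exact sum_inv_mul_le hc

theorem integral_interpolation_mul_deriv {p p' : ℝ → ℝ} (hp : ∀ t, HasDerivAt p (p' t) t)
    (hp' : Continuous p') (hN : (N : ℝ) ≠ 0) (k : ℕ) (r r' w : ℝ) :
    (∫ t in (k / N : ℝ)..((k + 1) / N), (((k : ℝ) + 1 - N * t) * r + (N * t - k) * r') * p' t) +
      (∫ t in (k / N : ℝ)..((k + 1) / N), p t * w) -
      (p ((k + 1) / N) * r' - p (k / N) * r) =
      ∫ t in (k / N : ℝ)..((k + 1) / N), p t * (w - N * (r' - r)) := by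
  have hpc : Continuous p := continuous_iff_continuousAt.2 fun t => (hp t).continuousAt
  have e1 : (∫ t in (k / N : ℝ)..((k + 1) / N),
      ((N * (r' - r)) * p t + (((k : ℝ) + 1 - N * t) * r + (N * t - k) * r') * p' t)) =
      p ((k + 1) / N) * r' - p (k / N) * r := by
    rw [intervalIntegral.integral_eq_sub_of_hasDerivAt
      (f := fun t => (((k : ℝ) + 1 - N * t) * r + (N * t - k) * r') * p t) (fun t _ => ?_)
      (Continuous.intervalIntegrable (by fun_prop) _ _)]
    · rw [mul_div_cancel₀ _ hN, mul_div_cancel₀ _ hN]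
      ring
    · have h2 := (hasDerivAt_id t).const_mul (N : ℝ)
      have h1 : HasDerivAt (fun t : ℝ => ((k : ℝ) + 1 - N * t) * r + (N * t - k) * r')
          (N * (r' - r)) t := by
        refine (((h2.const_sub ((k : ℝ) + 1)).mul_const r).add
          ((h2.sub_const (k : ℝ)).mul_const r')).congr_deriv ?_
        ring
      exact h1.mul (hp t)
  rw [← e1, ← intervalIntegral.integral_add (Continuous.intervalIntegrable (by fun_prop) _ _)
    (Continuous.intervalIntegrable (by fun_prop) _ _), ← intervalIntegral.integral_sub
    (Continuous.intervalIntegrable (by fun_prop) _ _)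
    (Continuous.intervalIntegrable (by fun_prop) _ _)]
  refine intervalIntegral.integral_congr fun t _ => ?_
  ring

theorem coe_clamp {t : ℝ} (ht : t ∈ Icc (0 : ℝ) 1) : ((clamp t : unitInterval) : ℝ) = t := by
  rw [clamp, projIcc_of_mem _ ht]

theorem recCE_tensor (P : Fin (N + 1) → 𝒳) {a : C(unitInterval, ℝ)} {p : ℝ → ℝ}
    (ha : ∀ t : unitInterval, a t = p t) (ψ : C(X, ℝ)) :
    R.recCE P (tensor a ψ) = ∑ k : Fin N, ∫ t in (k / N : ℝ)..((k + 1) / N),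
      (((k : ℝ) + 1 - N * t) * R.RCE (P k.castSucc) ψ +
        (N * t - k) * R.RCE (P k.succ) ψ) * p t := by
  rw [recCE, sum_apply]
  refine Finset.sum_congr rfl fun k _ => ?_
  rw [timeIntegral_apply]
  refine intervalIntegral.integral_congr fun t ht => ?_
  rw [uIcc_of_le (grid_le N k)] at ht
  simp only [sliceFun_tensor, map_smul, add_apply, smul_apply, smul_eq_mul, ha,
    coe_clamp (grid_mem k ht).1]
  ring

theorem recY_tensorField (M : Fin N → 𝒴) {a : C(unitInterval, ℝ)} {p : ℝ → ℝ}
    (ha : ∀ t : unitInterval, a t = p t) (G : SpaceField I X) :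
    R.recY M (tensorField a G) = ∑ k : Fin N, ∫ t in (k / N : ℝ)..((k + 1) / N),
      p t * R.RY (M k) G := by
  rw [recY, sum_apply]
  refine Finset.sum_congr rfl fun k _ => ?_
  rw [timeIntegral_apply]
  refine intervalIntegral.integral_congr fun t ht => ?_
  rw [uIcc_of_le (grid_le N k)] at ht
  simp only [sliceField_tensorField, map_smul, smul_eq_mul, ha, coe_clamp (grid_mem k ht).1]

/-- The continuity equation for the reconstructions, on product test functions. -/
theorem abs_recCE_add_recY_sub_le {P : Fin (N + 1) → 𝒳} {M : Fin N → 𝒴} (hN : 1 ≤ N)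
    (h : ∀ k : Fin N, (N : ℝ) • (P k.succ - P k.castSucc) + D.Div (M k) = 0)
    {ψ : C(X, ℝ)} {G : SpaceField I X} {ε : ℝ}
    (hε : ∀ M, |R.RCE (D.Div M) ψ + R.RY M G| ≤ ε * ‖R.RY M‖)
    {p p' : ℝ → ℝ} (hp : ∀ t, HasDerivAt p (p' t) t) (hp' : Continuous p')
    {a a' : C(unitInterval, ℝ)} (ha : ∀ t : unitInterval, a t = p t)
    (ha' : ∀ t : unitInterval, a' t = p' t) :
    |R.recCE P (tensor a' ψ) + R.recY M (tensorField a G) -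
      (a 1 * R.RCE (P (Fin.last N)) ψ - a 0 * R.RCE (P 0) ψ)| ≤
      ‖a‖ * (ε * ((N : ℝ)⁻¹ * ∑ k, ‖R.RY (M k)‖)) := by
  have hN0 : (N : ℝ) ≠ 0 := by positivity
  let f : Fin (N + 1) → ℝ := fun j => p (j / N) * R.RCE (P j) ψ
  have hf : a 1 * R.RCE (P (Fin.last N)) ψ - a 0 * R.RCE (P 0) ψ =
      ∑ k : Fin N, (f k.succ - f k.castSucc) := by
    rw [sum_succ_sub_castSucc]
    simp [f, ha, div_self hN0]
  rw [hf, R.recCE_tensor P ha', R.recY_tensorField M ha, ← Finset.sum_add_distrib,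
    ← Finset.sum_sub_distrib]
  refine (Finset.abs_sum_le_sum_abs _ _).trans ?_
  rw [Finset.mul_sum, Finset.mul_sum, Finset.mul_sum]
  refine Finset.sum_le_sum fun k _ => ?_
  have key := integral_interpolation_mul_deriv hp hp' hN0 k (R.RCE (P k.castSucc) ψ)
    (R.RCE (P k.succ) ψ) (R.RY (M k) G)
  have e1 : f k.succ - f k.castSucc =
      p ((k + 1) / N) * R.RCE (P k.succ) ψ - p (k / N) * R.RCE (P k.castSucc) ψ := by
    simp only [f, Fin.val_succ, Fin.val_castSucc, Nat.cast_add, Nat.cast_one]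
  rw [e1, key, R.RCE_sub_apply h k ψ]
  refine (intervalIntegral.norm_integral_le_of_norm_le_const (E := ℝ)
    (C := ‖a‖ * (ε * ‖R.RY (M k)‖)) fun t ht => ?_).trans (le_of_eq ?_)
  · rw [uIoc_of_le (grid_le N k)] at ht
    rw [norm_mul, sub_neg_eq_add, add_comm (R.RY (M k) G)]
    refine mul_le_mul ?_ (hε _) (norm_nonneg _) (norm_nonneg _)
    have := a.norm_coe_le_norm (clamp t)
    rwa [ha, coe_clamp (grid_mem k (Ioc_subset_Icc_self ht)).1] at this
  · rw [grid_sub, abs_of_nonneg (inv_nonneg.2 (Nat.cast_nonneg N))]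
    ring

/-- The Legendre estimate of the reconstructed momentum by the energy. -/
theorem recY_apply_le {P : Fin (N + 1) → 𝒳} {M : Fin N → 𝒴} (b : SpaceTimeField I X)
    {a : Fin N → ℝ} {c : ℝ} (hc : 0 ≤ c)
    (h : ∀ (k : Fin N) (t : ℝ), R.RY (M k) (sliceField t b) ≤
      a k + actionStar (R.RA ((1 / 2 : ℝ) • (P k.castSucc + P k.succ))) (sliceField t b) + c) :
    R.recY M b ≤ (N : ℝ)⁻¹ * ∑ k, a k + 1 / 2 * R.recA P (normSq b) + c := by
  have h1 (k : Fin N) : timeIntegral sliceField continuous_sliceField norm_sliceField_le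
        (fun _ => R.RY (M k)) continuous_const (k / N) ((k + 1) / N) b ≤
      (N : ℝ)⁻¹ * a k + 1 / 2 * timeIntegral sliceFun continuous_sliceFun norm_sliceFun_le
        (fun _ => R.RA ((1 / 2 : ℝ) • (P k.castSucc + P k.succ))) continuous_const
        (k / N) ((k + 1) / N) (normSq b) + (N : ℝ)⁻¹ * c := by
    set Q := (1 / 2 : ℝ) • (P k.castSucc + P k.succ)
    have hi : IntervalIntegrable (fun t => R.RA Q (sliceFun t (normSq b))) volume
        (k / N) ((k + 1) / N) :=
      ((R.RA Q).continuous.comp (continuous_sliceFun _)).intervalIntegrable _ _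
    have h2 : timeIntegral sliceField continuous_sliceField norm_sliceField_le
        (fun _ => R.RY (M k)) continuous_const (k / N) ((k + 1) / N) b ≤
        ∫ t in (k / N : ℝ)..((k + 1) / N),
          ((a k + c) + 1 / 2 * R.RA Q (sliceFun t (normSq b))) := by
      refine intervalIntegral.integral_mono_on (grid_le N k)
        (((R.RY (M k)).continuous.comp (continuous_sliceField b)).intervalIntegrable _ _)
        ((intervalIntegrable_const).add (hi.const_mul _)) fun t _ => ?_
      refine (h k t).trans (le_of_eq ?_)
      change a k + 1 / 2 * R.RA Q (sliceFun t (normSq b)) + c = _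
      ring
    refine h2.trans (le_of_eq ?_)
    rw [intervalIntegral.integral_add intervalIntegrable_const (hi.const_mul _),
      intervalIntegral.integral_const, intervalIntegral.integral_const_mul, grid_sub,
      timeIntegral_apply, smul_eq_mul]
    ring
  rw [recY, recA, sum_apply, sum_apply, Finset.mul_sum,
    Finset.mul_sum]
  refine (Finset.sum_le_sum fun k _ => h1 k).trans ?_
  rw [Finset.sum_add_distrib, Finset.sum_add_distrib]
  gcongr
  exact sum_inv_mul_le hc

end Operators

end DiscreteEstimates

section MassBounds

variable {𝒳 𝒴 : Type*} [AddCommGroup 𝒳] [Module ℝ 𝒳] [AddCommGroup 𝒴] [Module ℝ 𝒴]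
  {E : Type*} [NormedAddCommGroup E] [NormedSpace ℝ E]
  {H : Type*} [TopologicalSpace H] {I : ModelWithCorners ℝ E H}
  {X : Type*} [EMetricSpace X] [CompactSpace X] [MeasurableSpace X] [BorelSpace X]
  [ChartedSpace H X] [IsManifold I 1 X]
  [RiemannianBundle (fun x : X => TangentSpace I x)]
  [IsContinuousRiemannianBundle E (fun x : X => TangentSpace I x)]
  {D : DiscreteModel 𝒳 𝒴} (R : Operators I X D) {N : ℕ}

theorem DiscreteModel.admissible_of_energy_ne_top {P₀ P₁ : 𝒳} {P : Fin (N + 1) → 𝒳}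
    {M : Fin N → 𝒴} (h : D.energy P₀ P₁ P M ≠ ⊤) : D.Admissible P₀ P₁ P M := by
  by_contra h'
  exact h (if_neg h')

theorem DiscreteModel.action_ne_top_of_energy_ne_top {P₀ P₁ : 𝒳} {P : Fin (N + 1) → 𝒳}
    {M : Fin N → 𝒴} (h : D.energy P₀ P₁ P M ≠ ⊤) (k : Fin N) :
    D.action ((1 / 2 : ℝ) • (P k.castSucc + P k.succ)) (M k) ≠ ⊤ := by
  rw [energy, if_pos (admissible_of_energy_ne_top h)] at h
  intro hk
  refine h ?_
  rw [ENNReal.sum_eq_top.2 ⟨k, Finset.mem_univ _, hk⟩,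
    ENNReal.mul_top (ENNReal.inv_ne_zero.2 (ENNReal.natCast_ne_top N))]

theorem DiscreteModel.toReal_energy {P₀ P₁ : 𝒳} {P : Fin (N + 1) → 𝒳}
    {M : Fin N → 𝒴} (h : D.energy P₀ P₁ P M ≠ ⊤) :
    (D.energy P₀ P₁ P M).toReal = (N : ℝ)⁻¹ *
      ∑ k : Fin N, (D.action ((1 / 2 : ℝ) • (P k.castSucc + P k.succ)) (M k)).toReal := by
  rw [energy, if_pos (admissible_of_energy_ne_top h), ENNReal.toReal_mul, ENNReal.toReal_inv,
    ENNReal.toReal_natCast, ENNReal.toReal_sum fun k _ => action_ne_top_of_energy_ne_top h k]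

namespace Operators

/-- The reconstructed densities and momenta are bounded in terms of the initial mass and of the
energy. -/
theorem exists_mass_bounds {P₀ P₁ : 𝒳} {P : Fin (N + 1) → 𝒳} {M : Fin N → 𝒴} {C ε ε' K : ℝ}
    (hC : 1 ≤ C) (hε : 0 ≤ ε) (hε' : ε' ≤ 1) (hεC : ε * C ≤ 1 / 2)
    (hadm : D.Admissible P₀ P₁ P M)
    (hA : ∀ k : Fin N, D.action ((1 / 2 : ℝ) • (P k.castSucc + P k.succ)) (M k) ≠ ⊤)
    (hK : (N : ℝ)⁻¹ * ∑ k : Fin N,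
      (D.action ((1 / 2 : ℝ) • (P k.castSucc + P k.succ)) (M k)).toReal ≤ K)
    (hequiv : ∀ Q : 𝒳, R.RA Q 1 - R.RCE Q 1 ≤ ε' * ‖R.RCE Q‖)
    (hdiv : ∀ M : 𝒴, |R.RCE (D.Div M) 1| ≤ ε * ‖R.RY M‖)
    (hstar : ∀ (b : SpaceField I X) (Q : 𝒳),
      D.actionStar Q (adjoint R.RY b) ≤ ((C / 2 * ‖R.RA Q‖ * ‖b‖ ^ 2 : ℝ) : EReal)) :
    (∀ k, ‖R.RCE (P k)‖ ≤ 2 * (R.RCE P₀ 1 + ε * K)) ∧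
    (∀ k : Fin N, ‖R.RA ((1 / 2 : ℝ) • (P k.castSucc + P k.succ))‖ ≤
      2 * (2 * (R.RCE P₀ 1 + ε * K))) ∧
    (N : ℝ)⁻¹ * ∑ k : Fin N, ‖R.RY (M k)‖ ≤ K + C * (2 * (R.RCE P₀ 1 + ε * K)) := by
  have hone : ∀ x : X, 0 ≤ (1 : C(X, ℝ)) x := fun _ => zero_le_one
  have hr (k) : 0 ≤ R.RCE (P k) 1 := R.RCE_pos _ (hadm.mem_cone k) _ hone
  have hRA (k : Fin N) : ‖R.RA ((1 / 2 : ℝ) • (P k.castSucc + P k.succ))‖ ≤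
      R.RCE (P k.castSucc) 1 + R.RCE (P k.succ) 1 := by
    have h1 := (R.isPositive_RA_mid hadm.mem_cone k).norm_le
    have h2 := (R.isPositive_RCE_mid hadm.mem_cone k).norm_le
    have h3 := hequiv ((1 / 2 : ℝ) • (P k.castSucc + P k.succ))
    have h4 := mul_le_mul_of_nonneg_right hε'
      (norm_nonneg (R.RCE ((1 / 2 : ℝ) • (P k.castSucc + P k.succ))))
    have h5 : R.RCE ((1 / 2 : ℝ) • (P k.castSucc + P k.succ)) 1 =
        1 / 2 * (R.RCE (P k.castSucc) 1 + R.RCE (P k.succ) 1) := by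
      rw [map_smul, map_add]
      rfl
    linarith
  have hy (k : Fin N) : ‖R.RY (M k)‖ ≤
      (D.action ((1 / 2 : ℝ) • (P k.castSucc + P k.succ)) (M k)).toReal +
        C * ((R.RCE (P k.castSucc) 1 + R.RCE (P k.succ) 1) / 2) := by
    refine norm_le_of_forall_apply_le fun b hb => ?_
    refine (DiscreteModel.apply_le_action_add R (hstar b _) (hA k)).trans ?_
    have h1 : ‖b‖ ^ 2 ≤ 1 := pow_le_one₀ (norm_nonneg _) hb
    have h2 : C / 2 * ‖R.RA ((1 / 2 : ℝ) • (P k.castSucc + P k.succ))‖ * ‖b‖ ^ 2 ≤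
        C / 2 * (R.RCE (P k.castSucc) 1 + R.RCE (P k.succ) 1) * 1 := by
      have := (norm_nonneg (E := Meas X) _).trans (hRA k)
      gcongr
      exact hRA k
    linarith
  have hdiff (k : Fin N) : |R.RCE (P k.succ) 1 - R.RCE (P k.castSucc) 1| ≤
      (N : ℝ)⁻¹ * (ε * ‖R.RY (M k)‖) := by
    have := R.abs_RCE_sub_le hadm.continuity (ψ := 1) (G := 0) (ε := ε)
      (fun M => by simpa using hdiv M) k
    simpa using this
  have hm (k) : R.RCE (P k) 1 ≤ 2 * (R.RCE P₀ 1 + ε * K) := by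
    have := le_of_abs_sub_le (r := fun k => R.RCE (P k) 1) (by linarith) hε hεC hr hdiff hy hK k
    simpa only [hadm.initial] using this
  refine ⟨fun k => (R.RCE_pos _ (hadm.mem_cone k)).norm_le.trans (hm k), fun k => ?_, ?_⟩
  · have h1 := hRA k
    have h2 := hm k.castSucc
    have h3 := hm k.succ
    linarith
  · refine mul_sum_add_mul_le (by linarith) ((hr 0).trans (hm 0)) (fun k => (hy k).trans ?_) hK
    have h2 := hm k.castSucc
    have h3 := hm k.succ
    gcongr
    linarith

end Operators

end MassBounds

section Sequences

theorem tendsto_apply_zero_of_approx {V : Type*} [NormedAddCommGroup V] [NormedSpace ℝ V]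
    {f : ℕ → StrongDual ℝ V} {c : ℝ} (hf : ∀ᶠ n in atTop, ‖f n‖ ≤ c) {v : V}
    (h : ∀ ε > 0, ∃ w, ‖w - v‖ ≤ ε ∧ Tendsto (fun n => f n w) atTop (𝓝 0)) :
    Tendsto (fun n => f n v) atTop (𝓝 0) := by
  rw [Metric.tendsto_nhds]
  intro ε hε
  have hc : 0 < |c| + 1 := by positivity
  obtain ⟨w, hw, hlim⟩ := h (ε / 2 / (|c| + 1)) (by positivity)
  filter_upwards [hf, (Metric.tendsto_nhds.1 hlim) (ε / 2) (by positivity)] with n hn hn'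
  rw [Real.dist_0_eq_abs] at hn' ⊢
  have h1 : |f n (w - v)| ≤ ε / 2 := by
    refine ((f n).le_opNorm _).trans ?_
    rw [le_div_iff₀ hc] at hw
    refine le_trans ?_ hw
    rw [mul_comm]
    gcongr
    linarith [le_abs_self c]
  have h2 : f n v = f n w - f n (w - v) := by rw [map_sub]; ring
  rw [h2]
  exact lt_of_le_of_lt (abs_sub _ _) (by linarith)

theorem norm_half_add_le {V : Type*} [NormedAddCommGroup V] [NormedSpace ℝ V]
    {f g : StrongDual ℝ V} {c : ℝ} (hf : ‖f‖ ≤ c) (hg : ‖g‖ ≤ c) : ‖(1 / 2 : ℝ) • (f + g)‖ ≤ c := by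
  have h1 := norm_add_le f g
  rw [norm_smul, Real.norm_of_nonneg (by norm_num)]
  linarith

theorem exists_subseq_tendsto_apply {V : Type*} [NormedAddCommGroup V] [NormedSpace ℝ V]
    [TopologicalSpace.SeparableSpace V] {f : ℕ → StrongDual ℝ V} {c : ℝ}
    (hf : ∀ᶠ n in atTop, ‖f n‖ ≤ c) :
    ∃ (ψ : ℕ → ℕ) (g : StrongDual ℝ V), StrictMono ψ ∧
      ∀ v, Tendsto (fun n => f (ψ n) v) atTop (𝓝 (g v)) := by
  obtain ⟨g, -, ψ, hψ, hg⟩ := (WeakDual.isSeqCompact_closedBall ℝ V (0 : StrongDual ℝ V)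
    c).subseq_of_frequently_in (x := fun n => StrongDual.toWeakDual (f n))
    (hf.mono fun n hn => by simpa using hn).frequently
  exact ⟨ψ, WeakDual.toStrongDual g, hψ, fun v => ((WeakDual.eval_continuous v).tendsto g).comp hg⟩

theorem norm_normSq_sub_le {E : Type*} [NormedAddCommGroup E] [NormedSpace ℝ E]
    {H : Type*} [TopologicalSpace H] {I : ModelWithCorners ℝ E H}
    {X : Type*} [TopologicalSpace X] [ChartedSpace H X] [IsManifold I 1 X]
    [RiemannianBundle (fun x : X => TangentSpace I x)]
    [IsContinuousRiemannianBundle E (fun x : X => TangentSpace I x)]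
    {T : Type*} [TopologicalSpace T] [CompactSpace T] {f : C(T, X)} (v w : VectorField I f) :
    ‖normSq v - normSq w‖ ≤ ‖v - w‖ * (‖v‖ + ‖w‖) := by
  refine (ContinuousMap.norm_le _ (by positivity)).2 fun t => ?_
  change ‖‖v t‖ ^ 2 - ‖w t‖ ^ 2‖ ≤ _
  have h1 : |‖v t‖ - ‖w t‖| ≤ ‖v - w‖ :=
    (abs_norm_sub_norm_le (v t) (w t)).trans ((v - w).norm_apply_le t)
  have h2 : |‖v t‖ + ‖w t‖| ≤ ‖v‖ + ‖w‖ := by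
    rw [abs_of_nonneg (by positivity)]
    exact add_le_add (v.norm_apply_le t) (w.norm_apply_le t)
  rw [sq_sub_sq, mul_comm, Real.norm_eq_abs, abs_mul]
  gcongr

variable {E : Type*} [NormedAddCommGroup E] [NormedSpace ℝ E] [FiniteDimensional ℝ E]
  {H : Type*} [TopologicalSpace H] {I : ModelWithCorners ℝ E H}
  {X : Type*} [EMetricSpace X] [CompactSpace X] [MeasurableSpace X] [BorelSpace X]
  [ChartedSpace H X] [IsManifold I ∞ X]
  [RiemannianBundle (fun x : X => TangentSpace I x)]
  [IsContinuousRiemannianBundle E (fun x : X => TangentSpace I x)]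
  {S : Set ℝ} {𝒳 𝒴 : S → Type*}
  [∀ σ, AddCommGroup (𝒳 σ)] [∀ σ, Module ℝ (𝒳 σ)]
  [∀ σ, AddCommGroup (𝒴 σ)] [∀ σ, Module ℝ (𝒴 σ)]
  {D : ∀ σ, DiscreteModel (𝒳 σ) (𝒴 σ)} {R : ∀ σ, Operators I X (D σ)}

/-- A sequence of admissible discrete densities and momenta, on time and space grids that become
fine, whose reconstructions are bounded by `c`. -/
structure IsBoundedSequence (R : ∀ σ, Operators I X (D σ)) (ρ₀ ρ₁ : Meas X) (σ : ℕ → S)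
    (N : ℕ → ℕ) (P : ∀ n, Fin (N n + 1) → 𝒳 (σ n)) (M : ∀ n, Fin (N n) → 𝒴 (σ n)) (c : ℝ) :
    Prop where
  nonneg : 0 ≤ c
  tendsto_space : Tendsto σ atTop (toZero S)
  tendsto_time : Tendsto N atTop atTop
  admissible : ∀ᶠ n in atTop,
    (D (σ n)).Admissible ((R (σ n)).SX ρ₀) ((R (σ n)).SX ρ₁) (P n) (M n)
  action_ne_top : ∀ᶠ n in atTop, ∀ k : Fin (N n),
    (D (σ n)).action ((1 / 2 : ℝ) • (P n k.castSucc + P n k.succ)) (M n k) ≠ ⊤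
  norm_RCE_le : ∀ᶠ n in atTop, ∀ k, ‖(R (σ n)).RCE (P n k)‖ ≤ c
  norm_RA_le : ∀ᶠ n in atTop, ∀ k : Fin (N n),
    ‖(R (σ n)).RA ((1 / 2 : ℝ) • (P n k.castSucc + P n k.succ))‖ ≤ c
  norm_RY_le : ∀ᶠ n in atTop, (N n : ℝ)⁻¹ * ∑ k, ‖(R (σ n)).RY (M n k)‖ ≤ c

/-- Sequences of finite energy are bounded. -/
theorem IsAdapted.exists_isBoundedSequence (hDR : IsAdapted D R) {ρ₀ ρ₁ : Meas X}
    (hρ₀ : IsPositive ρ₀) {σ : ℕ → S} (hσ : Tendsto σ atTop (toZero S)) {N : ℕ → ℕ}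
    (hN : Tendsto N atTop atTop) {P : ∀ n, Fin (N n + 1) → 𝒳 (σ n)}
    {M : ∀ n, Fin (N n) → 𝒴 (σ n)} {K : ℝ≥0∞} (hK : K ≠ ⊤)
    (h : ∀ᶠ n in atTop, (D (σ n)).energy ((R (σ n)).SX ρ₀) ((R (σ n)).SX ρ₁) (P n) (M n) ≤ K) :
    ∃ c, IsBoundedSequence R ρ₀ ρ₁ σ N P M c := by
  have h1 : ContMDiff I 𝓘(ℝ, ℝ) 2 (1 : C(X, ℝ)) := contMDiff_const
  have h1' : ContMDiff I 𝓘(ℝ, ℝ) 1 (1 : C(X, ℝ)) := contMDiff_const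
  obtain ⟨ε₂, hε₂, hequiv⟩ := hDR.rec_equiv _ (isBoundedCq_pair (q := 1) h1')
  obtain ⟨ε₃, hε₃, hdiv⟩ := hDR.rec_div _ (isBoundedCq_pair (q := 2) h1)
  obtain ⟨C, hC, hstar⟩ := hDR.actionStar_le_sup
  have hfin : ∀ᶠ n in atTop,
      (D (σ n)).energy ((R (σ n)).SX ρ₀) ((R (σ n)).SX ρ₁) (P n) (M n) ≠ ⊤ :=
    h.mono fun n hn => ne_top_of_le_ne_top hK hn
  have hε₂σ : ∀ᶠ n in atTop, ε₂ (σ n) ≤ 1 := (hε₂.comp hσ).eventually (ge_mem_nhds one_pos)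
  have hε₃σ : ∀ᶠ n in atTop, |ε₃ (σ n)| ≤ 1 / 2 / C := by
    have h2 := (hε₃.comp hσ).abs
    rw [abs_zero] at h2
    exact h2.eventually (ge_mem_nhds (by positivity))
  have hmass : ∀ᶠ n in atTop, (R (σ n)).RCE ((R (σ n)).SX ρ₀) 1 ≤ ρ₀ 1 + 1 :=
    ((hDR.rec_sampling ρ₀ hρ₀ 1).comp hσ).eventually (ge_mem_nhds (lt_add_one _))
  have hρ₀1 : 0 ≤ ρ₀ 1 := hρ₀ 1 fun _ => zero_le_one
  have hK0 : 0 ≤ K.toReal := ENNReal.toReal_nonneg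
  have hall : ∀ᶠ n in atTop, (∀ k, ‖(R (σ n)).RCE (P n k)‖ ≤ 2 * (ρ₀ 1 + 1 + K.toReal)) ∧
      (∀ k : Fin (N n), ‖(R (σ n)).RA ((1 / 2 : ℝ) • (P n k.castSucc + P n k.succ))‖ ≤
        2 * (2 * (ρ₀ 1 + 1 + K.toReal))) ∧
      (N n : ℝ)⁻¹ * ∑ k : Fin (N n), ‖(R (σ n)).RY (M n k)‖ ≤
        K.toReal + C * (2 * (ρ₀ 1 + 1 + K.toReal)) := by
    filter_upwards [hfin, h, hε₂σ, hε₃σ, hmass] with n hn hnK hn₂ hn₃ hn₀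
    have h3 : |ε₃ (σ n)| * C ≤ 1 / 2 := by rwa [le_div_iff₀ (by positivity)] at hn₃
    have h4 : |ε₃ (σ n)| ≤ 1 := by nlinarith [abs_nonneg (ε₃ (σ n))]
    have key := (R (σ n)).exists_mass_bounds (K := K.toReal) hC (abs_nonneg (ε₃ (σ n))) hn₂ h3
      (DiscreteModel.admissible_of_energy_ne_top hn)
      (DiscreteModel.action_ne_top_of_energy_ne_top hn)
      ((DiscreteModel.toReal_energy hn).symm.le.trans (ENNReal.toReal_mono hK hnK))
      (fun Q => ?_) (fun M => ?_) fun b Q => hstar b (σ n) Q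
    · obtain ⟨k1, k2, k3⟩ := key
      have h5 : (R (σ n)).RCE ((R (σ n)).SX ρ₀) 1 + |ε₃ (σ n)| * K.toReal ≤
          ρ₀ 1 + 1 + K.toReal := add_le_add hn₀ (mul_le_of_le_one_left hK0 h4)
      have hC0 : 0 ≤ C := by linarith
      refine ⟨fun k => (k1 k).trans ?_, fun k => (k2 k).trans ?_, k3.trans ?_⟩ <;> gcongr
    · have h5 := hequiv (σ n) (-1) (by simp) Q
      rw [map_neg, sub_apply] at h5
      linarith
    · have h5 := hdiv (σ n) M 1 (by simp) 0 (hasGradient_const 1)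
      rw [map_zero, add_zero] at h5
      exact h5.trans (mul_le_mul_of_nonneg_right (le_abs_self _) (norm_nonneg _))
  have hA : 0 ≤ 2 * (ρ₀ 1 + 1 + K.toReal) := by positivity
  have hB : 0 ≤ K.toReal + C * (2 * (ρ₀ 1 + 1 + K.toReal)) := by positivity
  refine ⟨2 * (2 * (ρ₀ 1 + 1 + K.toReal)) + (K.toReal + C * (2 * (ρ₀ 1 + 1 + K.toReal))),
    by positivity, hσ, hN, hfin.mono fun n hn => DiscreteModel.admissible_of_energy_ne_top hn,
    hfin.mono fun n hn => DiscreteModel.action_ne_top_of_energy_ne_top hn,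
    hall.mono fun n hn k => (hn.1 k).trans (by linarith),
    hall.mono fun n hn k => (hn.2.1 k).trans (by linarith),
    hall.mono fun n hn => hn.2.2.trans (by linarith)⟩

namespace IsBoundedSequence

variable {ρ₀ ρ₁ : Meas X} {σ : ℕ → S} {N : ℕ → ℕ} {P : ∀ n, Fin (N n + 1) → 𝒳 (σ n)}
  {M : ∀ n, Fin (N n) → 𝒴 (σ n)} {c : ℝ}

theorem comp (h : IsBoundedSequence R ρ₀ ρ₁ σ N P M c) {ψ : ℕ → ℕ} (hψ : Tendsto ψ atTop atTop) :
    IsBoundedSequence R ρ₀ ρ₁ (fun n => σ (ψ n)) (fun n => N (ψ n)) (fun n => P (ψ n))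
      (fun n => M (ψ n)) c where
  nonneg := h.nonneg
  tendsto_space := h.tendsto_space.comp hψ
  tendsto_time := h.tendsto_time.comp hψ
  admissible := hψ.eventually h.admissible
  action_ne_top := hψ.eventually h.action_ne_top
  norm_RCE_le := hψ.eventually h.norm_RCE_le
  norm_RA_le := hψ.eventually h.norm_RA_le
  norm_RY_le := hψ.eventually h.norm_RY_le

theorem norm_recCE_le (h : IsBoundedSequence R ρ₀ ρ₁ σ N P M c) :
    ∀ᶠ n in atTop, ‖(R (σ n)).recCE (P n)‖ ≤ c :=
  h.norm_RCE_le.mono fun n hn => (R (σ n)).norm_recCE_le h.nonneg hn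

theorem norm_recA_le (h : IsBoundedSequence R ρ₀ ρ₁ σ N P M c) :
    ∀ᶠ n in atTop, ‖(R (σ n)).recA (P n)‖ ≤ c :=
  h.norm_RA_le.mono fun n hn => (R (σ n)).norm_recA_le h.nonneg hn

theorem norm_recY_le (h : IsBoundedSequence R ρ₀ ρ₁ σ N P M c) :
    ∀ᶠ n in atTop, ‖(R (σ n)).recY (M n)‖ ≤ c :=
  h.norm_RY_le.mono fun n hn => ((R (σ n)).norm_recY_le (M n)).trans hn

/-- The two reconstructions of the density have the same limits, on product test functions. -/
theorem tendsto_recCE_sub_recA_tensor (h : IsBoundedSequence R ρ₀ ρ₁ σ N P M c)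
    (hDR : IsAdapted D R) (a : C(unitInterval, ℝ)) {ψ : C(X, ℝ)}
    (hψ : ContMDiff I 𝓘(ℝ, ℝ) 2 ψ) :
    Tendsto (fun n => (R (σ n)).recCE (P n) (tensor a ψ) - (R (σ n)).recA (P n) (tensor a ψ))
      atTop (𝓝 0) := by
  have hψ1 : ContMDiff I 𝓘(ℝ, ℝ) 1 ψ := hψ.of_le one_le_two
  obtain ⟨G, hG⟩ := exists_hasGradient hψ1
  obtain ⟨ε₂, hε₂, hequiv⟩ := hDR.rec_equiv _ (isBoundedCq_pair (q := 1) hψ1)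
  obtain ⟨ε₃, hε₃, hdiv⟩ := hDR.rec_div _ (isBoundedCq_pair (q := 2) hψ)
  have hlim : Tendsto (fun n => ‖a‖ * (|ε₂ (σ n)| * c +
      (N n : ℝ)⁻¹ * ((‖G‖ + |ε₃ (σ n)|) * c))) atTop (𝓝 0) := by
    have h2 := (hε₂.comp h.tendsto_space).abs
    have h3 := (hε₃.comp h.tendsto_space).abs
    have h4 := tendsto_inv_atTop_nhds_zero_nat (𝕜 := ℝ) |>.comp h.tendsto_time
    have := ((h2.mul_const c).add (h4.mul ((h3.const_add ‖G‖).mul_const c))).const_mul ‖a‖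
    simpa using this
  refine squeeze_zero_norm' ?_ hlim
  filter_upwards [h.admissible, h.norm_RCE_le, h.norm_RY_le] with n hadm hCE hY
  refine (R (σ n)).abs_recCE_sub_recA_le a (fun k => ?_)
    (mul_nonneg (abs_nonneg _) h.nonneg) ?_
  · have hmid : ‖(R (σ n)).RCE ((1 / 2 : ℝ) • (P n k.castSucc + P n k.succ))‖ ≤ c := by
      rw [map_smul, map_add]
      exact norm_half_add_le (hCE k.castSucc) (hCE k.succ)
    have h1 := hequiv (σ n) ψ (by simp) ((1 / 2 : ℝ) • (P n k.castSucc + P n k.succ))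
    have h2 := hequiv (σ n) (-ψ) (by simp) ((1 / 2 : ℝ) • (P n k.castSucc + P n k.succ))
    have h3 : ε₂ (σ n) * ‖(R (σ n)).RCE ((1 / 2 : ℝ) • (P n k.castSucc + P n k.succ))‖ ≤
        |ε₂ (σ n)| * c := mul_le_mul (le_abs_self _) hmid (norm_nonneg (E := Meas X) _)
          (abs_nonneg _)
    rw [map_neg] at h2
    rw [abs_le]
    constructor <;> linarith
  · have hε : ∀ M, |(R (σ n)).RCE ((D (σ n)).Div M) ψ + (R (σ n)).RY M G| ≤
        |ε₃ (σ n)| * ‖(R (σ n)).RY M‖ := fun M =>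
      (hdiv (σ n) M ψ (by simp) G hG).trans
        (mul_le_mul_of_nonneg_right (le_abs_self _) (norm_nonneg _))
    calc _ ≤ ∑ k : Fin (N n), (N n : ℝ)⁻¹ * ((N n : ℝ)⁻¹ *
          ((‖G‖ + |ε₃ (σ n)|) * ‖(R (σ n)).RY (M n k)‖)) := by
          refine Finset.sum_le_sum fun k _ => mul_le_mul_of_nonneg_left ?_ (by positivity)
          exact (R (σ n)).abs_RCE_sub_le hadm.continuity hε k
      _ = (N n : ℝ)⁻¹ * ((‖G‖ + |ε₃ (σ n)|) *
          ((N n : ℝ)⁻¹ * ∑ k, ‖(R (σ n)).RY (M n k)‖)) := by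
          rw [← Finset.mul_sum, ← Finset.mul_sum, ← Finset.mul_sum]
          ring
      _ ≤ _ := by gcongr

/-- The two reconstructions of the density have the same weak limits. -/
theorem tendsto_recCE_sub_recA (h : IsBoundedSequence R ρ₀ ρ₁ σ N P M c)
    (hDR : IsAdapted D R) (φ : C(unitInterval × X, ℝ)) :
    Tendsto (fun n => (R (σ n)).recCE (P n) φ - (R (σ n)).recA (P n) φ) atTop (𝓝 0) := by
  refine tendsto_apply_zero_of_approx
    (f := fun n => (R (σ n)).recCE (P n) - (R (σ n)).recA (P n)) (c := c + c) ?_ fun ε hε => ?_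
  · filter_upwards [h.norm_recCE_le, h.norm_recA_le] with n h1 h2
    exact (norm_sub_le _ _).trans (add_le_add h1 h2)
  · obtain ⟨n, ψ, hψ, hφ⟩ := exists_sum_tensor_approx I φ hε
    refine ⟨_, hφ, ?_⟩
    have := tendsto_finsetSum Finset.univ fun (k : Fin (n + 1)) _ =>
      h.tendsto_recCE_sub_recA_tensor hDR (bernstein n k)
        ((hψ k).of_le (WithTop.coe_le_coe.2 le_top))
    simpa only [sub_apply, map_sum, ← Finset.sum_sub_distrib, Finset.sum_const_zero] using this

/-- Weak limits of the reconstructions solve the continuity equation. -/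
theorem continuityEquation (h : IsBoundedSequence R ρ₀ ρ₁ σ N P M c)
    (hDR : IsAdapted D R) (hin : HasInwardDirection (range I)) (hρ₀ : IsPositive ρ₀)
    (hρ₁ : IsPositive ρ₁) {ρ : Meas (unitInterval × X)} {m : SpaceTimeVecMeas I X}
    (hρ : ∀ φ, Tendsto (fun n => (R (σ n)).recCE (P n) φ) atTop (𝓝 (ρ φ)))
    (hm : ∀ b, Tendsto (fun n => (R (σ n)).recY (M n) b) atTop (𝓝 (m b))) :
    ContinuityEquation ρ₀ ρ₁ ρ m := by
  refine continuityEquation_of_tensor hin fun j k ψ G hψ hG => ?_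
  obtain ⟨ε₃, hε₃, hdiv⟩ := hDR.rec_div _ (isBoundedCq_pair (q := 2) hψ)
  have hlim : Tendsto (fun n => ‖bernstein j k‖ * (|ε₃ (σ n)| * c)) atTop (𝓝 0) := by
    have := (((hε₃.comp h.tendsto_space).abs).mul_const c).const_mul ‖bernstein j k‖
    simpa using this
  have herr : Tendsto (fun n => (R (σ n)).recCE (P n) (tensor (bernsteinDeriv j k) ψ) +
      (R (σ n)).recY (M n) (tensorField (bernstein j k) G) -
      (bernstein j k 1 * (R (σ n)).RCE ((R (σ n)).SX ρ₁) ψ -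
        bernstein j k 0 * (R (σ n)).RCE ((R (σ n)).SX ρ₀) ψ)) atTop (𝓝 0) := by
    refine squeeze_zero_norm' ?_ hlim
    filter_upwards [h.admissible, h.norm_RY_le, h.tendsto_time.eventually_ge_atTop 1]
      with n hadm hY hn
    have hε : ∀ M, |(R (σ n)).RCE ((D (σ n)).Div M) ψ + (R (σ n)).RY M G| ≤
        |ε₃ (σ n)| * ‖(R (σ n)).RY M‖ := fun M =>
      (hdiv (σ n) M ψ (by simp) G hG).trans
        (mul_le_mul_of_nonneg_right (le_abs_self _) (norm_nonneg _))
    have key := (R (σ n)).abs_recCE_add_recY_sub_le hn hadm.continuity hε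
      (fun t => (bernsteinPolynomial ℝ j k).hasDerivAt t)
      (bernsteinPolynomial ℝ j k).derivative.continuous (a := bernstein j k)
      (a' := bernsteinDeriv j k) (fun _ => rfl) (fun _ => rfl)
    rw [hadm.initial, hadm.final] at key
    refine key.trans ?_
    gcongr
  have hL := (hρ (tensor (bernsteinDeriv j k) ψ)).add (hm (tensorField (bernstein j k) G))
  have hR := (((hDR.rec_sampling ρ₁ hρ₁ ψ).comp h.tendsto_space).const_mul
    (bernstein j k 1)).sub (((hDR.rec_sampling ρ₀ hρ₀ ψ).comp h.tendsto_space).const_mul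
    (bernstein j k 0))
  exact sub_eq_zero.1 (tendsto_nhds_unique (hL.sub hR) herr)

/-- The Legendre estimate of the limit momentum by the energies. -/
theorem apply_le_of_energy_le (h : IsBoundedSequence R ρ₀ ρ₁ σ N P M c)
    (hDR : IsAdapted D R) {ρ : Meas (unitInterval × X)} {m : SpaceTimeVecMeas I X}
    (hρ : ∀ φ, Tendsto (fun n => (R (σ n)).recA (P n) φ) atTop (𝓝 (ρ φ)))
    (hm : ∀ b, Tendsto (fun n => (R (σ n)).recY (M n) b) atTop (𝓝 (m b))) {L : ℝ}
    (hL : ∀ᶠ n in atTop, (N n : ℝ)⁻¹ * ∑ k : Fin (N n), ((D (σ n)).action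
      ((1 / 2 : ℝ) • (P n k.castSucc + P n k.succ)) (M n k)).toReal ≤ L)
    (b : SpaceTimeField I X) : m b ≤ L + 1 / 2 * ρ (normSq b) := by
  have hdense : ∀ (j : ℕ) (v : Fin (j + 1) → SpaceField I X), (∀ k, IsCqField 1 (v k)) →
      m (∑ k : Fin (j + 1), tensorField (bernstein j k) (v k)) ≤
        L + 1 / 2 * ρ (normSq (∑ k : Fin (j + 1), tensorField (bernstein j k) (v k))) := by
    intro j v hv
    set w := ∑ k : Fin (j + 1), tensorField (bernstein j k) (v k) with hw
    obtain ⟨ε₅, hε₅, hstar⟩ := hDR.actionStar_le _ (isBoundedCqField_combinations hv)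
    have hslice (t : ℝ) : sliceField t w ∈
        {u | ∃ c : Fin (j + 1) → ℝ, (∀ i, |c i| ≤ 1) ∧ u = ∑ i, c i • v i} := by
      refine ⟨fun i => bernstein j i (clamp t), fun i => ?_, ?_⟩
      · rw [abs_of_nonneg bernstein_nonneg, ← bernstein.probability j (clamp t)]
        exact Finset.single_le_sum (f := fun i : Fin (j + 1) => bernstein j i (clamp t))
          (fun _ _ => bernstein_nonneg) (Finset.mem_univ i)
      · rw [hw, map_sum]
        rfl
    have hR : Tendsto (fun n => L + 1 / 2 * (R (σ n)).recA (P n) (normSq w) + |ε₅ (σ n)| * c)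
        atTop (𝓝 (L + 1 / 2 * ρ (normSq w))) := by
      have := (((hρ (normSq w)).const_mul (1 / 2)).const_add L).add
        ((hε₅.comp h.tendsto_space).abs.mul_const c)
      simpa using this
    refine le_of_tendsto_of_tendsto (hm w) hR ?_
    filter_upwards [h.action_ne_top, h.norm_RA_le, hL] with n hA hRA hn
    have key := (R (σ n)).recY_apply_le (P := P n) (M := M n) w
      (a := fun k => ((D (σ n)).action
        ((1 / 2 : ℝ) • (P n k.castSucc + P n k.succ)) (M n k)).toReal)
      (mul_nonneg (abs_nonneg (ε₅ (σ n))) h.nonneg) fun k t => ?_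
    · refine key.trans ?_
      gcongr
    · refine (DiscreteModel.apply_le_action_add (R (σ n)) (hstar _ (hslice t) (σ n) _)
        (hA k)).trans ?_
      rw [add_assoc]
      gcongr
      · exact le_abs_self _
      · exact hRA k
  choose j v hv hvb using fun i : ℕ => exists_sum_tensorField_approx b
    (Nat.one_div_pos_of_nat (n := i) (α := ℝ))
  have hw : Tendsto (fun i => ∑ k : Fin (j i + 1), tensorField (bernstein (j i) k) (v i k))
      atTop (𝓝 b) := tendsto_iff_norm_sub_tendsto_zero.2 (squeeze_zero (fun _ => norm_nonneg _)
        hvb tendsto_one_div_add_atTop_nhds_zero_nat)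
  have hw2 : Tendsto (fun i => normSq (∑ k : Fin (j i + 1),
      tensorField (bernstein (j i) k) (v i k))) atTop (𝓝 (normSq b)) := by
    refine tendsto_iff_norm_sub_tendsto_zero.2 (squeeze_zero (fun _ => norm_nonneg _)
      (fun i => norm_normSq_sub_le _ _) ?_)
    have := (tendsto_iff_norm_sub_tendsto_zero.1 hw).mul (hw.norm.add_const ‖b‖)
    simpa using this
  exact le_of_tendsto_of_tendsto' ((m.continuous.tendsto b).comp hw)
    ((((ρ.continuous.tendsto _).comp hw2).const_mul (1 / 2)).const_add L)
    fun i => hdense _ _ (hv i)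

/-- Lower semicontinuity: the action of the limit is at most the limit of the energies. -/
theorem action_le_of_energy_le (h : IsBoundedSequence R ρ₀ ρ₁ σ N P M c)
    (hDR : IsAdapted D R) {ρ : Meas (unitInterval × X)} {m : SpaceTimeVecMeas I X}
    (hρ : ∀ φ, Tendsto (fun n => (R (σ n)).recA (P n) φ) atTop (𝓝 (ρ φ)))
    (hm : ∀ b, Tendsto (fun n => (R (σ n)).recY (M n) b) atTop (𝓝 (m b))) {L : ℝ}
    (hL : ∀ᶠ n in atTop, (N n : ℝ)⁻¹ * ∑ k : Fin (N n), ((D (σ n)).action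
      ((1 / 2 : ℝ) • (P n k.castSucc + P n k.succ)) (M n k)).toReal ≤ L) :
    action ρ m ≤ (L : EReal) := by
  refine iSup_le fun a => iSup_le fun b => iSup_le fun hab => EReal.coe_le_coe ?_
  have hpos : IsPositive ρ := fun φ hφ => ge_of_tendsto (hρ φ)
    (h.admissible.mono fun n hn => (R (σ n)).isPositive_recA hn.mem_cone φ hφ)
  have h1 := h.apply_le_of_energy_le hDR hρ hm hL b
  have h2 := hpos (-(a + (1 / 2 : ℝ) • normSq b)) fun p => by
    have h3 := hab p
    change 0 ≤ -(a p + 1 / 2 * ‖b p‖ ^ 2)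
    linarith
  rw [map_neg, map_add, map_smul, smul_eq_mul] at h2
  linarith

/-- Weak compactness of the reconstructions. -/
theorem exists_subseq (h : IsBoundedSequence R ρ₀ ρ₁ σ N P M c) (hDR : IsAdapted D R) :
    ∃ ψ : ℕ → ℕ, StrictMono ψ ∧ ∃ (ρ : Meas (unitInterval × X)) (m : SpaceTimeVecMeas I X),
      (∀ φ, Tendsto (fun n => (R (σ (ψ n))).recCE (P (ψ n)) φ) atTop (𝓝 (ρ φ))) ∧
      (∀ φ, Tendsto (fun n => (R (σ (ψ n))).recA (P (ψ n)) φ) atTop (𝓝 (ρ φ))) ∧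
      (∀ b, Tendsto (fun n => (R (σ (ψ n))).recY (M (ψ n)) b) atTop (𝓝 (m b))) := by
  have : SecondCountableTopology X := EMetric.secondCountable_of_sigmaCompact X
  have : TopologicalSpace.SeparableSpace (SpaceTimeField I X) := separableSpace_vectorField _
  obtain ⟨ψ₁, ρ, hψ₁, hρ⟩ := exists_subseq_tendsto_apply h.norm_recCE_le
  obtain ⟨ψ₂, m, hψ₂, hm⟩ := exists_subseq_tendsto_apply
    (hψ₁.tendsto_atTop.eventually h.norm_recY_le)
  have hψ := (hψ₁.comp hψ₂).tendsto_atTop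
  have hCE (φ) : Tendsto (fun n => (R (σ (ψ₁ (ψ₂ n)))).recCE (P (ψ₁ (ψ₂ n))) φ) atTop
      (𝓝 (ρ φ)) := (hρ φ).comp hψ₂.tendsto_atTop
  refine ⟨ψ₁ ∘ ψ₂, hψ₁.comp hψ₂, ρ, m, hCE, fun φ => ?_, hm⟩
  have h1 := (hCE φ).sub ((h.tendsto_recCE_sub_recA hDR φ).comp hψ)
  simpa using h1

end IsBoundedSequence

end Sequences

end DynamicOT

end

theorem theorem2p7
    {E : Type*} [NormedAddCommGroup E] [NormedSpace ℝ E] [FiniteDimensional ℝ E]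
    {H : Type*} [TopologicalSpace H] (I : ModelWithCorners ℝ E H)
    (hI : DynamicOT.IsHalfSpaceModel I)
    {X : Type*} [EMetricSpace X] [CompactSpace X] [MeasurableSpace X] [BorelSpace X]
    [ChartedSpace H X] [IsManifold I ∞ X]
    [RiemannianBundle (fun x : X => TangentSpace I x)]
    [IsContMDiffRiemannianBundle I ∞ E (fun x : X => TangentSpace I x)]
    [IsContinuousRiemannianBundle E (fun x : X => TangentSpace I x)]
    [IsRiemannianManifold I X]
    {S : Set ℝ} (hS : ∀ σ ∈ S, 0 < σ) (hS₀ : AccPt 0 (𝓟 S))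
    {𝒳 𝒴 : S → Type*}
    [∀ σ, AddCommGroup (𝒳 σ)] [∀ σ, Module ℝ (𝒳 σ)] [∀ σ, FiniteDimensional ℝ (𝒳 σ)]
    [∀ σ, AddCommGroup (𝒴 σ)] [∀ σ, Module ℝ (𝒴 σ)] [∀ σ, FiniteDimensional ℝ (𝒴 σ)]
    (D : ∀ σ, DynamicOT.DiscreteModel (𝒳 σ) (𝒴 σ))
    (R : ∀ σ, DynamicOT.Operators I X (D σ))
    (hDR : DynamicOT.IsAdapted D R)
    (ρ₀ ρ₁ : DynamicOT.Meas X)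
    (hρ₀ : DynamicOT.IsPositive ρ₀) (hρ₁ : DynamicOT.IsPositive ρ₁)
    (hmass : ρ₀ 1 = ρ₁ 1)
    (P : ∀ (N : ℕ) (σ : S), Fin (N + 1) → 𝒳 σ)
    (M : ∀ (N : ℕ) (σ : S), Fin N → 𝒴 σ)
    (hbdd : (⨆ (N : ℕ) (_ : 1 ≤ N) (σ : S),
      (D σ).energy ((R σ).SX ρ₀) ((R σ).SX ρ₁) (P N σ) (M N σ)) < ⊤)
    (N : ℕ → ℕ) (hN : Tendsto N atTop atTop)
    (σ : ℕ → S) (hσ : Tendsto (fun n => (σ n : ℝ)) atTop (𝓝 0)) :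
    ∃ ψ : ℕ → ℕ, StrictMono ψ ∧
      ∃ (ρ : DynamicOT.Meas (unitInterval × X)) (m : DynamicOT.SpaceTimeVecMeas I X),
        (∀ φ : C(unitInterval × X, ℝ), Tendsto
          (fun n => (R (σ (ψ n))).recCE (P (N (ψ n)) (σ (ψ n))) φ) atTop (𝓝 (ρ φ))) ∧
        (∀ φ : C(unitInterval × X, ℝ), Tendsto
          (fun n => (R (σ (ψ n))).recA (P (N (ψ n)) (σ (ψ n))) φ) atTop (𝓝 (ρ φ))) ∧
        (∀ b : DynamicOT.SpaceTimeField I X, Tendsto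
          (fun n => (R (σ (ψ n))).recY (M (N (ψ n)) (σ (ψ n))) b) atTop (𝓝 (m b))) ∧
        DynamicOT.ContinuityEquation ρ₀ ρ₁ ρ m ∧
        DynamicOT.energy ρ₀ ρ₁ ρ m ≤
          liminf (fun n => (((D (σ n)).energy ((R (σ n)).SX ρ₀) ((R (σ n)).SX ρ₁)
            (P (N n) (σ n)) (M (N n) (σ n)) : ℝ≥0∞) : EReal)) atTop := by
  have hσ' : Tendsto σ atTop (DynamicOT.toZero S) := tendsto_comap_iff.2 hσ
  set K := ⨆ (N : ℕ) (_ : 1 ≤ N) (σ : S),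
    (D σ).energy ((R σ).SX ρ₀) ((R σ).SX ρ₁) (P N σ) (M N σ)
  set J : ℕ → ℝ≥0∞ := fun n => (D (σ n)).energy ((R (σ n)).SX ρ₀) ((R (σ n)).SX ρ₁)
    (P (N n) (σ n)) (M (N n) (σ n))
  have hJ : ∀ᶠ n in atTop, J n ≤ K := (hN.eventually_ge_atTop 1).mono fun n hn =>
    le_iSup_of_le (N n) (le_iSup_of_le hn (le_iSup_of_le (σ n) le_rfl))
  obtain ⟨c, hc⟩ := hDR.exists_isBoundedSequence (ρ₁ := ρ₁) hρ₀ hσ' hN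
    (P := fun n => P (N n) (σ n)) (M := fun n => M (N n) (σ n)) hbdd.ne hJ
  obtain ⟨L, hL⟩ : ∃ L : ℝ, liminf (fun n => ((J n : ℝ≥0∞) : EReal)) atTop = L := by
    have h1 : liminf (fun n => ((J n : ℝ≥0∞) : EReal)) atTop ≤ (K : EReal) :=
      liminf_le_of_frequently_le' (hJ.mono fun n hn =>
        EReal.coe_ennreal_le_coe_ennreal_iff.2 hn).frequently
    have h2 : (0 : EReal) ≤ liminf (fun n => ((J n : ℝ≥0∞) : EReal)) atTop :=
      le_liminf_of_le (by isBoundedDefault)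
        (Eventually.of_forall fun n => EReal.coe_ennreal_nonneg _)
    have h3 : (K : EReal) < ⊤ := lt_top_iff_ne_top.2
      fun h => hbdd.ne (EReal.coe_ennreal_eq_top_iff.1 h)
    exact ⟨_, (EReal.coe_toReal (h1.trans_lt h3).ne
      (lt_of_lt_of_le EReal.bot_lt_zero h2).ne').symm⟩
  obtain ⟨ψ₁, hψ₁, hψL⟩ := extraction_forall_of_frequently
    (P := fun j n => ((J n : ℝ≥0∞) : EReal) < ((L + 1 / ((j : ℝ) + 1) : ℝ) : EReal)) fun j =>
      frequently_lt_of_liminf_lt (by isBoundedDefault) (by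
        rw [hL, EReal.coe_lt_coe_iff]
        exact lt_add_of_pos_right _ Nat.one_div_pos_of_nat)
  have hc₁ := hc.comp hψ₁.tendsto_atTop
  obtain ⟨ψ₂, hψ₂, ρ, m, hCE, hA, hY⟩ := hc₁.exists_subseq hDR
  have hc₂ := hc₁.comp hψ₂.tendsto_atTop
  have hcont : DynamicOT.ContinuityEquation ρ₀ ρ₁ ρ m :=
    hc₂.continuityEquation hDR hI.hasInwardDirection hρ₀ hρ₁ hCE hY
  refine ⟨ψ₁ ∘ ψ₂, hψ₁.comp hψ₂, ρ, m, hCE, hA, hY, hcont, ?_⟩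
  rw [DynamicOT.energy, if_pos hcont]
  change DynamicOT.action ρ m ≤ liminf (fun n => ((J n : ℝ≥0∞) : EReal)) atTop
  rw [hL]
  have hlim : Tendsto (fun j : ℕ => ((L + 1 / ((j : ℝ) + 1) : ℝ) : EReal)) atTop
      (𝓝 (L : EReal)) := by
    refine (continuous_coe_real_ereal.tendsto _).comp ?_
    simpa using tendsto_one_div_add_atTop_nhds_zero_nat.const_add L
  refine ge_of_tendsto' hlim fun j => hc₂.action_le_of_energy_le hDR hA hY ?_
  filter_upwards [(hψ₂.tendsto_atTop).eventually_ge_atTop j] with n hn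
  have h1 := hψL (ψ₂ n)
  have h2 : J (ψ₁ (ψ₂ n)) ≠ ⊤ := fun h => by
    rw [h] at h1
    exact not_top_lt h1
  rw [← EReal.coe_ennreal_toReal h2, EReal.coe_lt_coe_iff] at h1
  refine (DynamicOT.DiscreteModel.toReal_energy h2).symm.le.trans (h1.le.trans ?_)
  gcongr
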